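/- For a subset $A$ of a finite abelian group $G$, let $$T(A)=\#\{(x,y,z)\in A^3 : x+z=2y\}$$ be the number of three-term arithmetic progressions in $A$, including the trivial ones $x=y=z$. The density of $A$ is $\alpha=|A|/|G|$. There are absolute constants $C_1,C_2,C_3>0$ (independent of $G$ and $A$) such that the following hold. (i) For every finite abelian group $G$ of odd order and every $A\subset G$ of density $\alpha>0$, $$T(A)\ \ge\ \exp\!\left(-C_1\,\alpha^{-1}\bigl(\log(2/\alpha)\bigr)^{C_2}\right)|A|^2 .$$ (ii) For every finite abelian group $G$ of odd order with $|G|\ge 17$ (equivalently, for odd orders, $|G|>e$ and $\log\log|G|>1$) and every $A\subset G$ of density $$\alpha\ \ge\ \frac{(\log\log|G|)^{C_3}}{\log|G|},$$ the set $A$ contains a non-trivial three-term arithmetic progression, that is, there are $x,y,z\in A$, not all equal, with $x+z=2y$. -/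

import Mathlib

/-- `threeAPCount A B C` is the number of triples `(x, y, z) ∈ A × B × C` with `x + z = 2y`:
three-term progressions (trivial ones included) with starting point in `A`, mid-point in `B` and
end-point in `C`. -/
def threeAPCount {G : Type*} [AddCommGroup G] [DecidableEq G] (A B C : Finset G) : ℕ :=
  ((A ×ˢ B ×ˢ C).filter fun p => p.1 + p.2.2 = 2 • p.2.1).card

/-- `A` contains a three-term progression `(x, y, z)` that is not trivial, i.e. for which
`x = y = z` fails. -/
def HasNontrivialThreeAP {G : Type*} [AddCommGroup G] (A : Finset G) : Prop :=
  ∃ x ∈ A, ∃ y ∈ A, ∃ z ∈ A, x + z = 2 • y ∧ ¬ (x = y ∧ y = z)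

/-- The density `|A| / |G|` of a subset of a finite type, as a real number. -/
noncomputable def density {G : Type*} [Fintype G] (A : Finset G) : ℝ :=
  (A.card : ℝ) / (Fintype.card G : ℝ)

/-!
Averages over Bohr sets are replaced by averages against the probability weights proportional to
`exp (-N)`, where `N` is a multiple of a Bohr seminorm `x ↦ ∑ ‖γ x - 1‖`; such a weight changes by
at most a factor `exp (N t)` under a shift by `t`. If a function `h` of density `a` at some scale
has far fewer three-term progressions than expected there, then Croot–Sisask sampling shows that
the relevant convolution is almost invariant under many shifts, and a dissociated part of its
large spectrum, bounded through Riesz products, yields a finer weight at which `h` has density at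
least `(1 + 1 / 100) * a`. Only about `a⁻¹ log (8 / a) ^ 4` characters are added at each of the
`O(log (8 / a))` steps, so when the density can no longer grow the final weight still has mass
`exp (-O(a⁻¹ log (8 / a) ^ 7)) * |G|`, and the progressions counted at that scale suffice. Odd
order lets one halve elements and characters, hence move between the weights of `x` and `2 • x`.
Comparison with the `|A|` trivial progressions gives the second statement.
-/

open Finset

section Weights

variable {G : Type*} [AddCommGroup G] [Fintype G]

/-- The partition function of the weight `exp (-N)`. -/
noncomputable def expMass (N : AddGroupSeminorm G) : ℝ := ∑ x, Real.exp (-N x)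

/-- The probability weight on `G` proportional to `exp (-N)`. It plays the role of the uniform
measure on a ball of `N`, but distorts by at most a factor `exp (N t)` under a shift by `t`, so
that no regularity of the balls is needed. -/
noncomputable def expWeight (N : AddGroupSeminorm G) (x : G) : ℝ := Real.exp (-N x) / expMass N

/-- The average of `h` around `x` with respect to the weight `expWeight N`. -/
noncomputable def localDensity (N : AddGroupSeminorm G) (h : G → ℝ) (x : G) : ℝ :=
  ∑ t, expWeight N t * h (x + t)

/-- `N'` is finer than `N` at accuracy `θ`: a random element for the weight of `N'` has `N`-seminorm
at most `θ`, except with probability at most `θ`. -/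
def IsFiner (θ : ℝ) (N N' : AddGroupSeminorm G) : Prop :=
  ∑ t with θ < N t, expWeight N' t ≤ θ

lemma expMass_pos (N : AddGroupSeminorm G) : 0 < expMass N :=
  sum_pos (fun _ _ => Real.exp_pos _) univ_nonempty

lemma expWeight_pos (N : AddGroupSeminorm G) (x : G) : 0 < expWeight N x :=
  div_pos (Real.exp_pos _) (expMass_pos N)

lemma expWeight_nonneg (N : AddGroupSeminorm G) (x : G) : 0 ≤ expWeight N x :=
  (expWeight_pos N x).le

lemma sum_expWeight (N : AddGroupSeminorm G) : ∑ x, expWeight N x = 1 := by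
  simp only [expWeight, ← sum_div]
  exact div_self (expMass_pos N).ne'

lemma expWeight_mem_stdSimplex (N : AddGroupSeminorm G) : expWeight N ∈ stdSimplex ℝ G :=
  ⟨expWeight_nonneg N, sum_expWeight N⟩

lemma expWeight_neg (N : AddGroupSeminorm G) (x : G) : expWeight N (-x) = expWeight N x := by
  simp only [expWeight, map_neg_eq_map]

lemma le_expWeight_add (N : AddGroupSeminorm G) (x t : G) :
    Real.exp (-N t) * expWeight N x ≤ expWeight N (x + t) := by
  rw [expWeight, expWeight, ← mul_div_assoc, ← Real.exp_add]
  refine div_le_div_of_nonneg_right (Real.exp_le_exp.2 ?_) (expMass_pos N).le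
  linarith [map_add_le_add N x t]

lemma expWeight_add_le (N : AddGroupSeminorm G) (x t : G) :
    expWeight N (x + t) ≤ Real.exp (N t) * expWeight N x := by
  have h := le_expWeight_add N (x + t) (-t)
  rw [add_neg_cancel_right, map_neg_eq_map, Real.exp_neg] at h
  exact (inv_mul_le_iff₀ (Real.exp_pos _)).1 h

lemma expWeight_le_of_expMass {N : AddGroupSeminorm G} {H : ℝ}
    (hN : Real.exp (-H) * Fintype.card G ≤ expMass N) (x : G) :
    expWeight N x ≤ Real.exp H / Fintype.card G := by
  have hcard : (0 : ℝ) < Fintype.card G := Nat.cast_pos.2 Fintype.card_pos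
  rw [expWeight, div_le_div_iff₀ (expMass_pos N) hcard]
  have hx : Real.exp (-N x) ≤ 1 := Real.exp_le_one_iff.2 (neg_nonpos.2 (apply_nonneg N x))
  calc Real.exp (-N x) * Fintype.card G ≤ 1 * Fintype.card G := by gcongr
    _ = Real.exp H * (Real.exp (-H) * Fintype.card G) := by
      rw [← mul_assoc, ← Real.exp_add, add_neg_cancel, Real.exp_zero]
    _ ≤ Real.exp H * expMass N := by gcongr

lemma isFiner_of_le {N N' : AddGroupSeminorm G} {H l θ : ℝ} (hθ : 0 < θ) (hl : 0 ≤ l)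
    (hN' : Real.exp (-H) * Fintype.card G ≤ expMass N')
    (hle : ∀ x, l * N x ≤ N' x) (hlθ : H + Real.log (1 / θ) ≤ l * θ) : IsFiner θ N N' := by
  have htail : ∀ t ∈ univ.filter fun t => θ < N t, Real.exp (-N' t) ≤ θ * Real.exp (-H) := by
    intro t ht
    have hN't : H + Real.log (1 / θ) ≤ N' t :=
      hlθ.trans ((mul_le_mul_of_nonneg_left (mem_filter.1 ht).2.le hl).trans (hle t))
    calc Real.exp (-N' t) ≤ Real.exp (-(H + Real.log (1 / θ))) := by gcongr
      _ = θ * Real.exp (-H) := by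
        rw [neg_add, Real.exp_add, one_div, Real.log_inv, neg_neg, Real.exp_log hθ, mul_comm]
  simp only [IsFiner, expWeight]
  rw [← sum_div, div_le_iff₀ (expMass_pos N')]
  calc ∑ t with θ < N t, Real.exp (-N' t)
      ≤ ((univ.filter fun t => θ < N t).card : ℝ) * (θ * Real.exp (-H)) := by
        rw [← nsmul_eq_mul]
        exact sum_le_card_nsmul _ _ _ htail
    _ ≤ (Fintype.card G : ℝ) * (θ * Real.exp (-H)) := by gcongr; exact card_le_univ _
    _ = θ * (Real.exp (-H) * Fintype.card G) := by ring
    _ ≤ θ * expMass N' := by gcongr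

lemma IsFiner.one_sub_le {θ : ℝ} {N N' : AddGroupSeminorm G} (hf : IsFiner θ N N') :
    1 - θ ≤ ∑ t with N t ≤ θ, expWeight N' t := by
  have hsplit := sum_filter_add_sum_filter_not univ (fun t => N t ≤ θ) (expWeight N')
  simp only [sum_expWeight, not_le] at hsplit
  linarith [show ∑ t with θ < N t, expWeight N' t ≤ θ from hf]

lemma localDensity_zero (N : AddGroupSeminorm G) (h : G → ℝ) :
    localDensity N h 0 = ∑ x, expWeight N x * h x := by
  simp only [localDensity, zero_add]

lemma localDensity_nonneg (N : AddGroupSeminorm G) {h : G → ℝ} (h0 : ∀ x, 0 ≤ h x) (x : G) :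
    0 ≤ localDensity N h x :=
  sum_nonneg fun t _ => mul_nonneg (expWeight_nonneg N t) (h0 _)

lemma localDensity_le_one (N : AddGroupSeminorm G) {h : G → ℝ} (h1 : ∀ x, h x ≤ 1) (x : G) :
    localDensity N h x ≤ 1 := by
  rw [← sum_expWeight N]
  exact sum_le_sum fun t _ => mul_le_of_le_one_right (expWeight_nonneg N t) (h1 _)

lemma le_localDensity_add (N : AddGroupSeminorm G) {h : G → ℝ} (h0 : ∀ x, 0 ≤ h x) (x t : G) :
    Real.exp (-N t) * localDensity N h x ≤ localDensity N h (x + t) := by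
  rw [localDensity, localDensity, mul_sum,
    ← Equiv.sum_comp (Equiv.addRight (-t)) fun s => expWeight N s * h (x + t + s)]
  refine sum_le_sum fun s _ => ?_
  have hs := le_expWeight_add N s (-t)
  rw [map_neg_eq_map] at hs
  rw [Equiv.coe_addRight, show x + t + (s + -t) = x + s by abel, ← mul_assoc]
  exact mul_le_mul_of_nonneg_right hs (h0 _)

lemma sum_expWeight_mul_localDensity_comm (N N' : AddGroupSeminorm G) (h : G → ℝ) (x : G) :
    ∑ t, expWeight N' t * localDensity N h (x + t) =
      ∑ t, expWeight N t * localDensity N' h (x + t) := by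
  simp only [localDensity, mul_sum]
  rw [sum_comm]
  refine sum_congr rfl fun s _ => sum_congr rfl fun t _ => ?_
  rw [add_right_comm, mul_left_comm]

lemma IsFiner.le_sum_localDensity {θ : ℝ} {N N' : AddGroupSeminorm G} (hf : IsFiner θ N N')
    (hθ0 : 0 ≤ θ) (hθ1 : θ ≤ 1) {h : G → ℝ} (h0 : ∀ x, 0 ≤ h x) (x : G) :
    (1 - 2 * θ) * localDensity N h x ≤ ∑ t, expWeight N' t * localDensity N h (x + t) := by
  have hd := localDensity_nonneg N h0 x
  have hexp : 1 - 2 * θ ≤ (1 - θ) * Real.exp (-θ) := by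
    nlinarith [Real.add_one_le_exp (-θ)]
  calc (1 - 2 * θ) * localDensity N h x
      ≤ ((1 - θ) * Real.exp (-θ)) * localDensity N h x := by gcongr
    _ ≤ ((∑ t with N t ≤ θ, expWeight N' t) * Real.exp (-θ)) * localDensity N h x := by
        gcongr; exact hf.one_sub_le
    _ = ∑ t with N t ≤ θ, expWeight N' t * (Real.exp (-θ) * localDensity N h x) := by
        rw [mul_assoc, sum_mul]
    _ ≤ ∑ t with N t ≤ θ, expWeight N' t * localDensity N h (x + t) := by
        refine sum_le_sum fun t ht => mul_le_mul_of_nonneg_left ?_ (expWeight_nonneg _ _)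
        refine le_trans ?_ (le_localDensity_add N h0 x t)
        have hNt : N t ≤ θ := (mem_filter.1 ht).2
        gcongr
    _ ≤ ∑ t, expWeight N' t * localDensity N h (x + t) :=
        sum_le_sum_of_subset_of_nonneg (filter_subset _ _) fun t _ _ =>
          mul_nonneg (expWeight_nonneg _ _) (localDensity_nonneg N h0 _)

lemma exists_le_of_le_sum_mul {ι : Type*} [Fintype ι] {p f : ι → ℝ} (hp : p ∈ stdSimplex ℝ ι)
    {v : ℝ} (hv : v ≤ ∑ i, p i * f i) : ∃ i, v ≤ f i := by
  have hsum : ∑ i, p i * v ≤ ∑ i, p i * f i := by rwa [← sum_mul, hp.2, one_mul]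
  by_contra! hlt
  have hpf : ∀ i, p i * f i ≤ p i * v := fun i => mul_le_mul_of_nonneg_left (hlt i).le (hp.1 i)
  have hzero : ∀ i, p i = 0 := fun i => by
    have := (sum_eq_sum_iff_of_le fun i _ => hpf i).1
      ((sum_le_sum fun i _ => hpf i).antisymm hsum) i (mem_univ i)
    simpa only [mul_eq_mul_left_iff, (hlt i).ne, false_or] using this
  simpa only [hzero, sum_const_zero, zero_ne_one] using hp.2

/-- The two local densities average to about `a` each and never exceed `(1 + c) * a`, so a point
where their sum is at least its mean serves for both. -/
lemma exists_simultaneous_localDensity {θ c a : ℝ} {N N₁ N₂ : AddGroupSeminorm G}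
    (hf₁ : IsFiner θ N N₁) (hf₂ : IsFiner θ N N₂) (hθ0 : 0 ≤ θ) (hθ1 : θ ≤ 1 / 2)
    (hθc : 4 * θ ≤ c) (ha : 0 ≤ a) {h : G → ℝ} (h0 : ∀ x, 0 ≤ h x) {x : G}
    (hx : a ≤ localDensity N h x) (h₁ : ∀ y, localDensity N₁ h y ≤ (1 + c) * a)
    (h₂ : ∀ y, localDensity N₂ h y ≤ (1 + c) * a) :
    ∃ y, (1 - 2 * c) * a ≤ localDensity N₁ h y ∧ (1 - 2 * c) * a ≤ localDensity N₂ h y := by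
  have havg : ∀ {N' : AddGroupSeminorm G}, IsFiner θ N N' →
      (1 - 2 * θ) * a ≤ ∑ t, expWeight N t * localDensity N' h (x + t) := fun {N'} hf => by
    rw [← sum_expWeight_mul_localDensity_comm]
    exact (mul_le_mul_of_nonneg_left hx (by linarith)).trans
      (hf.le_sum_localDensity hθ0 (by linarith) h0 x)
  have hsum : 2 * ((1 - 2 * θ) * a) ≤
      ∑ t, expWeight N t * (localDensity N₁ h (x + t) + localDensity N₂ h (x + t)) := by
    simp only [mul_add, sum_add_distrib]
    linarith [havg hf₁, havg hf₂]
  obtain ⟨t, ht⟩ := exists_le_of_le_sum_mul (expWeight_mem_stdSimplex N) hsum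
  have hθa : 4 * θ * a ≤ c * a := by gcongr
  exact ⟨x + t, by linarith [h₂ (x + t)], by linarith [h₁ (x + t)]⟩

/-- The convolution of `h` with the probability weight proportional to `expWeight N * h`. -/
noncomputable def weightedConv (N : AddGroupSeminorm G) (h : G → ℝ) (u : G) : ℝ :=
  ∑ x, (expWeight N x * h x / localDensity N h 0) * h (u - x)

lemma weight_div_localDensity_mem_stdSimplex {N : AddGroupSeminorm G} {h : G → ℝ}
    (h0 : ∀ x, 0 ≤ h x) (hb : 0 < localDensity N h 0) :
    (fun x => expWeight N x * h x / localDensity N h 0) ∈ stdSimplex ℝ G :=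
  ⟨fun x => div_nonneg (mul_nonneg (expWeight_nonneg N x) (h0 x)) hb.le, by
    simp only [← sum_div, ← localDensity_zero, div_self hb.ne']⟩

lemma weightedConv_nonneg (N : AddGroupSeminorm G) {h : G → ℝ} (h0 : ∀ x, 0 ≤ h x) (u : G) :
    0 ≤ weightedConv N h u :=
  sum_nonneg fun x _ => mul_nonneg
    (div_nonneg (mul_nonneg (expWeight_nonneg N x) (h0 x)) (localDensity_nonneg N h0 0)) (h0 _)

lemma weightedConv_le_one {N : AddGroupSeminorm G} {h : G → ℝ} (h0 : ∀ x, 0 ≤ h x)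
    (h1 : ∀ x, h x ≤ 1) (hb : 0 < localDensity N h 0) (u : G) : weightedConv N h u ≤ 1 := by
  obtain ⟨hp0, hp1⟩ := weight_div_localDensity_mem_stdSimplex h0 hb
  rw [← hp1]
  exact sum_le_sum fun x _ => mul_le_of_le_one_right (hp0 x) (h1 _)

end Weights

section Sampling

variable {ι : Type*} [Fintype ι] {p : ι → ℝ}

lemma prod_mem_stdSimplex (hp : p ∈ stdSimplex ℝ ι) (k : ℕ) :
    (fun x : Fin k → ι => ∏ i, p (x i)) ∈ stdSimplex ℝ (Fin k → ι) :=
  ⟨fun _ => prod_nonneg fun _ _ => hp.1 _, by rw [← Fintype.sum_pow, hp.2, one_pow]⟩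

lemma sum_prod_mul_exp_sum (p X : ι → ℝ) (k : ℕ) (s : ℝ) :
    ∑ x : Fin k → ι, (∏ i, p (x i)) * Real.exp (s * ∑ i, X (x i)) =
      (∑ y, p y * Real.exp (s * X y)) ^ k := by
  rw [Fintype.sum_pow]
  refine sum_congr rfl fun x _ => ?_
  rw [prod_mul_distrib, mul_sum, Real.exp_sum]

lemma sum_mul_exp_le {X : ι → ℝ} (hp : p ∈ stdSimplex ℝ ι) (hX0 : ∀ y, 0 ≤ X y)
    (hX1 : ∀ y, X y ≤ 1) {s : ℝ} (hs : |s| ≤ 1) :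
    ∑ y, p y * Real.exp (s * X y) ≤ Real.exp ((∑ y, p y * X y) * (s + s ^ 2)) := by
  have hconv : ∀ y, Real.exp (s * X y) ≤ 1 + X y * (Real.exp s - 1) := fun y => by
    have := convexOn_exp.2 (Set.mem_univ 0) (Set.mem_univ s) (sub_nonneg.2 (hX1 y)) (hX0 y)
      (by ring)
    simp only [smul_eq_mul, mul_zero, zero_add, Real.exp_zero, mul_one] at this
    rw [mul_comm s]
    linarith
  have hmean : 0 ≤ ∑ y, p y * X y := sum_nonneg fun y _ => mul_nonneg (hp.1 y) (hX0 y)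
  have hexp : Real.exp s - 1 ≤ s + s ^ 2 := by
    linarith [(abs_le.1 (Real.abs_exp_sub_one_sub_id_le hs)).2]
  calc ∑ y, p y * Real.exp (s * X y) ≤ ∑ y, p y * (1 + X y * (Real.exp s - 1)) :=
        sum_le_sum fun y _ => mul_le_mul_of_nonneg_left (hconv y) (hp.1 y)
    _ = 1 + (∑ y, p y * X y) * (Real.exp s - 1) := by
        simp only [mul_add, mul_one, sum_add_distrib, hp.2, sum_mul, mul_assoc]
    _ ≤ 1 + (∑ y, p y * X y) * (s + s ^ 2) := by gcongr
    _ ≤ _ := by linarith [Real.add_one_le_exp ((∑ y, p y * X y) * (s + s ^ 2))]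

lemma sum_filter_lt_le_sum_mul_exp {w Y : ι → ℝ} (hw : ∀ i, 0 ≤ w i) (c : ℝ) :
    ∑ i with c < Y i, w i ≤ ∑ i, w i * Real.exp (Y i - c) :=
  calc ∑ i with c < Y i, w i ≤ ∑ i with c < Y i, w i * Real.exp (Y i - c) :=
        sum_le_sum fun i hi => le_mul_of_one_le_right (hw i)
          (Real.one_le_exp (sub_nonneg.2 (mem_filter.1 hi).2.le))
    _ ≤ _ := sum_le_sum_of_subset_of_nonneg (filter_subset _ _)
        fun i _ _ => mul_nonneg (hw i) (Real.exp_pos _).le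

lemma chernoff_one_sided {X : ι → ℝ} (hp : p ∈ stdSimplex ℝ ι) (hX0 : ∀ y, 0 ≤ X y)
    (hX1 : ∀ y, X y ≤ 1) {s a : ℝ} (hs : |s| ≤ 1) (ha : 0 ≤ a) (k : ℕ) :
    ∑ x : Fin k → ι with 2 * k * s ^ 2 * (∑ y, p y * X y + a) <
        s * (∑ i, X (x i) - k * ∑ y, p y * X y), ∏ i, p (x i) ≤ Real.exp (-(k * s ^ 2 * a)) := by
  set q := ∑ y, p y * X y
  have hq : 0 ≤ q := sum_nonneg fun y _ => mul_nonneg (hp.1 y) (hX0 y)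
  have hfactor : ∀ x : Fin k → ι, (∏ i, p (x i)) *
      Real.exp (s * (∑ i, X (x i) - k * q) - 2 * k * s ^ 2 * (q + a)) =
      ((∏ i, p (x i)) * Real.exp (s * ∑ i, X (x i))) *
        Real.exp (-s * k * q - 2 * k * s ^ 2 * (q + a)) := fun x => by
    rw [mul_assoc (∏ i, p (x i)), ← Real.exp_add]; congr 2; ring
  calc _ ≤ ∑ x : Fin k → ι, (∏ i, p (x i)) *
          Real.exp (s * (∑ i, X (x i) - k * q) - 2 * k * s ^ 2 * (q + a)) :=
        sum_filter_lt_le_sum_mul_exp (prod_mem_stdSimplex hp k).1 _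
    _ = (∑ y, p y * Real.exp (s * X y)) ^ k *
          Real.exp (-s * k * q - 2 * k * s ^ 2 * (q + a)) := by
        simp only [hfactor]
        rw [← sum_mul, sum_prod_mul_exp_sum]
    _ ≤ Real.exp (q * (s + s ^ 2)) ^ k * Real.exp (-s * k * q - 2 * k * s ^ 2 * (q + a)) := by
        gcongr
        · exact sum_nonneg fun y _ => mul_nonneg (hp.1 y) (Real.exp_pos _).le
        · exact sum_mul_exp_le hp hX0 hX1 hs
    _ = Real.exp (-(k * s ^ 2 * a) - k * s ^ 2 * (q + a)) := by
        rw [← Real.exp_nat_mul, ← Real.exp_add]; congr 1; ring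
    _ ≤ _ := Real.exp_le_exp.2 (sub_le_self _ (by positivity))

lemma chernoff_relative {X : ι → ℝ} (hp : p ∈ stdSimplex ℝ ι) (hX0 : ∀ y, 0 ≤ X y)
    (hX1 : ∀ y, X y ≤ 1) {ε a : ℝ} (hε0 : 0 < ε) (hε1 : ε ≤ 1) (ha : 0 ≤ a) (k : ℕ) :
    ∑ x : Fin k → ι with k * (ε * (∑ y, p y * X y + a)) < |∑ i, X (x i) - k * ∑ y, p y * X y|,
      ∏ i, p (x i) ≤ 2 * Real.exp (-(k * ε ^ 2 * a / 4)) := by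
  classical
  set q := ∑ y, p y * X y
  let tail (s : ℝ) : Finset (Fin k → ι) :=
    univ.filter fun x => 2 * k * s ^ 2 * (q + a) < s * (∑ i, X (x i) - k * q)
  have htail : ∀ s : ℝ, |s| = ε / 2 →
      ∑ x ∈ tail s, ∏ i, p (x i) ≤ Real.exp (-(k * ε ^ 2 * a / 4)) := fun s hs => by
    refine (chernoff_one_sided hp hX0 hX1 (hs.trans_le (by linarith)) ha k).trans_eq ?_
    rw [← sq_abs, hs]
    congr 1; ring
  have hcover : (univ.filter fun x : Fin k → ι => k * (ε * (q + a)) < |∑ i, X (x i) - k * q|) ⊆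
      tail (ε / 2) ∪ tail (-(ε / 2)) := fun x hx => by
    simp only [tail, mem_union, mem_filter, mem_univ, true_and, lt_abs] at hx ⊢
    refine hx.imp (fun h => ?_) fun h => ?_ <;>
    · have := mul_lt_mul_of_pos_left h (half_pos hε0)
      linarith
  have hnonneg : ∀ x : Fin k → ι, 0 ≤ ∏ i, p (x i) := (prod_mem_stdSimplex hp k).1
  calc _ ≤ ∑ x ∈ tail (ε / 2) ∪ tail (-(ε / 2)), ∏ i, p (x i) :=
        sum_le_sum_of_subset_of_nonneg hcover fun x _ _ => hnonneg x
    _ ≤ ∑ x ∈ tail (ε / 2), ∏ i, p (x i) + ∑ x ∈ tail (-(ε / 2)), ∏ i, p (x i) := by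
        rw [← sum_union_inter]
        exact le_add_of_nonneg_right (sum_nonneg fun x _ => hnonneg x)
    _ ≤ 2 * Real.exp (-(k * ε ^ 2 * a / 4)) := by
        rw [two_mul]
        have hε2 : |ε / 2| = ε / 2 := abs_of_pos (half_pos hε0)
        exact add_le_add (htail _ hε2) (htail _ (by rw [abs_neg, hε2]))

lemma half_le_sum_filter_of_sum_mul_le {f : ι → ℝ} (hp : p ∈ stdSimplex ℝ ι)
    (hf : ∀ i, 0 ≤ f i) {m : ℝ} (hm : 0 < m) (h : ∑ i, p i * f i ≤ m) :
    1 / 2 ≤ ∑ i with f i ≤ 2 * m, p i := by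
  have hsplit := sum_filter_add_sum_filter_not univ (fun i => f i ≤ 2 * m) p
  rw [hp.2] at hsplit
  have hmarkov : (∑ i with ¬ f i ≤ 2 * m, p i) * (2 * m) ≤ m := by
    rw [sum_mul]
    calc ∑ i with ¬ f i ≤ 2 * m, p i * (2 * m) ≤ ∑ i with ¬ f i ≤ 2 * m, p i * f i :=
          sum_le_sum fun i hi =>
            mul_le_mul_of_nonneg_left (not_le.1 (mem_filter.1 hi).2).le (hp.1 i)
      _ ≤ ∑ i, p i * f i := sum_le_sum_of_subset_of_nonneg (filter_subset _ _)
          fun i _ _ => mul_nonneg (hp.1 i) (hf i)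
      _ ≤ m := h
  have : ∑ i with ¬ f i ≤ 2 * m, p i ≤ 1 / 2 :=
    le_of_mul_le_mul_right (hmarkov.trans_eq (by ring)) (show 0 < 2 * m by positivity)
  linarith

/-- Chernoff's bound for each `u`, averaged over `u`, followed by Markov's inequality. -/
lemma half_le_sum_prod_of_exceptional_le {κ : Type*} [Fintype κ] {ω : κ → ℝ} {F : κ → ι → ℝ}
    (hp : p ∈ stdSimplex ℝ ι) (hω : ω ∈ stdSimplex ℝ κ) (hF0 : ∀ u y, 0 ≤ F u y)
    (hF1 : ∀ u y, F u y ≤ 1) {ε a : ℝ} (hε0 : 0 < ε) (hε1 : ε ≤ 1) (ha : 0 ≤ a) (k : ℕ) :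
    1 / 2 ≤ ∑ x : Fin k → ι with ∑ u with k * (ε * (∑ y, p y * F u y + a)) <
        |∑ i, F u (x i) - k * ∑ y, p y * F u y|, ω u ≤ 4 * Real.exp (-(k * ε ^ 2 * a / 4)),
      ∏ i, p (x i) := by
  set e := Real.exp (-(k * ε ^ 2 * a / 4))
  let exc (u : κ) (x : Fin k → ι) : Prop := k * (ε * (∑ y, p y * F u y + a)) <
    |∑ i, F u (x i) - k * ∑ y, p y * F u y|
  have hmean : ∑ x : Fin k → ι, (∏ i, p (x i)) * ∑ u with exc u x, ω u ≤ 2 * e :=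
    calc _ = ∑ u, ω u * ∑ x : Fin k → ι with exc u x, ∏ i, p (x i) := by
          simp only [sum_filter, mul_sum]
          rw [sum_comm]
          refine sum_congr rfl fun u _ => sum_congr rfl fun x _ => ?_
          split_ifs <;> ring
      _ ≤ ∑ u, ω u * (2 * e) := sum_le_sum fun u _ => mul_le_mul_of_nonneg_left
          (chernoff_relative hp (hF0 u) (hF1 u) hε0 hε1 ha k) (hω.1 u)
      _ = 2 * e := by rw [← sum_mul, hω.2, one_mul]
  have := half_le_sum_filter_of_sum_mul_le (prod_mem_stdSimplex hp k)
    (fun x => sum_nonneg fun u _ => hω.1 u) (by positivity) hmean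
  rwa [show 2 * (2 * e) = 4 * e by ring] at this

end Sampling

section AlmostPeriodicity

variable {G : Type*} [AddCommGroup G] [Fintype G]

lemma le_prod_expWeight_add (N : AddGroupSeminorm G) {k : ℕ} (x : Fin k → G) (t : G) :
    Real.exp (-(k * N t)) * ∏ i, expWeight N (x i) ≤ ∏ i, expWeight N (x i + t) := by
  have hpow : Real.exp (-(k * N t)) = ∏ _i : Fin k, Real.exp (-N t) := by
    rw [prod_const, ← Real.exp_nat_mul, card_univ, Fintype.card_fin, mul_neg]
  rw [hpow, ← prod_mul_distrib]
  exact prod_le_prod (fun i _ => mul_nonneg (Real.exp_pos _).le (expWeight_nonneg _ _))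
    fun i _ => le_expWeight_add N (x i) t

lemma half_mul_le_sum_shift_prod_expWeight {N : AddGroupSeminorm G} {k : ℕ} {t : G}
    (ht : k * N t ≤ 1 / 2) (L : Finset (Fin k → G)) :
    1 / 2 * ∑ x ∈ L, ∏ i, expWeight N (x i) ≤ ∑ x ∈ L, ∏ i, expWeight N (x i + t) := by
  have hexp : 1 / 2 ≤ Real.exp (-(k * N t)) := by linarith [Real.add_one_le_exp (-(k * N t))]
  have hL : 0 ≤ ∑ x ∈ L, ∏ i, expWeight N (x i) :=
    sum_nonneg fun x _ => prod_nonneg fun i _ => expWeight_nonneg _ _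
  refine (mul_le_mul_of_nonneg_right hexp hL).trans ?_
  rw [mul_sum]
  exact sum_le_sum fun x _ => le_prod_expWeight_add N x t

lemma exists_le_sum_filter_shift_mem {N : AddGroupSeminorm G} {r : G → ℝ} (hr : ∀ x, 0 ≤ r x)
    {S : Finset G} (hrS : 1 / 2 ≤ ∑ t ∈ S, r t) {k : ℕ} (hS : ∀ t ∈ S, k * N t ≤ 1 / 2)
    {L : Finset (Fin k → G)} {c : ℝ} (hc : 0 ≤ c) (hL : c ≤ ∑ x ∈ L, ∏ i, expWeight N (x i)) :
    ∃ y : Fin k → G, ∃ T ⊆ S, c / 4 ≤ ∑ t ∈ T, r t ∧ ∀ t ∈ T, (fun i => y i - t) ∈ L := by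
  classical
  have hshift : ∀ t ∈ S, c / 2 ≤
      ∑ y : Fin k → G, (∏ i, expWeight N (y i)) * if (fun i => y i - t) ∈ L then 1 else 0 := by
    intro t ht
    rw [← Equiv.sum_comp (Equiv.addRight fun _ : Fin k => t)]
    simp only [Equiv.coe_addRight, Pi.add_apply, add_sub_cancel_right, mul_ite, mul_one, mul_zero]
    rw [← sum_filter, filter_mem_eq_inter, univ_inter]
    linarith [half_mul_le_sum_shift_prod_expWeight (hS t ht) L]
  have havg : c / 4 ≤ ∑ y : Fin k → G, (∏ i, expWeight N (y i)) *
      ∑ t ∈ S, r t * if (fun i => y i - t) ∈ L then 1 else 0 := by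
    calc c / 4 = 1 / 2 * (c / 2) := by ring
      _ ≤ (∑ t ∈ S, r t) * (c / 2) := by gcongr
      _ ≤ ∑ t ∈ S, r t * ∑ y : Fin k → G, (∏ i, expWeight N (y i)) *
          if (fun i => y i - t) ∈ L then 1 else 0 := by
        rw [sum_mul]
        exact sum_le_sum fun t ht => mul_le_mul_of_nonneg_left (hshift t ht) (hr t)
      _ = _ := by
        simp only [mul_sum]
        rw [sum_comm]
        exact sum_congr rfl fun y _ => sum_congr rfl fun t _ => mul_left_comm _ _ _
  obtain ⟨y, hy⟩ :=
    exists_le_of_le_sum_mul (prod_mem_stdSimplex (expWeight_mem_stdSimplex N) k) havg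
  refine ⟨y, S.filter fun t => (fun i => y i - t) ∈ L, filter_subset _ _, ?_,
    fun t ht => (mem_filter.1 ht).2⟩
  simpa only [sum_filter, mul_ite, mul_one, mul_zero] using hy

/-- The points at which the shift of `g` by `t` fails to approximate `k * Φ`. The error allowed is
relative to `Φ`, with an additive term `a` for the points where `Φ` is small. -/
noncomputable def exceptionalSet (k ε a : ℝ) (Φ g : G → ℝ) (t : G) : Finset G :=
  univ.filter fun u => k * (ε * (Φ u + a)) < |g (u + t) - k * Φ u|

/-- Croot–Sisask almost periodicity. If the sample `y - t` is good, in that `∑ i, h (u - (y i - t))`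
approximates `k * weightedConv N h u`, then so does the shift by `t` of one and the same function
`g u = ∑ i, h (u - y i)`. -/
lemma exists_shift_set {N : AddGroupSeminorm G} {h ω r : G → ℝ} (h0 : ∀ x, 0 ≤ h x)
    (h1 : ∀ x, h x ≤ 1) (hb : 0 < localDensity N h 0) (hω : ω ∈ stdSimplex ℝ G)
    (hr : ∀ x, 0 ≤ r x) {S : Finset G} (hrS : 1 / 2 ≤ ∑ t ∈ S, r t) {k : ℕ}
    (hS : ∀ t ∈ S, k * N t ≤ 1 / 2) {ε a : ℝ} (hε0 : 0 < ε) (hε1 : ε ≤ 1) (ha : 0 ≤ a) :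
    ∃ g : G → ℝ, ∃ T ⊆ S, localDensity N h 0 ^ k / 8 ≤ ∑ t ∈ T, r t ∧
      ∀ t ∈ T, ∑ u ∈ exceptionalSet k ε a (weightedConv N h) g t, ω u ≤
        4 * Real.exp (-(k * ε ^ 2 * a / 4)) := by
  set b := localDensity N h 0
  have hp := weight_div_localDensity_mem_stdSimplex h0 hb
  let L : Finset (Fin k → G) := univ.filter fun x =>
    ∑ u with k * (ε * (weightedConv N h u + a)) <
      |∑ i, h (u - x i) - k * weightedConv N h u|, ω u ≤ 4 * Real.exp (-(k * ε ^ 2 * a / 4))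
  have hhalf : 1 / 2 ≤ ∑ x ∈ L, ∏ i, expWeight N (x i) * h (x i) / b :=
    half_le_sum_prod_of_exceptional_le (F := fun u x => h (u - x)) hp hω
      (fun _ _ => h0 _) (fun _ _ => h1 _) hε0 hε1 ha k
  have hdom : ∀ x : Fin k → G, b ^ k * ∏ i, expWeight N (x i) * h (x i) / b ≤
      ∏ i, expWeight N (x i) := fun x => by
    rw [show b ^ k = ∏ _i : Fin k, b by rw [prod_const, card_univ, Fintype.card_fin],
      ← prod_mul_distrib]
    refine prod_le_prod (fun i _ => mul_nonneg hb.le (hp.1 _)) fun i _ => ?_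
    rw [mul_div_cancel₀ _ hb.ne']
    exact mul_le_of_le_one_right (expWeight_nonneg _ _) (h1 _)
  have hL : b ^ k / 2 ≤ ∑ x ∈ L, ∏ i, expWeight N (x i) :=
    calc b ^ k / 2 = b ^ k * (1 / 2) := by ring
      _ ≤ b ^ k * ∑ x ∈ L, ∏ i, expWeight N (x i) * h (x i) / b := by gcongr
      _ ≤ _ := by rw [mul_sum]; exact sum_le_sum fun x _ => hdom x
  obtain ⟨y, T, hTS, hT, hTL⟩ := exists_le_sum_filter_shift_mem hr hrS hS (by positivity) hL
  refine ⟨fun v => ∑ i, h (v - y i), T, hTS, le_trans (by linarith) hT, fun t ht => ?_⟩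
  have hgood := (mem_filter.1 (hTL t ht)).2
  simpa only [exceptionalSet, weightedConv, add_sub_assoc, sub_sub_eq_add_sub] using hgood

end AlmostPeriodicity

section Smoothing

variable {G : Type*} [AddCommGroup G]

lemma map_sub_le_two_mul {N : AddGroupSeminorm G} {θ : ℝ} {t t' : G} (ht : N t ≤ θ)
    (ht' : N t' ≤ θ) : N (t - t') ≤ 2 * θ := by
  linarith [map_sub_le_add N t t']

variable [Fintype G]

/-- The convolution of `f` with `p` and with the reflection of `p`. -/
noncomputable def smoothing (p f : G → ℝ) (u : G) : ℝ :=
  ∑ t, ∑ t', p t * p t' * f (u + (t - t'))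

lemma sum_sum_mul_le {ι : Type*} [Fintype ι] {p : ι → ℝ} (hp : p ∈ stdSimplex ℝ ι)
    {X : ι → ι → ℝ} {C : ℝ} (hX : ∀ i j, p i ≠ 0 → p j ≠ 0 → X i j ≤ C) :
    ∑ i, ∑ j, p i * p j * X i j ≤ C := by
  calc ∑ i, ∑ j, p i * p j * X i j ≤ ∑ i, ∑ j, p i * p j * C := by
        refine sum_le_sum fun i _ => sum_le_sum fun j _ => ?_
        rcases eq_or_ne (p i) 0 with hi | hi
        · simp only [hi, zero_mul, le_refl]
        rcases eq_or_ne (p j) 0 with hj | hj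
        · simp only [hj, mul_zero, zero_mul, le_refl]
        exact mul_le_mul_of_nonneg_left (hX i j hi hj) (mul_nonneg (hp.1 i) (hp.1 j))
    _ = C := by simp only [← sum_mul, ← mul_sum, hp.2, mul_one, one_mul]

lemma smoothing_nonneg {p f : G → ℝ} (hp : ∀ t, 0 ≤ p t) (hf : ∀ u, 0 ≤ f u) (u : G) :
    0 ≤ smoothing p f u :=
  sum_nonneg fun t _ => sum_nonneg fun t' _ => mul_nonneg (mul_nonneg (hp t) (hp t')) (hf _)

lemma sum_smoothing_mul (p f φ : G → ℝ) :
    ∑ u, smoothing p f u * φ u = ∑ t, ∑ t', p t * p t' * ∑ u, f u * φ (u + (t - t')) :=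
  calc ∑ u, smoothing p f u * φ u = ∑ t, ∑ t', ∑ u, p t * p t' * f (u + (t - t')) * φ u := by
        simp only [smoothing, sum_mul]
        rw [sum_comm]
        exact sum_congr rfl fun t _ => sum_comm
    _ = ∑ t, ∑ t', p t' * p t * ∑ u, f u * φ (u + (t' - t)) := by
        refine sum_congr rfl fun t _ => sum_congr rfl fun t' _ => ?_
        rw [← Equiv.sum_comp (Equiv.addRight (t' - t)), mul_sum]
        refine sum_congr rfl fun u _ => ?_
        rw [Equiv.coe_addRight, add_assoc, sub_add_sub_cancel, sub_self, add_zero]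
        ring
    _ = _ := sum_comm

lemma sum_smoothing {p : G → ℝ} (hp : p ∈ stdSimplex ℝ G) (f : G → ℝ) :
    ∑ u, smoothing p f u = ∑ u, f u := by
  have := sum_smoothing_mul p f 1
  simp only [Pi.one_apply, mul_one] at this
  rw [this]
  simp only [← sum_mul, ← mul_sum, hp.2, mul_one, one_mul]

lemma smoothing_le {p f : G → ℝ} (hp : p ∈ stdSimplex ℝ G) {Q : AddGroupSeminorm G} {θ B : ℝ}
    (hpQ : ∀ t, p t ≠ 0 → Q t ≤ θ) (hB : 0 ≤ B) (hf : ∀ u, f u ≤ B * expWeight Q u) (u : G) :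
    smoothing p f u ≤ B * Real.exp (2 * θ) * expWeight Q u := by
  refine sum_sum_mul_le hp fun t t' ht ht' => (hf _).trans ?_
  have := expWeight_nonneg Q u
  calc B * expWeight Q (u + (t - t')) ≤ B * (Real.exp (Q (t - t')) * expWeight Q u) := by
        gcongr; exact expWeight_add_le Q u _
    _ ≤ B * (Real.exp (2 * θ) * expWeight Q u) := by
        gcongr; exact map_sub_le_two_mul (hpQ t ht) (hpQ t' ht')
    _ = B * Real.exp (2 * θ) * expWeight Q u := (mul_assoc _ _ _).symm

lemma smoothing_ne_zero {p f : G → ℝ} {N : AddGroupSeminorm G} {θ r : ℝ}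
    (hpN : ∀ t, p t ≠ 0 → N t ≤ θ) (hf : ∀ u, f u ≠ 0 → N u ≤ r) {u : G}
    (hu : smoothing p f u ≠ 0) : N u ≤ r + 2 * θ := by
  obtain ⟨t, _, ht⟩ := exists_ne_zero_of_sum_ne_zero hu
  obtain ⟨t', _, htt'⟩ := exists_ne_zero_of_sum_ne_zero ht
  have hN := map_sub_le_two_mul (hpN t (left_ne_zero_of_mul (left_ne_zero_of_mul htt')))
    (hpN t' (right_ne_zero_of_mul (left_ne_zero_of_mul htt')))
  have hsub := map_sub_le_add N (u + (t - t')) (t - t')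
  rw [add_sub_cancel_right] at hsub
  linarith [hf _ (right_ne_zero_of_mul htt')]

lemma sum_expWeight_filter_add_mem_le [DecidableEq G] (Q : AddGroupSeminorm G) (E : Finset G)
    (s : G) : ∑ u with u + s ∈ E, expWeight Q u ≤ Real.exp (Q s) * ∑ u ∈ E, expWeight Q u := by
  have hE : ∑ u with u + s ∈ E, expWeight Q u = ∑ u ∈ E, expWeight Q (u + -s) :=
    sum_bij' (fun u _ => u + s) (fun u _ => u + -s) (fun u hu => (mem_filter.1 hu).2)
      (fun u hu => mem_filter.2 ⟨mem_univ _, by rwa [neg_add_cancel_right]⟩)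
      (fun u _ => add_neg_cancel_right u s) (fun u _ => neg_add_cancel_right u s)
      (fun u _ => by rw [add_neg_cancel_right])
  rw [hE, mul_sum]
  refine sum_le_sum fun u _ => (expWeight_add_le Q u (-s)).trans_eq ?_
  rw [map_neg_eq_map]

lemma le_of_abs_sub_mul_le {φ ψ z k ε a : ℝ} (hφ : 0 ≤ φ) (hk : 0 < k) (hε0 : 0 ≤ ε)
    (hε1 : ε ≤ 1 / 3) (ha : 0 ≤ a) (hzφ : |z - k * φ| ≤ k * (ε * (φ + a)))
    (hzψ : |z - k * ψ| ≤ k * (ε * (ψ + a))) : ψ ≤ (1 + 3 * ε) * φ + 3 * ε * a := by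
  have hψφ : ψ - φ ≤ ε * (ψ + a) + ε * (φ + a) :=
    le_of_mul_le_mul_left (by linarith [(abs_le.1 hzφ).2, (abs_le.1 hzψ).1]) hk
  have hslack : 0 ≤ ε * (1 - 3 * ε) * (φ + a) :=
    mul_nonneg (mul_nonneg hε0 (by linarith)) (add_nonneg hφ ha)
  exact le_of_mul_le_mul_left (a := 1 - ε) (by linarith) (by linarith)

section AlmostPeriodic

variable {p f Φ g : G → ℝ} {Q : AddGroupSeminorm G} {θ B k ε a e : ℝ}

lemma mul_shift_le [DecidableEq G] (hf0 : ∀ u, 0 ≤ f u) (hf : ∀ u, f u ≤ B * expWeight Q u)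
    (hΦ0 : ∀ u, 0 ≤ Φ u) (hΦ1 : ∀ u, Φ u ≤ 1) (hB : 0 ≤ B) (hk : 0 < k) (hε0 : 0 ≤ ε)
    (hε1 : ε ≤ 1 / 3) (ha : 0 ≤ a) (t t' u : G) :
    f u * Φ (u + (t - t')) ≤ ((1 + 3 * ε) * (f u * Φ u) + 3 * ε * a * f u) +
      (B * (if u ∈ exceptionalSet k ε a Φ g t then expWeight Q u else 0) +
       B * (if u + (t - t') ∈ exceptionalSet k ε a Φ g t' then expWeight Q u else 0)) := by
  have hBQ : 0 ≤ B * expWeight Q u := mul_nonneg hB (expWeight_nonneg Q u)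
  have hmain : 0 ≤ (1 + 3 * ε) * (f u * Φ u) + 3 * ε * a * f u := by
    have := hf0 u; have := hΦ0 u; positivity
  have htriv : f u * Φ (u + (t - t')) ≤ B * expWeight Q u :=
    (mul_le_of_le_one_right (hf0 u) (hΦ1 _)).trans (hf u)
  split_ifs with ht ht' ht'
  · linarith
  · linarith
  · linarith
  · simp only [exceptionalSet, mem_filter, mem_univ, true_and, not_lt] at ht ht'
    rw [add_assoc, sub_add_cancel] at ht'
    have := mul_le_mul_of_nonneg_left
      (le_of_abs_sub_mul_le (hΦ0 u) hk hε0 hε1 ha ht ht') (hf0 u)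
    linarith

lemma sum_smoothing_mul_le (hp : p ∈ stdSimplex ℝ G) (hpQ : ∀ t, p t ≠ 0 → Q t ≤ θ) (hB : 0 ≤ B)
    (hf0 : ∀ u, 0 ≤ f u) (hf : ∀ u, f u ≤ B * expWeight Q u) (hΦ0 : ∀ u, 0 ≤ Φ u)
    (hΦ1 : ∀ u, Φ u ≤ 1) (hk : 0 < k) (hε0 : 0 ≤ ε) (hε1 : ε ≤ 1 / 3) (ha : 0 ≤ a)
    (hexc : ∀ t, p t ≠ 0 → ∑ u ∈ exceptionalSet k ε a Φ g t, expWeight Q u ≤ e) :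
    ∑ u, smoothing p f u * Φ u ≤
      (1 + 3 * ε) * ∑ u, f u * Φ u + 3 * ε * a * ∑ u, f u + B * (1 + Real.exp (2 * θ)) * e := by
  classical
  rw [sum_smoothing_mul]
  refine sum_sum_mul_le hp fun t t' ht ht' => ?_
  refine (sum_le_sum fun u _ => mul_shift_le (g := g) hf0 hf hΦ0 hΦ1 hB hk hε0 hε1 ha t t' u).trans
    ?_
  have hexc' : ∑ u with u + (t - t') ∈ exceptionalSet k ε a Φ g t', expWeight Q u ≤
      Real.exp (2 * θ) * e := by
    refine (sum_expWeight_filter_add_mem_le Q _ _).trans ?_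
    gcongr
    · exact sum_nonneg fun u _ => expWeight_nonneg Q u
    · exact map_sub_le_two_mul (hpQ t ht) (hpQ t' ht')
    · exact hexc t' ht'
  simp only [sum_add_distrib, ← mul_sum, ← sum_filter, filter_mem_eq_inter, univ_inter]
  linarith [mul_le_mul_of_nonneg_left (hexc t ht) hB, mul_le_mul_of_nonneg_left hexc' hB]

lemma iterate_smoothing_nonneg (hp : ∀ t, 0 ≤ p t) (hf : ∀ u, 0 ≤ f u) (j : ℕ) (u : G) :
    0 ≤ (smoothing p)^[j] f u := by
  induction j generalizing u with
  | zero => exact hf u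
  | succ j ih => rw [Function.iterate_succ_apply']; exact smoothing_nonneg hp ih u

lemma sum_iterate_smoothing (hp : p ∈ stdSimplex ℝ G) (f : G → ℝ) (j : ℕ) :
    ∑ u, (smoothing p)^[j] f u = ∑ u, f u := by
  induction j with
  | zero => rfl
  | succ j ih => rw [Function.iterate_succ_apply', sum_smoothing hp, ih]

lemma iterate_smoothing_le (hp : p ∈ stdSimplex ℝ G) (hpQ : ∀ t, p t ≠ 0 → Q t ≤ θ) (hB : 0 ≤ B)
    (hf : ∀ u, f u ≤ B * expWeight Q u) (j : ℕ) (u : G) :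
    (smoothing p)^[j] f u ≤ B * Real.exp (2 * θ * j) * expWeight Q u := by
  induction j generalizing u with
  | zero => simpa using hf u
  | succ j ih =>
    rw [Function.iterate_succ_apply']
    refine (smoothing_le hp hpQ (by positivity) ih u).trans_eq ?_
    rw [mul_assoc B, ← Real.exp_add]
    congr 3
    push_cast; ring

lemma iterate_smoothing_ne_zero {N : AddGroupSeminorm G} {r : ℝ}
    (hpN : ∀ t, p t ≠ 0 → N t ≤ θ) (hf : ∀ u, f u ≠ 0 → N u ≤ r) (j : ℕ) {u : G}
    (hu : (smoothing p)^[j] f u ≠ 0) : N u ≤ r + 2 * θ * j := by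
  induction j generalizing u with
  | zero => simpa using hf u hu
  | succ j ih =>
    rw [Function.iterate_succ_apply'] at hu
    refine (smoothing_ne_zero hpN (fun v hv => ih hv) hu).trans_eq ?_
    push_cast; ring

lemma sum_iterate_smoothing_mul_le (hp : p ∈ stdSimplex ℝ G) (hθ : 0 ≤ θ)
    (hpQ : ∀ t, p t ≠ 0 → Q t ≤ θ) (hB : 0 ≤ B) (hf0 : ∀ u, 0 ≤ f u) (hf1 : ∑ u, f u = 1)
    (hf : ∀ u, f u ≤ B * expWeight Q u) (hΦ0 : ∀ u, 0 ≤ Φ u) (hΦ1 : ∀ u, Φ u ≤ 1) (hk : 0 < k)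
    (hε0 : 0 ≤ ε) (hε1 : ε ≤ 1 / 3) (ha : 0 ≤ a) (he : 0 ≤ e)
    (hexc : ∀ t, p t ≠ 0 → ∑ u ∈ exceptionalSet k ε a Φ g t, expWeight Q u ≤ e)
    {l : ℕ} (hl : 2 * θ * l ≤ 1) :
    ∑ u, (smoothing p)^[l] f u * Φ u ≤
      (1 + 3 * ε) ^ l * (∑ u, f u * Φ u + l * (3 * ε * a + 12 * B * e)) := by
  have hexp : ∀ x : ℝ, x ≤ 1 → Real.exp x ≤ 3 := fun x hx =>
    (Real.exp_le_exp.2 hx).trans Real.exp_one_lt_three.le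
  induction l with
  | zero => simp
  | succ j ih =>
    push_cast [mul_add] at hl
    have hθj : 0 ≤ 2 * θ * j := by positivity
    have hbound : ∀ u, (smoothing p)^[j] f u ≤ (3 * B) * expWeight Q u := fun u => by
      refine (iterate_smoothing_le hp hpQ hB hf j u).trans ?_
      rw [mul_comm 3 B]
      gcongr
      · exact expWeight_nonneg Q u
      · exact hexp _ (by linarith)
    have hstep := sum_smoothing_mul_le hp hpQ (by positivity)
      (iterate_smoothing_nonneg hp.1 hf0 j) hbound hΦ0 hΦ1 hk hε0 hε1 ha hexc
    rw [sum_iterate_smoothing hp, hf1] at hstep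
    rw [Function.iterate_succ_apply']
    have herr : 3 * B * (1 + Real.exp (2 * θ)) * e ≤ 12 * B * e := by
      nlinarith [hexp (2 * θ) (by linarith), mul_nonneg hB he]
    have hpow : 1 ≤ (1 + 3 * ε) ^ (j + 1) := one_le_pow₀ (by linarith)
    calc _ ≤ (1 + 3 * ε) * ∑ u, (smoothing p)^[j] f u * Φ u + 1 * (3 * ε * a + 12 * B * e) := by
          linarith
      _ ≤ (1 + 3 * ε) * ((1 + 3 * ε) ^ j * (∑ u, f u * Φ u + j * (3 * ε * a + 12 * B * e))) +
          (1 + 3 * ε) ^ (j + 1) * (3 * ε * a + 12 * B * e) := by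
          gcongr
          exact ih (by linarith)
      _ = _ := by push_cast; ring

end AlmostPeriodic

end Smoothing

section Fourier

variable {G : Type*} [AddCommGroup G] [Fintype G]

/-- The unnormalised Fourier transform of a real function on a finite abelian group, with `χ` rather
than its conjugate in the kernel. -/
noncomputable def charSum (f : G → ℝ) (χ : AddChar G ℂ) : ℂ := ∑ x, (f x : ℂ) * χ x

lemma norm_charSum_le_one {p : G → ℝ} (hp : p ∈ stdSimplex ℝ G) (χ : AddChar G ℂ) :
    ‖charSum p χ‖ ≤ 1 := by
  refine (norm_sum_le _ _).trans_eq ((sum_congr rfl fun x _ => ?_).trans hp.2)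
  rw [norm_mul, AddChar.norm_apply, mul_one, Complex.norm_real, Real.norm_of_nonneg (hp.1 x)]

lemma conj_charSum (f : G → ℝ) (χ : AddChar G ℂ) :
    starRingEnd ℂ (charSum f χ) = ∑ x, (f x : ℂ) * χ (-x) := by
  simp only [charSum, map_sum, map_mul, Complex.conj_ofReal, AddChar.map_neg_eq_conj]

lemma charSum_comp_add_right (f : G → ℝ) (t : G) (χ : AddChar G ℂ) :
    charSum (fun x => f (x + t)) χ = χ (-t) * charSum f χ := by
  rw [charSum, charSum, ← Equiv.sum_comp (Equiv.addRight (-t)), mul_sum]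
  refine sum_congr rfl fun x _ => ?_
  rw [Equiv.coe_addRight, neg_add_cancel_right, AddChar.map_add_eq_mul]
  ring

lemma charSum_smoothing (p f : G → ℝ) (χ : AddChar G ℂ) :
    charSum (smoothing p f) χ = charSum f χ * (charSum p χ * starRingEnd ℂ (charSum p χ)) := by
  calc charSum (smoothing p f) χ
      = ∑ t, ∑ t', (p t * p t' : ℂ) * charSum (fun u => f (u + (t - t'))) χ := by
        simp only [charSum, smoothing, Complex.ofReal_sum, Complex.ofReal_mul, sum_mul, mul_sum]
        rw [sum_comm]
        refine sum_congr rfl fun t _ => ?_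
        rw [sum_comm]
        exact sum_congr rfl fun t' _ => sum_congr rfl fun u _ => mul_assoc _ _ _
    _ = charSum f χ * ∑ t, ∑ t', (p t * χ (-t)) * (p t' * χ t') := by
        simp only [charSum_comp_add_right, mul_sum]
        refine sum_congr rfl fun t _ => sum_congr rfl fun t' _ => ?_
        rw [neg_sub, sub_eq_neg_add, AddChar.map_add_eq_mul]
        ring
    _ = charSum f χ * (charSum p χ * starRingEnd ℂ (charSum p χ)) := by
        rw [← sum_mul_sum, ← conj_charSum, mul_comm (starRingEnd ℂ _)]
        rfl

lemma norm_charSum_iterate_smoothing (p f : G → ℝ) (χ : AddChar G ℂ) (j : ℕ) :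
    ‖charSum ((smoothing p)^[j] f) χ‖ = ‖charSum f χ‖ * ‖charSum p χ‖ ^ (2 * j) := by
  induction j with
  | zero => rw [Function.iterate_zero_apply, mul_zero, pow_zero, mul_one]
  | succ j ih =>
    rw [Function.iterate_succ_apply', charSum_smoothing, norm_mul, norm_mul, RCLike.norm_conj, ih]
    ring

lemma charSum_shift_sub (f : G → ℝ) (t : G) (χ : AddChar G ℂ) :
    charSum (fun v => f (v - t) - f v) χ = (χ t - 1) * charSum f χ := by
  have hshift := charSum_comp_add_right f (-t) χ
  simp only [neg_neg, ← sub_eq_add_neg] at hshift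
  rw [sub_one_mul, ← hshift]
  simp only [charSum, Complex.ofReal_sub, sub_mul, sum_sub_distrib]

lemma sum_addChar_sum_mul_apply [DecidableEq G] {ι : Type*} [Fintype ι] (c : ι → ℂ) (e : ι → G) :
    ∑ χ : AddChar G ℂ, ∑ i, c i * χ (e i) = Fintype.card G * ∑ i with e i = 0, c i := by
  rw [sum_comm, sum_filter, mul_sum]
  refine sum_congr rfl fun i _ => ?_
  rw [← mul_sum, AddChar.sum_apply_eq_ite, mul_ite, mul_ite, mul_zero, mul_zero, mul_comm]

lemma sum_norm_charSum_sq (f : G → ℝ) :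
    ∑ χ, ‖charSum f χ‖ ^ 2 = Fintype.card G * ∑ x, f x ^ 2 := by
  classical
  have hχ : ∀ χ : AddChar G ℂ, ((‖charSum f χ‖ ^ 2 : ℝ) : ℂ) =
      ∑ z : G × G, (f z.1 * f z.2 : ℂ) * χ (z.1 - z.2) := fun χ => by
    rw [Complex.ofReal_pow, ← Complex.mul_conj', conj_charSum, charSum, sum_mul_sum,
      Fintype.sum_prod_type]
    refine sum_congr rfl fun x _ => sum_congr rfl fun y _ => ?_
    rw [sub_eq_add_neg, AddChar.map_add_eq_mul]
    ring
  apply Complex.ofReal_injective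
  rw [Complex.ofReal_sum, sum_congr rfl fun χ _ => hχ χ, sum_addChar_sum_mul_apply, sum_filter,
    Fintype.sum_prod_type]
  simp only [sub_eq_zero, sum_ite_eq, mem_univ, if_true]
  push_cast
  simp only [sq]

lemma sum_charSum_mul_conj_charSum_sq (f ψ : G → ℝ) :
    ∑ χ, charSum ψ χ * starRingEnd ℂ (charSum f χ) ^ 2 =
      ((Fintype.card G * ∑ v, ∑ x, ψ v * (f x * f (v - x)) : ℝ) : ℂ) := by
  classical
  have hχ : ∀ χ : AddChar G ℂ, charSum ψ χ * starRingEnd ℂ (charSum f χ) ^ 2 =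
      ∑ z : G × G × G, (ψ z.1 * f z.2.1 * f z.2.2 : ℂ) * χ (z.1 - z.2.1 - z.2.2) := fun χ => by
    rw [sq, conj_charSum, charSum, sum_mul_sum, sum_mul]
    simp only [mul_sum, Fintype.sum_prod_type]
    refine sum_congr rfl fun v _ => sum_congr rfl fun x _ => sum_congr rfl fun y _ => ?_
    rw [sub_eq_add_neg, sub_eq_add_neg, AddChar.map_add_eq_mul, AddChar.map_add_eq_mul]
    ring
  rw [sum_congr rfl fun χ _ => hχ χ, sum_addChar_sum_mul_apply, sum_filter]
  simp only [Fintype.sum_prod_type, sub_eq_zero, sum_ite_eq, mem_univ, if_true]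
  push_cast
  simp only [mul_assoc]

lemma abs_sum_sum_mul_le {f ψ : G → ℝ} {M : ℝ} (hM : ∀ χ, ‖charSum ψ χ‖ ≤ M) :
    |∑ v, ∑ x, ψ v * (f x * f (v - x))| ≤ M * ∑ x, f x ^ 2 := by
  have hcard : (0 : ℝ) < Fintype.card G := Nat.cast_pos.2 Fintype.card_pos
  refine le_of_mul_le_mul_left ?_ hcard
  calc Fintype.card G * |∑ v, ∑ x, ψ v * (f x * f (v - x))|
      = ‖∑ χ, charSum ψ χ * starRingEnd ℂ (charSum f χ) ^ 2‖ := by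
        rw [sum_charSum_mul_conj_charSum_sq, Complex.norm_real, Real.norm_eq_abs, abs_mul,
          abs_of_pos hcard]
    _ ≤ ∑ χ, M * ‖charSum f χ‖ ^ 2 := by
        refine (norm_sum_le _ _).trans (sum_le_sum fun χ _ => ?_)
        rw [norm_mul, norm_pow, RCLike.norm_conj]
        exact mul_le_mul_of_nonneg_right (hM χ) (sq_nonneg _)
    _ = Fintype.card G * (M * ∑ x, f x ^ 2) := by
        rw [← mul_sum, sum_norm_charSum_sq, mul_left_comm]

end Fourier

section RieszProduct

variable {G : Type*} [AddCommGroup G]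

/-- The coefficients of the factor `1 + Re (c z) / 8` of a Riesz product, as a trigonometric
polynomial in `z`. -/
noncomputable def rieszCoeff (c : ℂ) : SignType → ℂ
  | 0 => 1
  | 1 => c / 16
  | -1 => starRingEnd ℂ c / 16

/-- The Riesz product of the characters `χ i` with phases `c i`. The constant `8` keeps its factors
so close to `1` that their logarithms are essentially linear. -/
noncomputable def rieszProduct {ι : Type*} [Fintype ι] (c : ι → ℂ) (χ : ι → AddChar G ℂ) (x : G) :
    ℝ :=
  ∏ i, (1 + (c i * χ i x).re / 8)

lemma norm_rieszCoeff_le {c : ℂ} (hc : ‖c‖ ≤ 1) (s : SignType) : ‖rieszCoeff c s‖ ≤ 1 := by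
  cases s
  · exact norm_one.le
  · change ‖starRingEnd ℂ c / 16‖ ≤ 1
    rw [norm_div, RCLike.norm_conj, RCLike.norm_ofNat]
    linarith
  · change ‖c / 16‖ ≤ 1
    rw [norm_div, RCLike.norm_ofNat]
    linarith

lemma sum_rieszCoeff_mul {c z : ℂ} (hz : ‖z‖ = 1) :
    ∑ s : SignType, rieszCoeff c s * z ^ (s : ℤ) = ((1 + (c * z).re / 8 : ℝ) : ℂ) := by
  have huniv : (univ : Finset SignType) = {0, -1, 1} := rfl
  rw [huniv, sum_insert (by decide), sum_insert (by decide), sum_singleton]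
  change 1 * z ^ (0 : ℤ) + (starRingEnd ℂ c / 16 * z ^ (-1 : ℤ) + c / 16 * z ^ (1 : ℤ)) = _
  push_cast
  rw [Complex.re_eq_add_conj, map_mul, zpow_zero, zpow_neg_one, zpow_one, Complex.inv_eq_conj hz]
  ring

lemma abs_re_mul_apply_div_le [Finite G] {c : ℂ} (hc : ‖c‖ ≤ 1) (χ : AddChar G ℂ) (x : G) :
    |(c * χ x).re / 8| ≤ 1 / 8 := by
  rw [abs_div, abs_of_pos (by norm_num : (0 : ℝ) < 8)]
  gcongr
  calc |(c * χ x).re| ≤ ‖c * χ x‖ := Complex.abs_re_le_norm _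
    _ ≤ 1 := by rwa [norm_mul, AddChar.norm_apply, mul_one]

lemma exp_sub_le_one_add {z : ℝ} (hz : |z| ≤ 1 / 8) : Real.exp (z - 2 * z ^ 2) ≤ 1 + z := by
  obtain ⟨hz1, hz2⟩ := abs_le.1 hz
  have hy : |z - 2 * z ^ 2| ≤ 1 := abs_le.2 ⟨by nlinarith, by nlinarith⟩
  have hexp := (abs_le.1 (Real.abs_exp_sub_one_sub_id_le hy)).2
  have hsq : (z - 2 * z ^ 2) ^ 2 ≤ z ^ 2 * 2 := by
    rw [show (z - 2 * z ^ 2) ^ 2 = z ^ 2 * (1 - 2 * z) ^ 2 by ring]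
    gcongr
    nlinarith
  linarith

variable {ι : Type*} [Fintype ι]

lemma ofReal_rieszProduct [Finite G] [DecidableEq ι] (c : ι → ℂ) (χ : ι → AddChar G ℂ) (x : G) :
    (rieszProduct c χ x : ℂ) =
      ∑ e : ι → SignType, (∏ i, rieszCoeff (c i) (e i)) * (∏ i, χ i ^ (e i : ℤ)) x := by
  rw [rieszProduct, Complex.ofReal_prod]
  simp only [← sum_rieszCoeff_mul (AddChar.norm_apply (χ _) x), Fintype.prod_sum,
    prod_mul_distrib, AddChar.prod_apply, AddChar.zpow_apply]

lemma rieszProduct_nonneg [Finite G] {c : ι → ℂ} (hc : ∀ i, ‖c i‖ ≤ 1) (χ : ι → AddChar G ℂ)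
    (x : G) : 0 ≤ rieszProduct c χ x :=
  prod_nonneg fun i _ => by linarith [(abs_le.1 (abs_re_mul_apply_div_le (hc i) (χ i) x)).1]

/-- By Jensen's inequality, since `log (1 + z)` is at least `z - 2 * z ^ 2`. -/
lemma exp_card_le_sum_mul_rieszProduct [Fintype G] {p : G → ℝ} (hp : p ∈ stdSimplex ℝ G) {c : ι → ℂ}
    (hc : ∀ i, ‖c i‖ ≤ 1) {χ : ι → AddChar G ℂ} (hχ : ∀ i, 1 / 2 ≤ (c i * charSum p (χ i)).re) :
    Real.exp (Fintype.card ι / 32) ≤ ∑ x, p x * rieszProduct c χ x := by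
  set z : ι → G → ℝ := fun i x => (c i * χ i x).re / 8
  have hz : ∀ i x, |z i x| ≤ 1 / 8 := fun i => abs_re_mul_apply_div_le (hc i) (χ i)
  have hmean : ∀ i, 1 / 16 ≤ ∑ x, p x * z i x := fun i => by
    have hre : ∑ x, p x * z i x = (c i * charSum p (χ i)).re / 8 := by
      rw [charSum, mul_sum, Complex.re_sum, sum_div]
      refine sum_congr rfl fun x _ => ?_
      rw [mul_left_comm, Complex.re_ofReal_mul, mul_div_assoc]
    linarith [hχ i]
  have hsq : ∀ i, ∑ x, p x * (2 * z i x ^ 2) ≤ 1 / 32 := fun i => by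
    calc ∑ x, p x * (2 * z i x ^ 2) ≤ ∑ x, p x * (1 / 32) := by
          refine sum_le_sum fun x _ => mul_le_mul_of_nonneg_left ?_ (hp.1 x)
          linarith [sq_le_sq.2 ((hz i x).trans (le_abs_self _))]
      _ = 1 / 32 := by rw [← sum_mul, hp.2, one_mul]
  have hexponent : (Fintype.card ι : ℝ) / 32 ≤ ∑ x, p x * ∑ i, (z i x - 2 * z i x ^ 2) := by
    calc (Fintype.card ι : ℝ) / 32 = ∑ _i : ι, (1 / 32 : ℝ) := by
          rw [sum_const, card_univ, nsmul_eq_mul, mul_one_div]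
      _ ≤ ∑ i, ∑ x, p x * (z i x - 2 * z i x ^ 2) := by
          refine sum_le_sum fun i _ => ?_
          simp only [mul_sub, sum_sub_distrib]
          linarith [hmean i, hsq i]
      _ = ∑ x, p x * ∑ i, (z i x - 2 * z i x ^ 2) := by
          simp only [mul_sum]
          exact sum_comm
  calc Real.exp (Fintype.card ι / 32)
      ≤ Real.exp (∑ x, p x * ∑ i, (z i x - 2 * z i x ^ 2)) := Real.exp_le_exp.2 hexponent
    _ ≤ ∑ x, p x * Real.exp (∑ i, (z i x - 2 * z i x ^ 2)) :=
        convexOn_exp.map_sum_le (fun x _ => hp.1 x) hp.2 fun x _ => Set.mem_univ _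
    _ ≤ ∑ x, p x * rieszProduct c χ x := by
        refine sum_le_sum fun x _ => mul_le_mul_of_nonneg_left ?_ (hp.1 x)
        rw [Real.exp_sum]
        exact prod_le_prod (fun i _ => (Real.exp_pos _).le) fun i _ => exp_sub_le_one_add (hz i x)

end RieszProduct

section Chang

variable {G : Type*} [AddCommGroup G] [Fintype G] {ι : Type*} [Fintype ι]

lemma ofReal_iterate_localDensity (N : AddGroupSeminorm G) {f : G → ℝ}
    {w : ι → ℂ} {χ : ι → AddChar G ℂ} (hf : ∀ x, (f x : ℂ) = ∑ i, w i * χ i x) (m : ℕ) (x : G) :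
    (((localDensity N)^[m] f x : ℝ) : ℂ) =
      ∑ i, w i * charSum (expWeight N) (χ i) ^ m * χ i x := by
  induction m generalizing x with
  | zero => simp only [Function.iterate_zero_apply, pow_zero, mul_one, hf]
  | succ m ih =>
    rw [Function.iterate_succ_apply', localDensity]
    simp only [Complex.ofReal_sum, Complex.ofReal_mul, ih, mul_sum]
    rw [sum_comm]
    refine sum_congr rfl fun i _ => ?_
    rw [pow_succ, ← mul_assoc]
    generalize charSum (expWeight N) (χ i) ^ m = A
    rw [charSum, mul_sum, sum_mul]
    refine sum_congr rfl fun t _ => ?_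
    rw [AddChar.map_add_eq_mul]
    ring

lemma ofReal_sum_expWeight_mul_iterate_localDensity (N N' : AddGroupSeminorm G) {f : G → ℝ}
    {w : ι → ℂ} {χ : ι → AddChar G ℂ} (hf : ∀ x, (f x : ℂ) = ∑ i, w i * χ i x) (m : ℕ) :
    ((∑ x, expWeight N x * (localDensity N')^[m] f x : ℝ) : ℂ) =
      ∑ i, w i * charSum (expWeight N') (χ i) ^ m * charSum (expWeight N) (χ i) := by
  simp only [Complex.ofReal_sum, Complex.ofReal_mul, ofReal_iterate_localDensity N' hf m, mul_sum,
    charSum.eq_1 (expWeight N)]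
  rw [sum_comm]
  exact sum_congr rfl fun i _ => sum_congr rfl fun x _ => mul_left_comm _ _ _

lemma iterate_localDensity_nonneg (N : AddGroupSeminorm G) {f : G → ℝ} (hf : ∀ x, 0 ≤ f x) (m : ℕ)
    (x : G) : 0 ≤ (localDensity N)^[m] f x := by
  induction m generalizing x with
  | zero => exact hf x
  | succ m ih => rw [Function.iterate_succ_apply']; exact localDensity_nonneg N ih x

lemma IsFiner.le_sum_iterate_localDensity {θ : ℝ} {N N' : AddGroupSeminorm G}
    (hf : IsFiner θ N N') (hθ0 : 0 ≤ θ) (hθ1 : θ ≤ 1 / 2) {f : G → ℝ} (h0 : ∀ x, 0 ≤ f x) (m : ℕ) :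
    (1 - 2 * θ) ^ m * ∑ x, expWeight N x * f x ≤
      ∑ x, expWeight N x * (localDensity N')^[m] f x := by
  induction m with
  | zero => rw [pow_zero, one_mul, Function.iterate_zero_apply]
  | succ m ih =>
    have hstep := hf.le_sum_localDensity hθ0 (by linarith) (iterate_localDensity_nonneg N' h0 m) 0
    rw [sum_expWeight_mul_localDensity_comm, localDensity_zero] at hstep
    simp only [zero_add] at hstep
    rw [Function.iterate_succ_apply', pow_succ', mul_assoc]
    exact (mul_le_mul_of_nonneg_left ih (by linarith)).trans hstep

/-- A Riesz product of `m` characters has `3 ^ m` frequencies, and averaging `m` times multiplies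
all coefficients but the constant one by at most `3⁻ᵐ`. -/
lemma sum_mul_iterate_localDensity_rieszProduct_le {N N' : AddGroupSeminorm G} {c : ι → ℂ}
    (hc : ∀ i, ‖c i‖ ≤ 1) {χ : ι → AddChar G ℂ} (hdis : ∀ e : ι → SignType, e ≠ 0 →
      ‖charSum (expWeight N') (∏ i, χ i ^ (e i : ℤ))‖ ≤ 1 / 3) :
    ∑ x, expWeight N x * (localDensity N')^[Fintype.card ι] (rieszProduct c χ) x ≤ 2 := by
  classical
  set m := Fintype.card ι
  set w : (ι → SignType) → ℂ := fun e => ∏ i, rieszCoeff (c i) (e i)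
  set η : (ι → SignType) → AddChar G ℂ := fun e => ∏ i, χ i ^ (e i : ℤ)
  have hw : ∀ e, ‖w e‖ ≤ 1 := fun e => by
    rw [norm_prod]
    exact prod_le_one (fun i _ => norm_nonneg _) fun i _ => norm_rieszCoeff_le (hc i) _
  have hterm : ∀ e, ‖w e * charSum (expWeight N') (η e) ^ m * charSum (expWeight N) (η e)‖ ≤
      (if e = 0 then 1 else 0) + (1 / 3) ^ m := fun e => by
    calc ‖w e * charSum (expWeight N') (η e) ^ m * charSum (expWeight N) (η e)‖
        ≤ 1 * ‖charSum (expWeight N') (η e)‖ ^ m * 1 := by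
          rw [norm_mul, norm_mul, norm_pow]
          gcongr
          exacts [hw e, norm_charSum_le_one (expWeight_mem_stdSimplex N) _]
      _ ≤ (if e = 0 then 1 else 0) + (1 / 3) ^ m := by
          rw [one_mul, mul_one]
          split_ifs with he
          · have hη := norm_charSum_le_one (expWeight_mem_stdSimplex N') (η e)
            exact (pow_le_one₀ (norm_nonneg _) hη).trans (le_add_of_nonneg_right (by positivity))
          · rw [zero_add]
            gcongr
            exact hdis e he
  calc ∑ x, expWeight N x * (localDensity N')^[m] (rieszProduct c χ) x
      ≤ ‖∑ e, w e * charSum (expWeight N') (η e) ^ m * charSum (expWeight N) (η e)‖ := by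
        rw [← ofReal_sum_expWeight_mul_iterate_localDensity N N' (ofReal_rieszProduct c χ) m,
          Complex.norm_real]
        exact le_abs_self _
    _ ≤ ∑ e : ι → SignType, ((if e = 0 then 1 else 0) + (1 / 3) ^ m) :=
        (norm_sum_le _ _).trans (sum_le_sum fun e _ => hterm e)
    _ = 1 + 3 ^ m * (1 / 3) ^ m := by
        rw [sum_add_distrib, sum_ite_eq' univ (0 : ι → SignType), if_pos (mem_univ _), sum_const,
          card_univ, Fintype.card_fun, show Fintype.card SignType = 3 from rfl, nsmul_eq_mul,
          Nat.cast_pow, Nat.cast_ofNat]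
    _ = 2 := by rw [← mul_pow]; norm_num

lemma exp_card_le_of_dissociated {θ τ : ℝ} {N N' : AddGroupSeminorm G} (hf : IsFiner θ N N')
    (hθ0 : 0 ≤ θ) (hm : Fintype.card ι * θ ≤ 1 / 4) (hθ1 : θ ≤ 1 / 2) {p : G → ℝ}
    (hp : p ∈ stdSimplex ℝ G) (hτ : 0 < τ) (hpN : ∀ x, p x ≤ τ⁻¹ * expWeight N x)
    {χ : ι → AddChar G ℂ} (hχ : ∀ i, 1 / 2 ≤ ‖charSum p (χ i)‖)
    (hdis : ∀ e : ι → SignType, e ≠ 0 →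
      ‖charSum (expWeight N') (∏ i, χ i ^ (e i : ℤ))‖ ≤ 1 / 3) :
    Real.exp (Fintype.card ι / 32) ≤ 4 / τ := by
  have hphase : ∀ i, ∃ c : ℂ, ‖c‖ ≤ 1 ∧ 1 / 2 ≤ (c * charSum p (χ i)).re := fun i => by
    obtain ⟨c, hc, hcχ⟩ := Complex.exists_norm_eq_mul_self (charSum p (χ i))
    exact ⟨c, hc.le, by rw [← hcχ, Complex.ofReal_re]; exact hχ i⟩
  choose c hc hcχ using hphase
  have hP : ∀ x, 0 ≤ rieszProduct c χ x := rieszProduct_nonneg hc χ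
  have hmean : ∑ x, expWeight N x * rieszProduct c χ x ≤ 4 := by
    have hhalf : 1 / 2 ≤ (1 - 2 * θ) ^ Fintype.card ι := by
      have hbern := one_add_mul_le_pow (a := -(2 * θ)) (by linarith) (Fintype.card ι)
      rw [← sub_eq_add_neg] at hbern
      linarith
    have hpos : 0 ≤ ∑ x, expWeight N x * rieszProduct c χ x :=
      sum_nonneg fun x _ => mul_nonneg (expWeight_nonneg N x) (hP x)
    linarith [mul_le_mul_of_nonneg_right hhalf hpos,
      hf.le_sum_iterate_localDensity hθ0 hθ1 hP (Fintype.card ι),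
      sum_mul_iterate_localDensity_rieszProduct_le (N := N) hc hdis]
  calc Real.exp (Fintype.card ι / 32) ≤ ∑ x, p x * rieszProduct c χ x :=
        exp_card_le_sum_mul_rieszProduct hp hc hcχ
    _ ≤ ∑ x, τ⁻¹ * expWeight N x * rieszProduct c χ x :=
        sum_le_sum fun x _ => mul_le_mul_of_nonneg_right (hpN x) (hP x)
    _ = τ⁻¹ * ∑ x, expWeight N x * rieszProduct c χ x := by simp only [mul_sum, mul_assoc]
    _ ≤ τ⁻¹ * 4 := by gcongr
    _ = 4 / τ := by rw [mul_comm, div_eq_mul_inv]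

lemma norm_zpow_sign_sub_one {z : ℂ} (hz : ‖z‖ = 1) {s : SignType} (hs : s ≠ 0) :
    ‖z ^ (s : ℤ) - 1‖ = ‖z - 1‖ := by
  have hz0 : z ≠ 0 := norm_ne_zero_iff.1 (by rw [hz]; exact one_ne_zero)
  cases s
  · exact absurd rfl hs
  · change ‖z ^ (-1 : ℤ) - 1‖ = _
    rw [zpow_neg_one, ← norm_neg, neg_sub, ← one_mul ‖1 - z⁻¹‖, ← hz, ← norm_mul, mul_sub, mul_one,
      mul_inv_cancel₀ hz0]
  · change ‖z ^ (1 : ℤ) - 1‖ = _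
    rw [zpow_one]

lemma norm_zpow_sign_sub_one_le {z : ℂ} (hz : ‖z‖ = 1) (s : SignType) :
    ‖z ^ (s : ℤ) - 1‖ ≤ ‖z - 1‖ := by
  rcases eq_or_ne s 0 with rfl | hs
  · rw [SignType.coe_zero, zpow_zero, sub_self, norm_zero]
    exact norm_nonneg _
  · exact (norm_zpow_sign_sub_one hz hs).le

lemma norm_prod_sub_one_le {κ : Type*} (s : Finset κ) {z : κ → ℂ} (hz : ∀ i, ‖z i‖ = 1) :
    ‖∏ i ∈ s, z i - 1‖ ≤ ∑ i ∈ s, ‖z i - 1‖ := by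
  classical
  induction s using Finset.induction_on with
  | empty => rw [prod_empty, sub_self, norm_zero, sum_empty]
  | insert i s hi ih =>
    rw [prod_insert hi, sum_insert hi]
    calc ‖z i * ∏ j ∈ s, z j - 1‖ = ‖(z i - 1) + z i * (∏ j ∈ s, z j - 1)‖ := by congr 1; ring
      _ ≤ ‖z i - 1‖ + ‖∏ j ∈ s, z j - 1‖ := by
        refine (norm_add_le _ _).trans_eq ?_
        rw [norm_mul, hz, one_mul]
      _ ≤ ‖z i - 1‖ + ∑ j ∈ s, ‖z j - 1‖ := by gcongr

/-- Characters in the large spectrum of the weight are nearly `1` near `0`, because the weight is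
nearly invariant under small shifts. -/
lemma norm_apply_sub_one_mul_le (N : AddGroupSeminorm G) (χ : AddChar G ℂ) (t : G) :
    ‖χ t - 1‖ * ‖charSum (expWeight N) χ‖ ≤ Real.exp (N t) - 1 := by
  rw [← norm_mul, ← charSum_shift_sub]
  calc ‖charSum (fun v => expWeight N (v - t) - expWeight N v) χ‖
      ≤ ∑ v, (Real.exp (N t) - 1) * expWeight N v := by
        refine (norm_sum_le _ _).trans (sum_le_sum fun v _ => ?_)
        rw [norm_mul, AddChar.norm_apply, mul_one, Complex.norm_real, Real.norm_eq_abs, abs_le]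
        have hupper := expWeight_add_le N v (-t)
        have hlower := le_expWeight_add N v (-t)
        rw [map_neg_eq_map, ← sub_eq_add_neg] at hupper hlower
        have hexp : 1 - Real.exp (-N t) ≤ Real.exp (N t) - 1 := by
          linarith [Real.add_one_le_exp (N t), Real.add_one_le_exp (-N t)]
        have := mul_le_mul_of_nonneg_right hexp (expWeight_nonneg N v)
        constructor <;> linarith
    _ = Real.exp (N t) - 1 := by rw [← mul_sum, sum_expWeight, mul_one]

/-- `Λ` is dissociated relative to the weight of `N`: a product of elements of `Λ` or their
inverses, not all exponents being zero, lies outside the large spectrum of that weight. For the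
uniform weight this is the usual dissociativity. -/
def IsDissociated (N : AddGroupSeminorm G) (Λ : Finset (AddChar G ℂ)) : Prop :=
  ∀ e : AddChar G ℂ → SignType, (∃ γ ∈ Λ, e γ ≠ 0) →
    ‖charSum (expWeight N) (∏ γ ∈ Λ, γ ^ (e γ : ℤ))‖ ≤ 1 / 3

lemma isDissociated_empty (N : AddGroupSeminorm G) : IsDissociated N ∅ := by
  rintro e ⟨γ, hγ, -⟩
  exact absurd hγ (notMem_empty γ)

section IsDissociated

variable {N N' : AddGroupSeminorm G} {Λ : Finset (AddChar G ℂ)}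

lemma IsDissociated.norm_charSum_le_of_subset (hΛ : IsDissociated N Λ)
    {Λ' : Finset (AddChar G ℂ)} (hsub : Λ' ⊆ Λ) {e : Λ' → SignType} (he : e ≠ 0) :
    ‖charSum (expWeight N) (∏ γ : Λ', (γ : AddChar G ℂ) ^ (e γ : ℤ))‖ ≤ 1 / 3 := by
  classical
  obtain ⟨γ, hγ⟩ := Function.ne_iff.1 he
  set e' : AddChar G ℂ → SignType := fun χ => if h : χ ∈ Λ' then e ⟨χ, h⟩ else 0
  have he' : ∀ γ : Λ', e' γ = e γ := fun γ => dif_pos γ.2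
  have hprod : ∏ γ : Λ', (γ : AddChar G ℂ) ^ (e γ : ℤ) = ∏ χ ∈ Λ, χ ^ (e' χ : ℤ) := by
    rw [← prod_subset hsub fun χ _ hχ => by
      rw [show e' χ = 0 from dif_neg hχ, SignType.coe_zero, zpow_zero], ← prod_coe_sort Λ']
    simp only [he']
  rw [hprod]
  exact hΛ e' ⟨γ, hsub γ.2, by rwa [he']⟩

lemma IsDissociated.card_le {θ τ : ℝ} {n : ℕ} (hΛ : IsDissociated N' Λ) (hf : IsFiner θ N N')
    (hθ0 : 0 ≤ θ) (hn : n * θ ≤ 1 / 4) (hθ1 : θ ≤ 1 / 2) {p : G → ℝ} (hp : p ∈ stdSimplex ℝ G)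
    (hτ : 0 < τ) (hpN : ∀ x, p x ≤ τ⁻¹ * expWeight N x) (hnτ : 4 / τ < Real.exp (n / 32))
    (hspec : ∀ γ ∈ Λ, 1 / 2 ≤ ‖charSum p γ‖) : Λ.card ≤ n := by
  by_contra! hcard
  obtain ⟨Λ', hsub, hΛ'⟩ := exists_subset_card_eq hcard.le
  have hcard' : Fintype.card Λ' = n := by rw [Fintype.card_coe, hΛ']
  have hle := exp_card_le_of_dissociated hf hθ0 (hcard' ▸ hn) hθ1 hp hτ hpN
    (fun γ : Λ' => hspec γ (hsub γ.2)) fun e he => hΛ.norm_charSum_le_of_subset hsub he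
  rw [hcard'] at hle
  exact hle.not_gt hnτ

/-- A nontrivial signed product of `γ` and `Λ` lies in the large spectrum of the weight, and solving
for `γ` expresses it by `Λ` up to an error that is small near `0`. -/
lemma IsDissociated.norm_apply_sub_one_le [DecidableEq (AddChar G ℂ)] (hΛ : IsDissociated N Λ)
    {γ : AddChar G ℂ} (hγ : γ ∉ Λ) (hins : ¬ IsDissociated N (insert γ Λ)) (t : G) :
    ‖γ t - 1‖ ≤ 3 * (Real.exp (N t) - 1) + ∑ χ ∈ Λ, ‖χ t - 1‖ := by
  unfold IsDissociated at hins
  push Not at hins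
  obtain ⟨e, ⟨δ, hδ, hδ0⟩, he⟩ := hins
  rw [prod_insert hγ] at he
  have heγ : e γ ≠ 0 := fun h0 => by
    rw [h0, SignType.coe_zero, zpow_zero, one_mul] at he
    obtain rfl | hδΛ := mem_insert.1 hδ
    · exact hδ0 h0
    · exact (hΛ e ⟨δ, hδΛ, hδ0⟩).not_gt he
  set η := ∏ δ ∈ Λ, δ ^ (e δ : ℤ)
  have hγη : ‖γ t ^ (e γ : ℤ) * η t - 1‖ ≤ 3 * (Real.exp (N t) - 1) := by
    have hspec := norm_apply_sub_one_mul_le N (γ ^ (e γ : ℤ) * η) t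
    rw [AddChar.mul_apply, AddChar.zpow_apply] at hspec
    nlinarith [norm_nonneg (γ t ^ (e γ : ℤ) * η t - 1)]
  have hη : ‖η t - 1‖ ≤ ∑ χ ∈ Λ, ‖χ t - 1‖ := by
    simp only [η, AddChar.prod_apply, AddChar.zpow_apply]
    refine (norm_prod_sub_one_le Λ fun δ => ?_).trans
      (sum_le_sum fun δ _ => norm_zpow_sign_sub_one_le (AddChar.norm_apply _ _) _)
    rw [norm_zpow, AddChar.norm_apply, one_zpow]
  calc ‖γ t - 1‖ = ‖γ t ^ (e γ : ℤ) - 1‖ :=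
        (norm_zpow_sign_sub_one (AddChar.norm_apply _ _) heγ).symm
    _ = ‖(γ t ^ (e γ : ℤ) * η t - 1) - (η t - 1)‖ := by
        rw [sub_sub_sub_cancel_right, ← sub_one_mul, norm_mul, AddChar.norm_apply, mul_one]
    _ ≤ 3 * (Real.exp (N t) - 1) + ∑ χ ∈ Λ, ‖χ t - 1‖ :=
        (norm_sub_le _ _).trans (add_le_add hγη hη)

/-- A local version of Chang's theorem. -/
lemma exists_finset_control_spectrum {θ τ : ℝ} {n : ℕ} (hf : IsFiner θ N N') (hθ0 : 0 ≤ θ)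
    (hn : n * θ ≤ 1 / 4) (hθ1 : θ ≤ 1 / 2) {p : G → ℝ} (hp : p ∈ stdSimplex ℝ G) (hτ : 0 < τ)
    (hpN : ∀ x, p x ≤ τ⁻¹ * expWeight N x) (hnτ : 4 / τ < Real.exp (n / 32)) :
    ∃ Λ : Finset (AddChar G ℂ), Λ.card ≤ n ∧ ∀ γ, 1 / 2 ≤ ‖charSum p γ‖ → ∀ t,
      ‖γ t - 1‖ ≤ 3 * (Real.exp (N' t) - 1) + ∑ χ ∈ Λ, ‖χ t - 1‖ := by
  classical
  obtain ⟨Λ, hmax⟩ := (Set.toFinite {Λ : Finset (AddChar G ℂ) | IsDissociated N' Λ ∧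
    ∀ γ ∈ Λ, 1 / 2 ≤ ‖charSum p γ‖}).exists_maximal
    ⟨∅, isDissociated_empty N', fun γ hγ => absurd hγ (notMem_empty γ)⟩
  obtain ⟨hΛ, hspec⟩ := hmax.prop
  refine ⟨Λ, hΛ.card_le hf hθ0 hn hθ1 hp hτ hpN hnτ hspec, fun γ hγ t => ?_⟩
  by_cases hmem : γ ∈ Λ
  · have hexp : 0 ≤ Real.exp (N' t) - 1 :=
      sub_nonneg.2 (Real.one_le_exp (apply_nonneg N' t))
    have := single_le_sum (f := fun χ : AddChar G ℂ => ‖χ t - 1‖)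
      (fun χ _ => norm_nonneg _) hmem
    linarith
  · refine hΛ.norm_apply_sub_one_le hmem (fun hins => hmem ?_) t
    exact hmax.le_of_ge ⟨hins, forall_mem_insert _ _ _ |>.2 ⟨hγ, hspec⟩⟩ (subset_insert _ _)
      (mem_insert_self _ _)

end IsDissociated

end Chang

section Increment

variable {G : Type*} [AddCommGroup G] [Fintype G]

lemma sqrt_expWeight_add_le (N : AddGroupSeminorm G) (x t : G) :
    √(expWeight N (x + t)) ≤ Real.exp (N t) * √(expWeight N x) := by
  rw [← Real.sqrt_sq (Real.exp_pos (N t)).le, ← Real.sqrt_mul (sq_nonneg _)]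
  have hle := le_self_pow₀ (Real.one_le_exp (apply_nonneg N t)) two_ne_zero
  exact Real.sqrt_le_sqrt ((expWeight_add_le N x t).trans
    (mul_le_mul_of_nonneg_right hle (expWeight_nonneg N x)))

lemma abs_sqrt_expWeight_sub_le (N : AddGroupSeminorm G) {R : ℝ} (hR : R ≤ 1) {t : G}
    (ht : N t ≤ R) (x : G) :
    |√(expWeight N x) - √(expWeight N (x - t))| ≤ 2 * R * √(expWeight N x) := by
  have hR0 : 0 ≤ R := (apply_nonneg N t).trans ht
  have hexp : Real.exp (N t) ≤ 1 + 2 * R := by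
    have := (abs_le.1 (Real.abs_exp_sub_one_le (x := R) (by rwa [abs_of_nonneg hR0]))).2
    rw [abs_of_nonneg hR0] at this
    linarith [Real.exp_le_exp.2 ht]
  have hexp' : 1 - R ≤ Real.exp (-N t) := by linarith [Real.add_one_le_exp (-N t)]
  have hupper := sqrt_expWeight_add_le N x (-t)
  have hlower := sqrt_expWeight_add_le N (x - t) t
  rw [map_neg_eq_map, ← sub_eq_add_neg] at hupper
  rw [sub_add_cancel, ← inv_mul_le_iff₀ (Real.exp_pos _), ← Real.exp_neg] at hlower
  have hs := Real.sqrt_nonneg (expWeight N x)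
  have hexps := mul_le_mul_of_nonneg_right hexp hs
  have hexps' := mul_le_mul_of_nonneg_right hexp' hs
  have := mul_nonneg hR0 hs
  rw [abs_le]
  constructor <;> linarith

lemma localDensity_mul_weightedConv {N : AddGroupSeminorm G} {h : G → ℝ}
    (hb : localDensity N h 0 ≠ 0) (u : G) :
    localDensity N h 0 * weightedConv N h u = ∑ x, expWeight N x * h x * h (u - x) := by
  rw [weightedConv, mul_sum]
  exact sum_congr rfl fun x _ => by rw [← mul_assoc, mul_div_cancel₀ _ hb]

/-- Near `0` the weight `expWeight N x` may be replaced by the symmetric expression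
`√(expWeight N x) * √(expWeight N (v - x))`. -/
lemma abs_localDensity_mul_weightedConv_sub_le {N : AddGroupSeminorm G} {h : G → ℝ}
    (h0 : ∀ x, 0 ≤ h x) (h1 : ∀ x, h x ≤ 1) (hb : localDensity N h 0 ≠ 0) {R : ℝ} (hR : R ≤ 1)
    {v : G} (hv : N v ≤ R) :
    |localDensity N h 0 * weightedConv N h v -
        ∑ x, √(expWeight N x) * h x * (√(expWeight N (v - x)) * h (v - x))| ≤
      2 * R * localDensity N h 0 := by
  rw [localDensity_mul_weightedConv hb, ← sum_sub_distrib, localDensity_zero, mul_sum]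
  refine (abs_sum_le_sum_abs _ _).trans (sum_le_sum fun x _ => ?_)
  have hs := Real.sqrt_nonneg (expWeight N x)
  have hneg : expWeight N (v - x) = expWeight N (x - v) := by rw [← expWeight_neg, neg_sub]
  calc |expWeight N x * h x * h (v - x) -
        √(expWeight N x) * h x * (√(expWeight N (v - x)) * h (v - x))|
      = √(expWeight N x) * |√(expWeight N x) - √(expWeight N (x - v))| * (h x * h (v - x)) := by
        have hfactor : expWeight N x * h x * h (v - x) -
            √(expWeight N x) * h x * (√(expWeight N (x - v)) * h (v - x)) =
            √(expWeight N x) * (√(expWeight N x) - √(expWeight N (x - v))) *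
              (h x * h (v - x)) := by
          linear_combination -(h x * h (v - x)) * Real.mul_self_sqrt (expWeight_nonneg N x)
        rw [hneg, hfactor, abs_mul, abs_mul, abs_of_nonneg hs,
          abs_of_nonneg (mul_nonneg (h0 x) (h0 (v - x)))]
    _ ≤ √(expWeight N x) * (2 * R * √(expWeight N x)) * (h x * 1) := by
        have hsqrt := abs_sqrt_expWeight_sub_le N hR hv x
        exact mul_le_mul (mul_le_mul_of_nonneg_left hsqrt hs)
          (mul_le_mul_of_nonneg_left (h1 _) (h0 x)) (mul_nonneg (h0 x) (h0 _))
          (mul_nonneg hs ((abs_nonneg _).trans hsqrt))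
    _ = 2 * R * (expWeight N x * h x) := by
        linear_combination 2 * R * h x * Real.mul_self_sqrt (expWeight_nonneg N x)

lemma abs_sum_mul_weightedConv_le {N : AddGroupSeminorm G} {h ψ : G → ℝ}
    (h0 : ∀ x, 0 ≤ h x) (h1 : ∀ x, h x ≤ 1) (hb : 0 < localDensity N h 0) {R M : ℝ} (hR : R ≤ 1)
    (hψR : ∀ v, ψ v ≠ 0 → N v ≤ R) (hM : ∀ χ, ‖charSum ψ χ‖ ≤ M) :
    |∑ v, ψ v * weightedConv N h v| ≤ M + (∑ v, |ψ v|) * (2 * R) := by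
  set b := localDensity N h 0
  set g : G → ℝ := fun x => √(expWeight N x) * h x
  have hg : ∑ x, g x ^ 2 ≤ b := by
    rw [show b = ∑ x, expWeight N x * h x from localDensity_zero N h]
    refine sum_le_sum fun x _ => ?_
    rw [mul_pow, Real.sq_sqrt (expWeight_nonneg N x)]
    exact mul_le_mul_of_nonneg_left (pow_le_of_le_one (h0 x) (h1 x) two_ne_zero)
      (expWeight_nonneg N x)
  have hmain : |∑ v, ∑ x, ψ v * (g x * g (v - x))| ≤ M * b :=
    (abs_sum_sum_mul_le hM).trans
      (mul_le_mul_of_nonneg_left hg ((norm_nonneg _).trans (hM 1)))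
  have herr : |b * ∑ v, ψ v * weightedConv N h v - ∑ v, ∑ x, ψ v * (g x * g (v - x))| ≤
      (∑ v, |ψ v|) * (2 * R * b) := by
    rw [mul_sum, ← sum_sub_distrib, sum_mul]
    refine (abs_sum_le_sum_abs _ _).trans (sum_le_sum fun v _ => ?_)
    rw [mul_left_comm, ← mul_sum, ← mul_sub, abs_mul]
    rcases eq_or_ne (ψ v) 0 with hv | hv
    · simp only [hv, abs_zero, zero_mul, le_refl]
    · exact mul_le_mul_of_nonneg_left
        (abs_localDensity_mul_weightedConv_sub_le h0 h1 hb.ne' hR (hψR v hv)) (abs_nonneg _)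
  refine le_of_mul_le_mul_left ?_ hb
  calc b * |∑ v, ψ v * weightedConv N h v| = |b * ∑ v, ψ v * weightedConv N h v| := by
        rw [abs_mul, abs_of_pos hb]
    _ ≤ M * b + (∑ v, |ψ v|) * (2 * R * b) := by
        linarith [abs_sub_abs_le_abs_sub (b * ∑ v, ψ v * weightedConv N h v)
          (∑ v, ∑ x, ψ v * (g x * g (v - x)))]
    _ = b * (M + (∑ v, |ψ v|) * (2 * R)) := by ring

lemma abs_sum_weightedConv_shift_sub_le {N : AddGroupSeminorm G} {h f : G → ℝ}
    (h0 : ∀ x, 0 ≤ h x) (h1 : ∀ x, h x ≤ 1) (hb : 0 < localDensity N h 0)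
    (hf : f ∈ stdSimplex ℝ G) {R M : ℝ} (hR : R ≤ 1) {t : G}
    (hfR : ∀ v, f v ≠ 0 → N v + N t ≤ R) (hM : ∀ χ, ‖charSum (fun v => f (v - t) - f v) χ‖ ≤ M) :
    |∑ v, f v * weightedConv N h (v + t) - ∑ v, f v * weightedConv N h v| ≤ M + 4 * R := by
  have hshift : ∀ φ : G → ℝ, ∑ v, f (v - t) * φ v = ∑ v, f v * φ (v + t) := fun φ => by
    rw [← Equiv.sum_comp (Equiv.addRight t)]
    simp only [Equiv.coe_addRight, add_sub_cancel_right]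
  obtain ⟨v, -, hv⟩ := exists_ne_zero_of_sum_ne_zero (hf.2.trans_ne one_ne_zero)
  have hR0 : 0 ≤ R := (add_nonneg (apply_nonneg N v) (apply_nonneg N t)).trans (hfR v hv)
  have hsupp : ∀ v, f (v - t) - f v ≠ 0 → N v ≤ R := fun v hv => by
    rcases eq_or_ne (f v) 0 with hv' | hv'
    · rw [hv', sub_zero] at hv
      have hadd := map_add_le_add N (v - t) t
      rw [sub_add_cancel] at hadd
      exact hadd.trans (hfR _ hv)
    · linarith [hfR v hv', apply_nonneg N t]
  have hl1 : ∑ v, |f (v - t) - f v| ≤ 2 := by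
    calc ∑ v, |f (v - t) - f v| ≤ ∑ v, (f (v - t) * 1 + f v) := by
          refine sum_le_sum fun v _ => (abs_sub _ _).trans_eq ?_
          rw [abs_of_nonneg (hf.1 _), abs_of_nonneg (hf.1 _), mul_one]
      _ = 2 := by
          rw [sum_add_distrib, hshift fun _ => 1, hf.2]
          simp only [mul_one, hf.2, one_add_one_eq_two]
  rw [← hshift, ← sum_sub_distrib]
  simp only [← sub_mul]
  calc |∑ v, (f (v - t) - f v) * weightedConv N h v|
      ≤ M + (∑ v, |f (v - t) - f v|) * (2 * R) :=
        abs_sum_mul_weightedConv_le h0 h1 hb hR hsupp hM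
    _ ≤ M + 2 * (2 * R) := by gcongr
    _ = M + 4 * R := by ring

lemma sum_sum_mul_weightedConv (N : AddGroupSeminorm G) (h q : G → ℝ) (v : G) :
    ∑ t, ∑ t', q t * q t' * weightedConv N h (v + t + t') =
      ∑ z, (∑ t, q t * (expWeight N (z + t) * h (z + t) / localDensity N h 0)) *
        ∑ t', q t' * h (v - z + t') := by
  have hconv : ∀ t t', weightedConv N h (v + t + t') =
      ∑ z, expWeight N (z + t) * h (z + t) / localDensity N h 0 * h (v - z + t') := fun t t' => by
    rw [weightedConv, ← Equiv.sum_comp (Equiv.addRight t)]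
    refine sum_congr rfl fun z _ => ?_
    rw [Equiv.coe_addRight, show v + t + t' - (z + t) = v - z + t' by abel]
  simp only [sum_mul_sum]
  rw [← sum_comm_cycle]
  refine sum_congr rfl fun t _ => sum_congr rfl fun t' _ => ?_
  rw [hconv, mul_sum]
  exact sum_congr rfl fun z _ => mul_mul_mul_comm _ _ _ _

section Average

variable {N : AddGroupSeminorm G} {h q : G → ℝ} {θ β : ℝ}

lemma sum_mul_weight_div_localDensity_le (h0 : ∀ x, 0 ≤ h x) (hq : ∀ t, 0 ≤ q t)
    (hqθ : ∀ t, q t ≠ 0 → N t ≤ θ) {z : G} (hβ : ∑ t, q t * h (z + t) ≤ β) :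
    ∑ t, q t * (expWeight N (z + t) * h (z + t) / localDensity N h 0) ≤
      Real.exp θ * (β / localDensity N h 0) * expWeight N z := by
  have hb := localDensity_nonneg N h0 0
  have hz := expWeight_nonneg N z
  calc ∑ t, q t * (expWeight N (z + t) * h (z + t) / localDensity N h 0)
      ≤ ∑ t, q t * (Real.exp θ * expWeight N z * h (z + t) / localDensity N h 0) := by
        refine sum_le_sum fun t _ => ?_
        rcases eq_or_ne (q t) 0 with ht | ht
        · simp only [ht, zero_mul, le_refl]
        have hqt := hq t
        have hht := h0 (z + t)
        gcongr
        exact (expWeight_add_le N z t).trans (by gcongr; exact hqθ t ht)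
    _ = Real.exp θ * expWeight N z / localDensity N h 0 * ∑ t, q t * h (z + t) := by
        rw [mul_sum]
        exact sum_congr rfl fun t _ => by ring
    _ ≤ Real.exp θ * expWeight N z / localDensity N h 0 * β := by gcongr
    _ = Real.exp θ * (β / localDensity N h 0) * expWeight N z := by ring

lemma exp_neg_mul_localDensity_le (h0 : ∀ x, 0 ≤ h x) (hq : q ∈ stdSimplex ℝ G)
    (hqθ : ∀ t, q t ≠ 0 → N t ≤ θ) :
    Real.exp (-θ) * localDensity N h 0 ≤ ∑ z, expWeight N z * ∑ t, q t * h (z + t) := by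
  calc Real.exp (-θ) * localDensity N h 0
      = ∑ t, q t * (Real.exp (-θ) * localDensity N h 0) := by rw [← sum_mul, hq.2, one_mul]
    _ ≤ ∑ t, q t * localDensity N h t := by
        refine sum_le_sum fun t _ => ?_
        rcases eq_or_ne (q t) 0 with ht | ht
        · simp only [ht, zero_mul, le_refl]
        refine mul_le_mul_of_nonneg_left ?_ (hq.1 t)
        have hshift := le_localDensity_add N h0 0 t
        rw [zero_add] at hshift
        refine le_trans ?_ hshift
        have hb := localDensity_nonneg N h0 0
        gcongr
        exact hqθ t ht
    _ = ∑ z, expWeight N z * ∑ t, q t * h (z + t) := by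
        simp only [localDensity, mul_sum]
        rw [sum_comm]
        refine sum_congr rfl fun z _ => sum_congr rfl fun t _ => ?_
        rw [mul_left_comm, add_comm]

lemma sum_sum_mul_weight_div_localDensity (h0 : ∀ x, 0 ≤ h x) (hb : 0 < localDensity N h 0)
    (hq : q ∈ stdSimplex ℝ G) :
    ∑ z, ∑ t, q t * (expWeight N (z + t) * h (z + t) / localDensity N h 0) = 1 := by
  rw [sum_comm, ← hq.2]
  refine sum_congr rfl fun t _ => ?_
  have hshift := Equiv.sum_comp (Equiv.addRight t) fun z =>
    expWeight N z * h z / localDensity N h 0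
  simp only [Equiv.coe_addRight] at hshift
  rw [← mul_sum, hshift, (weight_div_localDensity_mem_stdSimplex h0 hb).2, mul_one]

/-- No average of `h` along `q` exceeds `β` while their mean is nearly `β`, so that most of them
are close to `β`. -/
lemma le_sum_weightedConv_average (h0 : ∀ x, 0 ≤ h x) (hb : 0 < localDensity N h 0)
    (hq : q ∈ stdSimplex ℝ G) (hqθ : ∀ t, q t ≠ 0 → N t ≤ θ)
    (hβ : ∀ z, ∑ t, q t * h (z + t) ≤ β) {R : ℝ} {v : G} (hv : N v ≤ R) :
    β - Real.exp (θ + R) * (β / localDensity N h 0) *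
        (β - Real.exp (-θ) * localDensity N h 0) ≤
      ∑ t, ∑ t', q t * q t' * weightedConv N h (v + t + t') := by
  set b := localDensity N h 0
  set φ : G → ℝ := fun z => ∑ t, q t * h (z + t)
  set ν : G → ℝ := fun z => ∑ t, q t * (expWeight N (z + t) * h (z + t) / b)
  have hβ0 : 0 ≤ β := (sum_nonneg fun t _ => mul_nonneg (hq.1 t) (h0 _)).trans (hβ 0)
  have hν : ∑ z, ν z = 1 := sum_sum_mul_weight_div_localDensity h0 hb hq
  have hνle : ∀ z, ν z ≤ Real.exp (θ + R) * (β / b) * expWeight N (v - z) := fun z => by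
    have hz : expWeight N z ≤ Real.exp R * expWeight N (v - z) := by
      have hadd := expWeight_add_le N (v - z) (-v)
      rw [map_neg_eq_map, show v - z + -v = -z by abel, expWeight_neg] at hadd
      have := expWeight_nonneg N (v - z)
      exact hadd.trans (by gcongr)
    calc ν z ≤ Real.exp θ * (β / b) * expWeight N z :=
          sum_mul_weight_div_localDensity_le h0 hq.1 hqθ (hβ z)
      _ ≤ Real.exp θ * (β / b) * (Real.exp R * expWeight N (v - z)) := by gcongr
      _ = Real.exp (θ + R) * (β / b) * expWeight N (v - z) := by rw [Real.exp_add]; ring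
  have hdefect : ∑ z, ν z * (β - φ (v - z)) ≤
      Real.exp (θ + R) * (β / b) * (β - Real.exp (-θ) * b) := by
    calc ∑ z, ν z * (β - φ (v - z))
        ≤ ∑ z, Real.exp (θ + R) * (β / b) * expWeight N (v - z) * (β - φ (v - z)) :=
          sum_le_sum fun z _ => mul_le_mul_of_nonneg_right (hνle z) (sub_nonneg.2 (hβ _))
      _ = Real.exp (θ + R) * (β / b) * (β - ∑ z, expWeight N z * φ z) := by
          have hsub := Equiv.sum_comp (Equiv.subLeft v) fun z =>
            Real.exp (θ + R) * (β / b) * expWeight N z * (β - φ z)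
          simp only [Equiv.subLeft_apply] at hsub
          rw [hsub]
          simp only [mul_assoc, ← mul_sum, mul_sub, sum_sub_distrib, ← sum_mul, sum_expWeight,
            one_mul]
      _ ≤ Real.exp (θ + R) * (β / b) * (β - Real.exp (-θ) * b) := by
          gcongr
          exact exp_neg_mul_localDensity_le h0 hq hqθ
  simp only [mul_sub, sum_sub_distrib, ← sum_mul, hν, one_mul] at hdefect
  rw [sum_sum_mul_weightedConv]
  simp only [mul_sub]
  linarith

end Average

end Increment

section CondWeight

variable {G : Type*} {r : G → ℝ} {T : Finset G}

/-- The weight `r` conditioned on the set `T`. It is `0` when `T` has weight `0`. -/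
noncomputable def condWeight (r : G → ℝ) (T : Finset G) (t : G) : ℝ :=
  (T : Set G).indicator r t / ∑ s ∈ T, r s

lemma sum_condWeight_mul [Fintype G] (r : G → ℝ) (T : Finset G) (f : G → ℝ) :
    ∑ t, condWeight r T t * f t = (∑ t ∈ T, r t * f t) / ∑ s ∈ T, r s := by
  classical
  simp only [condWeight, Set.indicator_apply, mem_coe, div_mul_eq_mul_div, ite_mul, zero_mul]
  rw [← sum_div, sum_ite_mem, univ_inter]

lemma condWeight_mem_stdSimplex [Fintype G] (hr : ∀ t, 0 ≤ r t) (hT : 0 < ∑ s ∈ T, r s) :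
    condWeight r T ∈ stdSimplex ℝ G := by
  refine ⟨fun t => div_nonneg (Set.indicator_nonneg (fun t _ => hr t) t) hT.le, ?_⟩
  simpa only [mul_one, div_self hT.ne'] using sum_condWeight_mul r T fun _ => 1

lemma mem_of_condWeight_ne_zero {t : G} (ht : condWeight r T t ≠ 0) : t ∈ T := by
  contrapose! ht
  rw [condWeight, Set.indicator_of_notMem (mem_coe.not.2 ht), zero_div]

lemma condWeight_le (hr : ∀ t, 0 ≤ r t) (t : G) : condWeight r T t ≤ (∑ s ∈ T, r s)⁻¹ * r t := by
  rw [condWeight, div_eq_inv_mul]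
  exact mul_le_mul_of_nonneg_left (Set.indicator_le_self' (fun t _ => hr t) t)
    (inv_nonneg.2 (sum_nonneg fun s _ => hr s))

end CondWeight

section Bohr

variable {G : Type*} [AddCommGroup G]

lemma norm_apply_sub_sub_one [Finite G] (γ : AddChar G ℂ) (x y : G) :
    ‖γ (x - y) - 1‖ = ‖γ x - γ y‖ := by
  have hy : γ y ≠ 0 := (AddChar.val_isUnit γ y).ne_zero
  rw [AddChar.map_sub_eq_div, div_sub_one hy, norm_div, AddChar.norm_apply, div_one]

lemma norm_apply_neg_sub_one [Finite G] (γ : AddChar G ℂ) (x : G) :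
    ‖γ (-x) - 1‖ = ‖γ x - 1‖ := by
  rw [← zero_sub, norm_apply_sub_sub_one, AddChar.map_zero_eq_one, norm_sub_rev]

lemma norm_apply_add_sub_one_le [Finite G] (γ : AddChar G ℂ) (x y : G) :
    ‖γ (x + y) - 1‖ ≤ ‖γ x - 1‖ + ‖γ y - 1‖ := by
  rw [← sub_neg_eq_add, norm_apply_sub_sub_one, ← norm_apply_neg_sub_one γ y,
    norm_sub_rev (γ (-y))]
  exact norm_sub_le_norm_sub_add_norm_sub _ _ _

/-- The seminorm whose balls are the Bohr sets with frequencies `Γ`, scaled by `K`. Integer scales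
and multisets of frequencies make the seminorm additive in `Γ` and multiplicative in `K`. -/
noncomputable def bohrSeminorm [Finite G] (K : ℕ) (Γ : Multiset (AddChar G ℂ)) :
    AddGroupSeminorm G where
  toFun x := K * (Γ.map fun γ => ‖γ x - 1‖).sum
  map_zero' := by simp
  add_le' x y := by
    rw [← mul_add, ← Multiset.sum_map_add]
    exact mul_le_mul_of_nonneg_left
      (Multiset.sum_map_le_sum_map _ _ fun γ _ => norm_apply_add_sub_one_le γ x y)
      (Nat.cast_nonneg K)
  neg' x := by simp only [norm_apply_neg_sub_one]

lemma bohrSeminorm_apply [Finite G] (K : ℕ) (Γ : Multiset (AddChar G ℂ)) (x : G) :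
    bohrSeminorm K Γ x = K * (Γ.map fun γ => ‖γ x - 1‖).sum := rfl

lemma bohrSeminorm_add [Finite G] (K : ℕ) (Γ Δ : Multiset (AddChar G ℂ)) (x : G) :
    bohrSeminorm K (Γ + Δ) x = bohrSeminorm K Γ x + bohrSeminorm K Δ x := by
  simp only [bohrSeminorm_apply, Multiset.map_add, Multiset.sum_add, mul_add]

lemma bohrSeminorm_mul [Finite G] (m K : ℕ) (Γ : Multiset (AddChar G ℂ)) (x : G) :
    bohrSeminorm (m * K) Γ x = m * bohrSeminorm K Γ x := by
  rw [bohrSeminorm_apply, bohrSeminorm_apply, Nat.cast_mul, mul_assoc]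

lemma bohrSeminorm_mono [Finite G] {K K' : ℕ} (hK : K ≤ K') (Γ : Multiset (AddChar G ℂ)) (x : G) :
    bohrSeminorm K Γ x ≤ bohrSeminorm K' Γ x := by
  refine mul_le_mul_of_nonneg_right (Nat.cast_le.2 hK) (Multiset.sum_nonneg fun r hr => ?_)
  obtain ⟨γ, _, rfl⟩ := Multiset.mem_map.1 hr
  exact norm_nonneg _

lemma bohrSeminorm_sub_le [Finite G] (K : ℕ) {Γ : Multiset (AddChar G ℂ)} {x y : G} {δ : ℝ}
    (hδ : ∀ γ ∈ Γ, ‖γ x - γ y‖ ≤ δ) : bohrSeminorm K Γ (x - y) ≤ K * (Γ.card * δ) := by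
  refine mul_le_mul_of_nonneg_left ?_ (Nat.cast_nonneg K)
  rw [← nsmul_eq_mul, ← Multiset.card_map (fun γ : AddChar G ℂ => ‖γ (x - y) - 1‖) Γ]
  refine Multiset.sum_le_card_nsmul _ _ fun r hr => ?_
  obtain ⟨γ, hγ, rfl⟩ := Multiset.mem_map.1 hr
  exact (norm_apply_sub_sub_one γ x y).trans_le (hδ γ hγ)

lemma floor_mul_mem_Icc (m : ℕ) {r : ℝ} (hr : |r| ≤ 1) : ⌊m * r⌋ ∈ Icc (-(m : ℤ)) m := by
  have : (0 : ℝ) ≤ m := Nat.cast_nonneg m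
  obtain ⟨hlow, hhigh⟩ := abs_le.1 hr
  refine mem_Icc.2 ⟨Int.le_floor.2 ?_, Int.floor_le_iff.2 ?_⟩
  · push_cast
    nlinarith
  · push_cast
    nlinarith

lemma norm_sub_le_of_floor_eq {m : ℕ} (hm : 0 < m) {z w : ℂ} (hre : ⌊m * z.re⌋ = ⌊m * w.re⌋)
    (him : ⌊m * z.im⌋ = ⌊m * w.im⌋) : ‖z - w‖ ≤ 2 / m := by
  have hm' : (0 : ℝ) < m := Nat.cast_pos.2 hm
  have hre' := Int.abs_sub_lt_one_of_floor_eq_floor hre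
  have him' := Int.abs_sub_lt_one_of_floor_eq_floor him
  rw [← mul_sub, abs_mul, abs_of_pos hm'] at hre' him'
  rw [le_div_iff₀' hm']
  calc m * ‖z - w‖ ≤ m * (|z.re - w.re| + |z.im - w.im|) :=
        mul_le_mul_of_nonneg_left (Complex.norm_le_abs_re_add_abs_im _) hm'.le
    _ ≤ 2 := by linarith

lemma exists_large_subset_norm_sub_le {ι : Type*} {f : ι → ℂ} (hf : ∀ x, ‖f x‖ ≤ 1) {m : ℕ}
    (hm : 0 < m) (S : Finset ι) :
    ∃ S' ⊆ S, (S.card : ℝ) ≤ (2 * m + 1) ^ 2 * S'.card ∧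
      ∀ x ∈ S', ∀ y ∈ S', ‖f x - f y‖ ≤ 2 / m := by
  classical
  let F : ι → ℤ × ℤ := fun x => (⌊m * (f x).re⌋, ⌊m * (f x).im⌋)
  let B : Finset (ℤ × ℤ) := Icc (-(m : ℤ)) m ×ˢ Icc (-(m : ℤ)) m
  have hmaps : ∀ x ∈ S, F x ∈ B := fun x _ => mem_product.2
    ⟨floor_mul_mem_Icc m ((Complex.abs_re_le_norm _).trans (hf x)),
      floor_mul_mem_Icc m ((Complex.abs_im_le_norm _).trans (hf x))⟩
  have hBcard : (B.card : ℝ) = (2 * m + 1) ^ 2 := by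
    have hIcc : (Icc (-(m : ℤ)) m).card = 2 * m + 1 := by rw [Int.card_Icc]; omega
    rw [card_product, hIcc]
    push_cast
    ring
  have hB0 : (0 : ℝ) < B.card := by rw [hBcard]; positivity
  obtain ⟨c, _, hc⟩ := exists_le_card_fiber_of_nsmul_le_card_of_maps_to
    (b := (S.card : ℝ) / B.card) hmaps (card_pos.1 (Nat.cast_pos.1 hB0))
    (by rw [nsmul_eq_mul, mul_div_cancel₀ _ hB0.ne'])
  refine ⟨S.filter fun x => F x = c, filter_subset _ _, ?_, fun x hx y hy => ?_⟩
  · rwa [div_le_iff₀' hB0, hBcard] at hc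
  · have hxy : F x = F y := (mem_filter.1 hx).2.trans (mem_filter.1 hy).2.symm
    exact norm_sub_le_of_floor_eq hm (Prod.mk.inj hxy).1 (Prod.mk.inj hxy).2

lemma exists_large_subset_close [Finite G] (Γ : Multiset (AddChar G ℂ)) {m : ℕ} (hm : 0 < m)
    (S : Finset G) : ∃ S' ⊆ S, (S.card : ℝ) ≤ (2 * m + 1) ^ (2 * Γ.card) * S'.card ∧
      ∀ γ ∈ Γ, ∀ x ∈ S', ∀ y ∈ S', ‖γ x - γ y‖ ≤ 2 / m := by
  induction Γ using Multiset.induction_on with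
  | empty => exact ⟨S, Subset.rfl, by simp, by simp⟩
  | cons γ Γ ih =>
    obtain ⟨S₁, hS₁, hcard₁, hclose₁⟩ := ih
    obtain ⟨S₂, hS₂, hcard₂, hclose₂⟩ :=
      exists_large_subset_norm_sub_le (fun x => (AddChar.norm_apply γ x).le) hm S₁
    refine ⟨S₂, hS₂.trans hS₁, ?_, Multiset.forall_mem_cons.2 ⟨hclose₂, fun δ hδ x hx y hy =>
      hclose₁ δ hδ x (hS₂ hx) y (hS₂ hy)⟩⟩
    calc (S.card : ℝ) ≤ (2 * m + 1) ^ (2 * Γ.card) * S₁.card := hcard₁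
      _ ≤ (2 * m + 1) ^ (2 * Γ.card) * ((2 * m + 1) ^ 2 * S₂.card) := by gcongr
      _ = (2 * m + 1) ^ (2 * (γ ::ₘ Γ).card) * S₂.card := by rw [Multiset.card_cons]; ring

lemma exp_neg_one_mul_card_le_expMass [Fintype G] {N : AddGroupSeminorm G} {S : Finset G} {y : G}
    (hS : ∀ x ∈ S, N (x - y) ≤ 1) : Real.exp (-1) * S.card ≤ expMass N := by
  have hshift := Equiv.sum_comp (Equiv.subRight y) fun x => Real.exp (-N x)
  simp only [Equiv.subRight_apply] at hshift
  calc Real.exp (-1) * S.card = ∑ _x ∈ S, Real.exp (-1) := by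
        rw [sum_const, nsmul_eq_mul, mul_comm]
    _ ≤ ∑ x ∈ S, Real.exp (-N (x - y)) :=
        sum_le_sum fun x hx => Real.exp_le_exp.2 (neg_le_neg (hS x hx))
    _ ≤ ∑ x, Real.exp (-N (x - y)) :=
        sum_le_sum_of_subset_of_nonneg (subset_univ _) fun _ _ _ => (Real.exp_pos _).le
    _ = expMass N := hshift

lemma exp_neg_mul_card_le_expMass_bohrSeminorm [Fintype G] {K d : ℕ} {Γ : Multiset (AddChar G ℂ)}
    (hΓ : Γ.card ≤ d) {H : ℝ} (hH : 1 + 2 * d * Real.log (4 * K * d + 3) ≤ H) :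
    Real.exp (-H) * Fintype.card G ≤ expMass (bohrSeminorm K Γ) := by
  obtain ⟨S, -, hS, hclose⟩ := exists_large_subset_close Γ (m := 2 * K * d + 1) (by omega) univ
  set M : ℝ := 4 * K * d + 3
  have hM1 : 1 ≤ M := by
    have : (0 : ℝ) ≤ 4 * K * d := by positivity
    linarith
  have hcard : (Fintype.card G : ℝ) ≤ M ^ (2 * d) * S.card := by
    rw [card_univ, show 2 * ((2 * K * d + 1 : ℕ) : ℝ) + 1 = M by push_cast; ring] at hS
    exact hS.trans (by gcongr)
  obtain ⟨y, hy⟩ : S.Nonempty := by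
    rw [nonempty_iff_ne_empty]
    rintro rfl
    rw [card_empty, Nat.cast_zero, mul_zero] at hcard
    exact hcard.not_gt (Nat.cast_pos.2 Fintype.card_pos)
  have hball : ∀ x ∈ S, bohrSeminorm K Γ (x - y) ≤ 1 := fun x hx => by
    calc bohrSeminorm K Γ (x - y) ≤ K * (Γ.card * (2 / (2 * K * d + 1 : ℕ))) :=
          bohrSeminorm_sub_le K fun γ hγ => hclose γ hγ x hx y hy
      _ ≤ K * (d * (2 / (2 * K * d + 1 : ℕ))) := by gcongr
      _ = 2 * K * d / (2 * K * d + 1 : ℕ) := by ring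
      _ ≤ 1 := div_le_one_of_le₀ (by push_cast; linarith) (Nat.cast_nonneg _)
  have hexp : Real.exp (-H) * M ^ (2 * d) ≤ Real.exp (-1) := by
    rw [← Real.exp_log (show 0 < M by linarith), ← Real.exp_nat_mul, ← Real.exp_add]
    push_cast
    exact Real.exp_le_exp.2 (by linarith)
  calc Real.exp (-H) * Fintype.card G ≤ Real.exp (-H) * (M ^ (2 * d) * S.card) := by gcongr
    _ = Real.exp (-H) * M ^ (2 * d) * S.card := by ring
    _ ≤ Real.exp (-1) * S.card := by gcongr
    _ ≤ expMass (bohrSeminorm K Γ) := exp_neg_one_mul_card_le_expMass hball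

end Bohr

section IncrementParams

/-- Numerical conditions tying together the parameters of the density increment argument: `a` is a
lower bound for the density, `l` the number of smoothings, `k` the number of samples, `n` the number
of new characters and `θ` the accuracy to which scales are separated. -/
structure IncrementParams (a θ : ℝ) (k l n : ℕ) : Prop where
  a_pos : 0 < a
  θ_pos : 0 < θ
  l_pos : 0 < l
  k_pos : 0 < k
  smoothing_le : 2 * (1 / 4) ^ l ≤ a / 100
  sampling_le : 9600 * l * Real.exp (-(k * (1 / (300 * l)) ^ 2 * a / 4)) ≤ a ^ 2
  spectrum_lt : 32 * (2 / a) ^ k < Real.exp (n / 32)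
  θ_mul_l_le : 3800 * θ * l ≤ a
  θ_mul_k_le : k * θ ≤ 1 / 2
  θ_mul_n_le : n * θ ≤ 1 / 4
  θ_le : 1000 * θ ≤ a

namespace IncrementParams

variable {a₀ a θ : ℝ} {k l n : ℕ}

lemma sampling_error_le (hpar : IncrementParams a₀ θ k l n) (ha₀ : a₀ ≤ a) :
    l * (12 * (2 / a) * (4 * Real.exp (-(k * (1 / (300 * l)) ^ 2 * a / 4)))) ≤ a / 100 := by
  have ha₀0 := hpar.a_pos
  have ha := ha₀0.trans_le ha₀
  calc l * (12 * (2 / a) * (4 * Real.exp (-(k * (1 / (300 * l)) ^ 2 * a / 4))))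
      = 9600 * l * Real.exp (-(k * (1 / (300 * l)) ^ 2 * a / 4)) / (100 * a) := by
        field_simp
        ring
    _ ≤ 9600 * l * Real.exp (-(k * (1 / (300 * l)) ^ 2 * a₀ / 4)) / (100 * a) := by gcongr
    _ ≤ a₀ ^ 2 / (100 * a) := by
        have := hpar.sampling_le
        gcongr
    _ ≤ a ^ 2 / (100 * a) := by gcongr
    _ = a / 100 := by field_simp

lemma four_div_lt (hpar : IncrementParams a₀ θ k l n) {b τ : ℝ} (hb : a₀ / 2 ≤ b)
    (hτ : b ^ k / 8 ≤ τ) : 4 / τ < Real.exp (n / 32) := by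
  have ha₀0 := hpar.a_pos
  have hb0 : 0 < b := (half_pos ha₀0).trans_le hb
  calc 4 / τ ≤ 4 / (b ^ k / 8) := by gcongr
    _ = 32 / b ^ k := by
        field_simp
        norm_num
    _ ≤ 32 / (a₀ / 2) ^ k := by gcongr
    _ = 32 * (2 / a₀) ^ k := by rw [div_eq_mul_inv, ← inv_pow, inv_div]
    _ < Real.exp (n / 32) := hpar.spectrum_lt

lemma θ_le_of_le_one (hpar : IncrementParams a₀ θ k l n) (ha₀ : a₀ ≤ 1) : θ ≤ 1 / 1000 := by
  linarith [hpar.θ_le]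

lemma le_θ_mul_l (hpar : IncrementParams a₀ θ k l n) : θ ≤ θ * l :=
  le_mul_of_one_le_right hpar.θ_pos.le (by exact_mod_cast hpar.l_pos)

end IncrementParams

lemma exp_le_one_add_two_mul_of_le {x y : ℝ} (hxy : x ≤ y) (hy0 : 0 ≤ y) (hy1 : y ≤ 1) :
    Real.exp x ≤ 1 + 2 * y := by
  have hexp := (abs_le.1 (Real.abs_exp_sub_one_le (x := y) (by rwa [abs_of_nonneg hy0]))).2
  rw [abs_of_nonneg hy0] at hexp
  linarith [Real.exp_le_exp.2 hxy]

lemma one_add_three_mul_pow_le {l : ℕ} (hl : 0 < l) :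
    (1 + 3 * (1 / (300 * l : ℝ))) ^ l ≤ 1 + 2 / 100 := by
  have hl' : (l : ℝ) ≠ 0 := Nat.cast_ne_zero.2 hl.ne'
  calc (1 + 3 * (1 / (300 * l : ℝ))) ^ l ≤ Real.exp (3 * (1 / (300 * l))) ^ l := by
        rw [add_comm]
        gcongr
        exact Real.add_one_le_exp _
    _ = Real.exp (1 / 100) := by
        rw [← Real.exp_nat_mul]
        congr 1
        field_simp
        norm_num
    _ ≤ 1 + 2 * (1 / 100) := exp_le_one_add_two_mul_of_le le_rfl (by norm_num) (by norm_num)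
    _ = 1 + 2 / 100 := by norm_num

end IncrementParams

section AlmostPeriods

variable {G : Type*} [AddCommGroup G] [Fintype G]

lemma norm_charSum_iterate_smoothing_shift_le {p f : G → ℝ} (hp : p ∈ stdSimplex ℝ G)
    (hf : f ∈ stdSimplex ℝ G) (l : ℕ) {t : G} {δ : ℝ}
    (hδ : ∀ γ : AddChar G ℂ, 1 / 2 ≤ ‖charSum p γ‖ → ‖γ t - 1‖ ≤ δ) (hδ0 : 0 ≤ δ)
    (χ : AddChar G ℂ) :
    ‖charSum (fun v => (smoothing p)^[l] f (v - t) - (smoothing p)^[l] f v) χ‖ ≤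
      2 * (1 / 4) ^ l + δ := by
  rw [charSum_shift_sub, norm_mul, norm_charSum_iterate_smoothing]
  have hfχ := norm_charSum_le_one hf χ
  have hpχ := norm_charSum_le_one hp χ
  have hχ : ‖χ t - 1‖ ≤ 2 := by
    refine (norm_sub_le _ _).trans_eq ?_
    rw [AddChar.norm_apply, norm_one, one_add_one_eq_two]
  rcases le_or_gt (1 / 2) ‖charSum p χ‖ with hlarge | hsmall
  · calc ‖χ t - 1‖ * (‖charSum f χ‖ * ‖charSum p χ‖ ^ (2 * l)) ≤ δ * (1 * 1 ^ (2 * l)) := by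
          gcongr
          exact hδ χ hlarge
      _ = δ := by rw [one_pow, mul_one, mul_one]
      _ ≤ 2 * (1 / 4) ^ l + δ := le_add_of_nonneg_left (by positivity)
  · calc ‖χ t - 1‖ * (‖charSum f χ‖ * ‖charSum p χ‖ ^ (2 * l))
        ≤ 2 * (1 * (1 / 2) ^ (2 * l)) := by gcongr
      _ = 2 * (1 / 4) ^ l := by
          rw [one_mul, pow_mul]
          norm_num
      _ ≤ 2 * (1 / 4) ^ l + δ := le_add_of_nonneg_right hδ0

variable {a₀ a θ : ℝ} {k l n : ℕ} {h : G → ℝ}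

lemma exists_almost_periods {N₁ Q N₃ N₅ : AddGroupSeminorm G} {ε : ℝ}
    (hpar : IncrementParams a₀ θ k l n) (ha₀ : a₀ ≤ 1) (h0 : ∀ x, 0 ≤ h x) (h1 : ∀ x, h x ≤ 1)
    (hN₁Q : ∀ x, N₁ x ≤ Q x) (hQN₃ : IsFiner θ Q N₃) (hN₃N₅ : IsFiner θ N₃ N₅)
    (hb : a₀ / 2 ≤ localDensity N₁ h 0) (hε0 : 0 < ε) (hε1 : ε ≤ 1) (ha : 0 ≤ a) :
    ∃ g : G → ℝ, ∃ p ∈ stdSimplex ℝ G, (∀ t, p t ≠ 0 → Q t ≤ θ) ∧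
      (∀ t, p t ≠ 0 → ∑ u ∈ exceptionalSet k ε a (weightedConv N₁ h) g t, expWeight Q u ≤
        4 * Real.exp (-(k * ε ^ 2 * a / 4))) ∧
      ∃ Λ : Finset (AddChar G ℂ), Λ.card ≤ n ∧ ∀ γ, 1 / 2 ≤ ‖charSum p γ‖ → ∀ t,
        ‖γ t - 1‖ ≤ 3 * (Real.exp (N₅ t) - 1) + bohrSeminorm 1 Λ.val t := by
  have hθ := hpar.θ_pos
  have hθ1 := hpar.θ_le_of_le_one ha₀
  have hb0 := (half_pos hpar.a_pos).trans_le hb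
  have hball : 1 / 2 ≤ ∑ t with Q t ≤ θ, expWeight N₃ t := by linarith [hQN₃.one_sub_le]
  have hscale : ∀ t ∈ univ.filter fun t => Q t ≤ θ, k * N₁ t ≤ 1 / 2 := fun t ht =>
    (mul_le_mul_of_nonneg_left ((hN₁Q t).trans (mem_filter.1 ht).2) k.cast_nonneg).trans
      hpar.θ_mul_k_le
  obtain ⟨g, T, hTS, hT, hexc⟩ := exists_shift_set h0 h1 hb0 (expWeight_mem_stdSimplex Q)
    (expWeight_nonneg N₃) hball hscale hε0 hε1 ha
  have hτ : 0 < ∑ t ∈ T, expWeight N₃ t := lt_of_lt_of_le (by positivity) hT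
  have hp := condWeight_mem_stdSimplex (expWeight_nonneg N₃) hτ
  obtain ⟨Λ, hΛn, hΛ⟩ := exists_finset_control_spectrum hN₃N₅ hθ.le hpar.θ_mul_n_le
    (by linarith) hp hτ (condWeight_le (expWeight_nonneg N₃)) (hpar.four_div_lt hb hT)
  refine ⟨g, _, hp, fun t ht => (mem_filter.1 (hTS (mem_of_condWeight_ne_zero ht))).2,
    fun t ht => hexc t (mem_of_condWeight_ne_zero ht), Λ, hΛn, fun γ hγ t => ?_⟩
  rw [bohrSeminorm_apply, Nat.cast_one, one_mul]
  exact hΛ γ hγ t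

lemma sum_iterate_smoothing_mul_le_of_params {Q : AddGroupSeminorm G} {p f Φ g : G → ℝ}
    (hpar : IncrementParams a₀ θ k l n) (ha₀ : a₀ ≤ a) (ha1 : a ≤ 1)
    (hp : p ∈ stdSimplex ℝ G) (hpQ : ∀ t, p t ≠ 0 → Q t ≤ θ) (hf : f ∈ stdSimplex ℝ G)
    (hfQ : ∀ u, f u ≤ 2 / a * expWeight Q u) (hΦ0 : ∀ u, 0 ≤ Φ u) (hΦ1 : ∀ u, Φ u ≤ 1)
    (hexc : ∀ t, p t ≠ 0 → ∑ u ∈ exceptionalSet k (1 / (300 * l)) a Φ g t, expWeight Q u ≤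
      4 * Real.exp (-(k * (1 / (300 * l)) ^ 2 * a / 4))) :
    ∑ u, (smoothing p)^[l] f u * Φ u ≤ (1 + 2 / 100) * (∑ u, f u * Φ u + 2 / 100 * a) := by
  have ha := hpar.a_pos.trans_le ha₀
  have hθ := hpar.θ_pos
  have hl : (1 : ℝ) ≤ l := by exact_mod_cast hpar.l_pos
  have hε1 : 1 / (300 * l : ℝ) ≤ 1 / 3 := by gcongr; linarith
  have hεl : l * (1 / (300 * l) : ℝ) = 1 / 300 := by field_simp
  set ε : ℝ := 1 / (300 * l)
  set e := 4 * Real.exp (-(k * ε ^ 2 * a / 4))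
  have hsmooth := sum_iterate_smoothing_mul_le hp hθ.le hpQ (B := 2 / a) (by positivity) hf.1 hf.2
    hfQ hΦ0 hΦ1 (Nat.cast_pos.2 hpar.k_pos) (ε := ε) (by positivity) hε1 ha.le (e := e)
    (by positivity) hexc (l := l) (by linarith [hpar.θ_mul_l_le])
  have herr : l * (3 * ε * a + 12 * (2 / a) * e) ≤ 2 / 100 * a := by
    have hsampling : l * (12 * (2 / a) * e) ≤ a / 100 := hpar.sampling_error_le ha₀
    linear_combination hsampling + 3 * a * hεl
  have hsum : 0 ≤ ∑ u, f u * Φ u := sum_nonneg fun u _ => mul_nonneg (hf.1 u) (hΦ0 u)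
  calc ∑ u, (smoothing p)^[l] f u * Φ u
      ≤ (1 + 3 * ε) ^ l * (∑ u, f u * Φ u + l * (3 * ε * a + 12 * (2 / a) * e)) := hsmooth
    _ ≤ (1 + 2 / 100) * (∑ u, f u * Φ u + 2 / 100 * a) := by
        gcongr
        exact one_add_three_mul_pow_le hpar.l_pos

lemma sum_iterate_smoothing_shift_le_of_params {N₁ : AddGroupSeminorm G} {p f : G → ℝ}
    (hpar : IncrementParams a₀ θ k l n) (ha₀ : a₀ ≤ a) (ha1 : a ≤ 1) (h0 : ∀ x, 0 ≤ h x)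
    (h1 : ∀ x, h x ≤ 1) (hb : 0 < localDensity N₁ h 0) (hp : p ∈ stdSimplex ℝ G)
    (hpN : ∀ t, p t ≠ 0 → N₁ t ≤ θ) (hf : f ∈ stdSimplex ℝ G)
    (hfN : ∀ u, f u ≠ 0 → N₁ u ≤ 2 * θ) {t : G} (ht : N₁ t ≤ 2 * θ)
    (hspec : ∀ γ : AddChar G ℂ, 1 / 2 ≤ ‖charSum p γ‖ → ‖γ t - 1‖ ≤ 14 * θ) :
    ∑ v, (smoothing p)^[l] f v * weightedConv N₁ h (v + t) ≤
      ∑ v, (smoothing p)^[l] f v * weightedConv N₁ h v + 2 / 100 * a := by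
  have hθ := hpar.θ_pos
  have hθl := hpar.θ_mul_l_le
  have hlθ := hpar.le_θ_mul_l
  have hF : (smoothing p)^[l] f ∈ stdSimplex ℝ G :=
    ⟨iterate_smoothing_nonneg hp.1 hf.1 l, (sum_iterate_smoothing hp f l).trans hf.2⟩
  have hsupp : ∀ v, (smoothing p)^[l] f v ≠ 0 → N₁ v + N₁ t ≤ 6 * (θ * l) := fun v hv => by
    linarith [iterate_smoothing_ne_zero hpN hfN l hv]
  have hshift := abs_sum_weightedConv_shift_sub_le h0 h1 hb hF (R := 6 * (θ * l)) (by linarith)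
    hsupp (norm_charSum_iterate_smoothing_shift_le hp hf l hspec (by linarith))
  linarith [(abs_le.1 hshift).2, hpar.smoothing_le]

end AlmostPeriods

section NoIncrement

variable {G : Type*} [AddCommGroup G] [Fintype G]

lemma exists_weight_average_le {M N : AddGroupSeminorm G} {θ β : ℝ} {h : G → ℝ}
    (hMN : IsFiner θ M N) (hθ : θ < 1) (h0 : ∀ x, 0 ≤ h x)
    (hβ : ∀ x, localDensity N h x ≤ β * (1 - θ)) :
    ∃ q ∈ stdSimplex ℝ G, (∀ t, q t ≠ 0 → M t ≤ θ) ∧ ∀ z, ∑ t, q t * h (z + t) ≤ β := by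
  have hmass := hMN.one_sub_le
  have hpos : 0 < ∑ t with M t ≤ θ, expWeight N t := by linarith
  have hβ0 : 0 ≤ β :=
    nonneg_of_mul_nonneg_left ((localDensity_nonneg N h0 0).trans (hβ 0)) (by linarith)
  refine ⟨_, condWeight_mem_stdSimplex (expWeight_nonneg N) hpos,
    fun t ht => (mem_filter.1 (mem_of_condWeight_ne_zero ht)).2, fun z => ?_⟩
  rw [sum_condWeight_mul, div_le_iff₀ hpos]
  calc ∑ t with M t ≤ θ, expWeight N t * h (z + t) ≤ localDensity N h z :=
        sum_le_sum_of_subset_of_nonneg (subset_univ _)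
          fun t _ _ => mul_nonneg (expWeight_nonneg N t) (h0 _)
    _ ≤ β * (1 - θ) := hβ z
    _ ≤ β * ∑ t with M t ≤ θ, expWeight N t := by gcongr

lemma mul_le_sum_weightedConv_average {N : AddGroupSeminorm G} {h q : G → ℝ} {a θ R : ℝ}
    (ha : 0 < a) (h0 : ∀ x, 0 ≤ h x) (hb : (1 - 2 / 100) * a ≤ localDensity N h 0)
    (hq : q ∈ stdSimplex ℝ G) (hqθ : ∀ t, q t ≠ 0 → N t ≤ θ) (hθ : θ ≤ 1 / 1000)
    (hβ : ∀ z, ∑ t, q t * h (z + t) ≤ (1 + 2 / 100) * a) (hR : R ≤ 4 / 1000) {v : G}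
    (hv : N v ≤ R) :
    971 / 1000 * a ≤ ∑ t, ∑ t', q t * q t' * weightedConv N h (v + t + t') := by
  have hb0 : 0 < localDensity N h 0 := lt_of_lt_of_le (by positivity) hb
  refine le_trans ?_ (le_sum_weightedConv_average h0 hb0 hq hqθ hβ hv)
  set b := localDensity N h 0
  have hexp : Real.exp (θ + R) ≤ 1 + 2 * (1 / 200) :=
    exp_le_one_add_two_mul_of_le (by linarith) (by norm_num) (by norm_num)
  have hratio : (1 + 2 / 100) * a / b ≤ 1 + 5 / 100 := by
    rw [div_le_iff₀ hb0]
    linarith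
  have hdefect : (1 + 2 / 100) * a - Real.exp (-θ) * b ≤ 45 / 1000 * a := by
    have hexp' : 999 / 1000 ≤ Real.exp (-θ) := by linarith [Real.add_one_le_exp (-θ)]
    linarith [mul_le_mul_of_nonneg_right hexp' hb0.le]
  have hloss : Real.exp (θ + R) * ((1 + 2 / 100) * a / b) *
      ((1 + 2 / 100) * a - Real.exp (-θ) * b) ≤ 49 / 1000 * a := by
    calc _ ≤ Real.exp (θ + R) * ((1 + 2 / 100) * a / b) * (45 / 1000 * a) := by gcongr
      _ ≤ (1 + 2 * (1 / 200)) * (1 + 5 / 100) * (45 / 1000 * a) := by gcongr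
      _ ≤ 49 / 1000 * a := by linarith
  linarith

lemma sum_mul_sum_sum_shift (F q Φ : G → ℝ) :
    ∑ v, F v * ∑ t, ∑ t', q t * q t' * Φ (v + t + t') =
      ∑ t, ∑ t', q t * q t' * ∑ v, F v * Φ (v + (t + t')) := by
  simp only [mul_sum, ← add_assoc]
  rw [sum_comm_cycle, sum_comm_cycle]
  exact sum_congr rfl fun t _ => sum_congr rfl fun t' _ => sum_congr rfl fun v _ =>
    mul_left_comm _ _ _

lemma le_sum_mul_of_forall_ne_zero {ι : Type*} [Fintype ι] {p φ : ι → ℝ} {c : ℝ}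
    (hp : p ∈ stdSimplex ℝ ι) (hφ : ∀ i, p i ≠ 0 → c ≤ φ i) : c ≤ ∑ i, p i * φ i := by
  calc c = ∑ i, p i * c := by rw [← sum_mul, hp.2, one_mul]
    _ ≤ ∑ i, p i * φ i := by
        refine sum_le_sum fun i _ => ?_
        rcases eq_or_ne (p i) 0 with hi | hi
        · simp only [hi, zero_mul, le_refl]
        · exact mul_le_mul_of_nonneg_left (hφ i hi) (hp.1 i)

/-- Smoothing `f` along almost periods of `weightedConv N₁ h` hardly changes the mean, and makes it
almost invariant under shifts by elements on which few characters are close to `1`. Averaging over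
such shifts compares the mean with averages of `h`, which are nearly constant when no density
increment is available. -/
lemma half_le_sum_mul_weightedConv {a₀ a θ : ℝ} {k l n : ℕ} (hpar : IncrementParams a₀ θ k l n)
    (ha₀ : a₀ ≤ a) (ha1 : a ≤ 1) {N₁ Q N₃ N₅ : AddGroupSeminorm G} {h f : G → ℝ}
    (h0 : ∀ x, 0 ≤ h x) (h1 : ∀ x, h x ≤ 1) (hN₁Q : ∀ x, N₁ x ≤ Q x) (hQN₅ : ∀ x, Q x ≤ N₅ x)
    (hQN₃ : IsFiner θ Q N₃) (hN₃N₅ : IsFiner θ N₃ N₅)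
    (hb : (1 - 2 / 100) * a ≤ localDensity N₁ h 0) (hf : f ∈ stdSimplex ℝ G)
    (hfQ : ∀ u, f u ≤ 2 / a * expWeight Q u) (hfN : ∀ u, f u ≠ 0 → N₁ u ≤ 2 * θ)
    (hinc : ∀ Λ : Finset (AddChar G ℂ), Λ.card ≤ n → ∃ N₄ : AddGroupSeminorm G,
      IsFiner θ (N₅ + bohrSeminorm 1 Λ.val) N₄ ∧ ∀ x, localDensity N₄ h x ≤ (1 + 1 / 100) * a) :
    a / 2 ≤ ∑ u, f u * weightedConv N₁ h u := by
  have ha := hpar.a_pos.trans_le ha₀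
  have hθ := hpar.θ_pos
  have hθ1 := hpar.θ_le_of_le_one (ha₀.trans ha1)
  have hb0 : 0 < localDensity N₁ h 0 := lt_of_lt_of_le (by positivity) hb
  have hl : (1 : ℝ) ≤ l := by exact_mod_cast hpar.l_pos
  obtain ⟨g, p, hp, hpQ, hexc, Λ, hΛn, hΛ⟩ := exists_almost_periods hpar (ha₀.trans ha1) h0 h1
    hN₁Q hQN₃ hN₃N₅ (by linarith) (ε := 1 / (300 * l)) (by positivity)
    (div_le_one_of_le₀ (by linarith) (by positivity)) ha.le
  have hpN : ∀ t, p t ≠ 0 → N₁ t ≤ θ := fun t ht => (hN₁Q t).trans (hpQ t ht)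
  obtain ⟨N₄, hN₄, hN₄a⟩ := hinc Λ hΛn
  obtain ⟨q, hq, hqM, hqβ⟩ := exists_weight_average_le hN₄ (β := (1 + 2 / 100) * a) (by linarith) h0
    fun x => (hN₄a x).trans (by nlinarith)
  set D := bohrSeminorm 1 Λ.val
  have hqN : ∀ t, q t ≠ 0 → N₁ t ≤ θ := fun t ht =>
    ((hN₁Q t).trans (hQN₅ t)).trans ((le_add_of_nonneg_right (apply_nonneg D t)).trans (hqM t ht))
  set F := (smoothing p)^[l] f
  have hF : F ∈ stdSimplex ℝ G :=
    ⟨iterate_smoothing_nonneg hp.1 hf.1 l, (sum_iterate_smoothing hp f l).trans hf.2⟩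
  have hshift : ∀ t t', q t ≠ 0 → q t' ≠ 0 → ∑ v, F v * weightedConv N₁ h (v + (t + t')) ≤
      ∑ v, F v * weightedConv N₁ h v + 2 / 100 * a := fun t t' ht ht' => by
    have hM : N₅ (t + t') + D (t + t') ≤ 2 * θ :=
      (map_add_le_add (N₅ + D) t t').trans (by linarith [hqM t ht, hqM t' ht'])
    have hN₁₅ := (hN₁Q (t + t')).trans (hQN₅ (t + t'))
    have hD := apply_nonneg D (t + t')
    have hN₅ := apply_nonneg N₅ (t + t')
    refine sum_iterate_smoothing_shift_le_of_params hpar ha₀ ha1 h0 h1 hb0 hp hpN hf hfN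
      (by linarith) fun γ hγ => (hΛ γ hγ _).trans ?_
    linarith [exp_le_one_add_two_mul_of_le (x := N₅ (t + t')) (y := 2 * θ) (by linarith)
      (by linarith) (by linarith)]
  have hpoint : ∀ v, F v ≠ 0 →
      971 / 1000 * a ≤ ∑ t, ∑ t', q t * q t' * weightedConv N₁ h (v + t + t') := fun v hv => by
    refine mul_le_sum_weightedConv_average ha h0 hb hq hqN hθ1 hqβ (R := 4 / 1000) le_rfl ?_
    linarith [iterate_smoothing_ne_zero hpN hfN l hv, hpar.θ_mul_l_le, hpar.le_θ_mul_l]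
  have hlower := le_sum_mul_of_forall_ne_zero hF hpoint
  rw [sum_mul_sum_sum_shift] at hlower
  have hupper := sum_iterate_smoothing_mul_le_of_params hpar ha₀ ha1 hp hpQ hf hfQ
    (weightedConv_nonneg N₁ h0) (weightedConv_le_one h0 h1 hb0) hexc
  linarith [hlower.trans (sum_sum_mul_le hq hshift)]

end NoIncrement

section Halving

variable {G : Type*} [AddCommGroup G]

/-- Doubling, as a permutation of a finite abelian group of odd order. -/
noncomputable def doublingEquiv (hodd : Odd (Nat.card G)) : G ≃ G :=
  nsmulCoprime (Nat.coprime_two_right.2 hodd)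

lemma doublingEquiv_apply (hodd : Odd (Nat.card G)) (x : G) : doublingEquiv hodd x = 2 • x := rfl

/-- The frequencies `γ ^ (1 / 2)` for `γ` in `Γ`: in odd order the square root of a character is
its power with exponent `(|G| + 1) / 2`. -/
noncomputable def halfFreq (Γ : Multiset (AddChar G ℂ)) : Multiset (AddChar G ℂ) :=
  Γ.map fun γ => γ ^ ((Nat.card G + 1) / 2)

lemma card_halfFreq (Γ : Multiset (AddChar G ℂ)) : (halfFreq Γ).card = Γ.card :=
  Multiset.card_map _ _

lemma half_nsmul_two_nsmul (hodd : Odd (Nat.card G)) (x : G) :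
    ((Nat.card G + 1) / 2) • 2 • x = x := by
  have htwo : (Nat.card G + 1) / 2 * 2 = Nat.card G + 1 :=
    Nat.div_mul_cancel (hodd.add_one).two_dvd
  rw [← mul_nsmul', htwo, add_nsmul, card_nsmul_eq_zero', zero_add, one_nsmul]

lemma bohrSeminorm_halfFreq_two_nsmul [Finite G] (hodd : Odd (Nat.card G)) (K : ℕ)
    (Γ : Multiset (AddChar G ℂ)) (x : G) :
    bohrSeminorm K (halfFreq Γ) (2 • x) = bohrSeminorm K Γ x := by
  simp only [bohrSeminorm_apply, halfFreq, Multiset.map_map, Function.comp_def, AddChar.pow_apply,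
    ← AddChar.map_nsmul_eq_pow, half_nsmul_two_nsmul hodd]

lemma map_two_nsmul_le (N : AddGroupSeminorm G) (x : G) :
    N (2 • x) ≤ 2 * N x := by
  rw [two_nsmul, two_mul]
  exact map_add_le_add N x x

lemma bohrSeminorm_le_halfFreq [Finite G] (hodd : Odd (Nat.card G)) {K K' : ℕ} (hK : 2 * K ≤ K')
    (Γ : Multiset (AddChar G ℂ)) (x : G) :
    bohrSeminorm K Γ x ≤ bohrSeminorm K' (halfFreq Γ) x :=
  calc bohrSeminorm K Γ x = bohrSeminorm K (halfFreq Γ) (2 • x) :=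
        (bohrSeminorm_halfFreq_two_nsmul hodd K Γ x).symm
    _ ≤ 2 * bohrSeminorm K (halfFreq Γ) x := map_two_nsmul_le _ x
    _ = bohrSeminorm (2 * K) (halfFreq Γ) x := by rw [bohrSeminorm_mul, Nat.cast_ofNat]
    _ ≤ bohrSeminorm K' (halfFreq Γ) x := bohrSeminorm_mono hK _ x

end Halving

section DoubledWeight

variable {G : Type*} [AddCommGroup G] [Fintype G]

lemma expWeight_halfFreq_two_nsmul (hodd : Odd (Nat.card G)) (K : ℕ)
    (Γ : Multiset (AddChar G ℂ)) (x : G) :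
    expWeight (bohrSeminorm K (halfFreq Γ)) (2 • x) = expWeight (bohrSeminorm K Γ) x := by
  have hmass : expMass (bohrSeminorm K (halfFreq Γ)) = expMass (bohrSeminorm K Γ) := by
    unfold expMass
    simp only [← Equiv.sum_comp (doublingEquiv hodd) fun y =>
      Real.exp (-bohrSeminorm K (halfFreq Γ) y), doublingEquiv_apply,
      bohrSeminorm_halfFreq_two_nsmul hodd]
  rw [expWeight, expWeight, hmass, bohrSeminorm_halfFreq_two_nsmul hodd]

/-- The law of `2 • y` when `y` follows the probability weight proportional to
`expWeight N * g`. -/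
noncomputable def doubledWeight (hodd : Odd (Nat.card G)) (N : AddGroupSeminorm G) (g : G → ℝ)
    (u : G) : ℝ :=
  expWeight N ((doublingEquiv hodd).symm u) * g ((doublingEquiv hodd).symm u) / localDensity N g 0

variable {hodd : Odd (Nat.card G)} {N P : AddGroupSeminorm G} {g : G → ℝ}

lemma doubledWeight_mem_stdSimplex (g0 : ∀ x, 0 ≤ g x) (hb : 0 < localDensity P g 0) :
    doubledWeight hodd P g ∈ stdSimplex ℝ G := by
  obtain ⟨hp0, hp1⟩ := weight_div_localDensity_mem_stdSimplex g0 hb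
  exact ⟨fun u => hp0 _, (Equiv.sum_comp (doublingEquiv hodd).symm _).trans hp1⟩

lemma doubledWeight_bohrSeminorm_le {K : ℕ} {Γ : Multiset (AddChar G ℂ)} (g1 : ∀ x, g x ≤ 1)
    {b : ℝ} (hb0 : 0 < b) (hb : b ≤ localDensity (bohrSeminorm K Γ) g 0) (u : G) :
    doubledWeight hodd (bohrSeminorm K Γ) g u ≤
      b⁻¹ * expWeight (bohrSeminorm K (halfFreq Γ)) u := by
  obtain ⟨y, rfl⟩ := (doublingEquiv hodd).surjective u
  rw [doubledWeight, Equiv.symm_apply_apply, doublingEquiv_apply,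
    expWeight_halfFreq_two_nsmul hodd, div_eq_inv_mul]
  have hw := expWeight_nonneg (bohrSeminorm K Γ) y
  calc (localDensity (bohrSeminorm K Γ) g 0)⁻¹ * (expWeight (bohrSeminorm K Γ) y * g y)
      ≤ (localDensity (bohrSeminorm K Γ) g 0)⁻¹ * expWeight (bohrSeminorm K Γ) y := by
        have := hb0.trans_le hb
        exact mul_le_mul_of_nonneg_left (mul_le_of_le_one_right hw (g1 y)) (by positivity)
    _ ≤ b⁻¹ * expWeight (bohrSeminorm K Γ) y := by gcongr

lemma le_two_mul_of_doubledWeight_ne_zero {θ : ℝ} (hg : ∀ y, g y ≠ 0 → N y ≤ θ) {u : G}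
    (hu : doubledWeight hodd P g u ≠ 0) : N u ≤ 2 * θ := by
  obtain ⟨y, rfl⟩ := (doublingEquiv hodd).surjective u
  have hgy : g y ≠ 0 := by
    rintro hgy
    exact hu (by rw [doubledWeight, Equiv.symm_apply_apply, hgy, mul_zero, zero_div])
  exact (map_two_nsmul_le N y).trans (by linarith [hg y hgy])

lemma localDensity_mul_sum_doubledWeight (hb : localDensity P g 0 ≠ 0) (Φ : G → ℝ) :
    localDensity P g 0 * ∑ u, doubledWeight hodd P g u * Φ u =
      ∑ y, expWeight P y * g y * Φ (2 • y) := by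
  rw [← Equiv.sum_comp (doublingEquiv hodd), mul_sum]
  refine sum_congr rfl fun y _ => ?_
  rw [doubledWeight, Equiv.symm_apply_apply, doublingEquiv_apply]
  field_simp

lemma IsFiner.localDensity_le_indicator_add {θ : ℝ} (hNP : IsFiner θ N P) (g1 : ∀ x, g x ≤ 1) :
    localDensity P g 0 ≤ localDensity P ({y | N y ≤ θ}.indicator g) 0 + θ := by
  calc localDensity P g 0
      ≤ localDensity P ({y | N y ≤ θ}.indicator g) 0 + ∑ y with θ < N y, expWeight P y := by
        rw [localDensity_zero, localDensity_zero, sum_filter, ← sum_add_distrib]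
        refine sum_le_sum fun y _ => ?_
        by_cases hy : N y ≤ θ
        · rw [Set.indicator_of_mem (by exact hy), if_neg hy.not_gt, add_zero]
        · rw [Set.indicator_of_notMem (by exact hy), if_pos (not_le.1 hy), mul_zero, zero_add]
          exact mul_le_of_le_one_right (expWeight_nonneg P y) (g1 y)
    _ ≤ _ := add_le_add_right hNP _

end DoubledWeight

section WeightedCount

variable {G : Type*} [AddCommGroup G] [Fintype G]

/-- The number of three-term progressions weighted by a function `h`: the real-valued counterpart
of `threeAPCount A A A`. -/
noncomputable def apCount (h : G → ℝ) : ℝ := ∑ y, ∑ x, h y * (h x * h (2 • y - x))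

lemma apCount_translate (h : G → ℝ) (s : G) : apCount (fun x => h (s + x)) = apCount h := by
  have hshift : ∀ x y, s + (2 • y - x) = 2 • (s + y) - (s + x) := fun x y => by
    rw [nsmul_add, two_nsmul s]
    abel
  unfold apCount
  simp only [hshift]
  rw [← Equiv.sum_comp (Equiv.addLeft s) fun y => ∑ x, h y * (h x * h (2 • y - x))]
  exact sum_congr rfl fun y _ =>
    Equiv.sum_comp (Equiv.addLeft s) fun x => h (s + y) * (h x * h (2 • (s + y) - x))

lemma localDensity_translate (N : AddGroupSeminorm G) (h : G → ℝ) (s x : G) :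
    localDensity N (fun z => h (s + z)) x = localDensity N h (s + x) := by
  simp only [localDensity, add_assoc]

lemma sum_weightedConv_le_apCount {N P : AddGroupSeminorm G} {H : ℝ}
    (hN : Real.exp (-H) * Fintype.card G ≤ expMass N)
    (hP : Real.exp (-H) * Fintype.card G ≤ expMass P) {h g : G → ℝ} (h0 : ∀ x, 0 ≤ h x)
    (hb : 0 < localDensity N h 0) (g0 : ∀ x, 0 ≤ g x) (hgh : ∀ x, g x ≤ h x) :
    localDensity N h 0 * ∑ y, expWeight P y * g y * weightedConv N h (2 • y) ≤
      (Real.exp H / Fintype.card G) ^ 2 * apCount h := by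
  unfold apCount weightedConv
  simp only [mul_sum]
  refine sum_le_sum fun y _ => sum_le_sum fun x _ => ?_
  have hweight : expWeight P y * expWeight N x ≤ (Real.exp H / Fintype.card G) ^ 2 := by
    rw [sq]
    exact mul_le_mul (expWeight_le_of_expMass hP y) (expWeight_le_of_expMass hN x)
      (expWeight_nonneg N x) (by positivity)
  have hhh : 0 ≤ h x * h (2 • y - x) := mul_nonneg (h0 _) (h0 _)
  calc localDensity N h 0 * (expWeight P y * g y *
        (expWeight N x * h x / localDensity N h 0 * h (2 • y - x)))
      = (expWeight P y * expWeight N x) * (g y * (h x * h (2 • y - x))) := by field_simp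
    _ ≤ (Real.exp H / Fintype.card G) ^ 2 * (h y * (h x * h (2 • y - x))) :=
        mul_le_mul hweight (mul_le_mul_of_nonneg_right (hgh y) hhh) (mul_nonneg (g0 y) hhh)
          (by positivity)

lemma le_apCount_of_half_le {hodd : Odd (Nat.card G)} {N P : AddGroupSeminorm G} {a H : ℝ}
    (ha : 0 < a) (hN : Real.exp (-H) * Fintype.card G ≤ expMass N)
    (hP : Real.exp (-H) * Fintype.card G ≤ expMass P) {h g : G → ℝ} (h0 : ∀ x, 0 ≤ h x)
    (g0 : ∀ x, 0 ≤ g x) (hgh : ∀ x, g x ≤ h x) (hbh : a / 2 ≤ localDensity N h 0)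
    (hbg : a / 2 ≤ localDensity P g 0)
    (hconv : a / 2 ≤ ∑ u, doubledWeight hodd P g u * weightedConv N h u) :
    a ^ 3 / 8 * Real.exp (-(2 * H)) * (Fintype.card G : ℝ) ^ 2 ≤ apCount h := by
  have hbh0 : 0 < localDensity N h 0 := (half_pos ha).trans_le hbh
  have hbg0 : 0 < localDensity P g 0 := (half_pos ha).trans_le hbg
  have hcount := sum_weightedConv_le_apCount hN hP h0 hbh0 g0 hgh
  rw [← localDensity_mul_sum_doubledWeight (hodd := hodd) hbg0.ne'] at hcount
  have hcube : a ^ 3 / 8 ≤ (Real.exp H / Fintype.card G) ^ 2 * apCount h :=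
    calc a ^ 3 / 8 = a / 2 * (a / 2 * (a / 2)) := by ring
      _ ≤ _ := by gcongr
      _ ≤ _ := hcount
  calc a ^ 3 / 8 * Real.exp (-(2 * H)) * (Fintype.card G : ℝ) ^ 2
      ≤ (Real.exp H / Fintype.card G) ^ 2 * apCount h * Real.exp (-(2 * H)) *
          (Fintype.card G : ℝ) ^ 2 := by gcongr
    _ = apCount h * (Real.exp H ^ 2 * Real.exp (-(2 * H))) := by field_simp
    _ = apCount h := by
        rw [← Real.exp_nat_mul, ← Real.exp_add, Nat.cast_ofNat, add_neg_cancel, Real.exp_zero,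
          mul_one]

end WeightedCount

section Step

variable {G : Type*} [AddCommGroup G] [Fintype G]

lemma isFiner_bohrSeminorm_add {θ H : ℝ} {m K L K' : ℕ} {Γ Δ : Multiset (AddChar G ℂ)}
    (hθ : 0 < θ) (hmθ : H + Real.log (1 / θ) ≤ m * θ)
    (hbig : Real.exp (-H) * Fintype.card G ≤ expMass (bohrSeminorm K' (Γ + Δ)))
    (hK : m * K ≤ K') (hL : m * L ≤ K') :
    IsFiner θ (bohrSeminorm K Γ + bohrSeminorm L Δ) (bohrSeminorm K' (Γ + Δ)) :=
  isFiner_of_le hθ (Nat.cast_nonneg m) hbig (fun x => by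
    rw [add_apply, mul_add, ← bohrSeminorm_mul, ← bohrSeminorm_mul,
      bohrSeminorm_add]
    exact add_le_add (bohrSeminorm_mono hK Γ x) (bohrSeminorm_mono hL Δ x)) hmθ

lemma isFiner_bohrSeminorm {θ H : ℝ} {m K K' : ℕ} {Γ : Multiset (AddChar G ℂ)}
    (hθ : 0 < θ) (hmθ : H + Real.log (1 / θ) ≤ m * θ)
    (hbig : Real.exp (-H) * Fintype.card G ≤ expMass (bohrSeminorm K' Γ)) (hK : m * K ≤ K') :
    IsFiner θ (bohrSeminorm K Γ) (bohrSeminorm K' Γ) :=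
  isFiner_of_le hθ (Nat.cast_nonneg m) hbig
    (fun x => (bohrSeminorm_mul m K Γ x).symm.trans_le (bohrSeminorm_mono hK Γ x)) hmθ

variable {a₀ a θ H : ℝ} {k l n K m : ℕ} {Γ : Multiset (AddChar G ℂ)} {h : G → ℝ}

lemma le_apCount_of_localDensity_le (hodd : Odd (Nat.card G)) (hpar : IncrementParams a₀ θ k l n)
    (ha₀ : a₀ ≤ a) (ha1 : a ≤ 1) (hK : 0 < K) (hm : 2 ≤ m)
    (hbig : ∀ (K' : ℕ) (Γ' : Multiset (AddChar G ℂ)), K' ≤ m ^ 5 * K → Γ'.card ≤ Γ.card + n →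
      Real.exp (-H) * Fintype.card G ≤ expMass (bohrSeminorm K' Γ'))
    (hmθ : H + Real.log (1 / θ) ≤ m * θ) (h0 : ∀ x, 0 ≤ h x) (h1 : ∀ x, h x ≤ 1)
    (hbN : (1 - 2 / 100) * a ≤ localDensity (bohrSeminorm (m * K) Γ) h 0)
    (hbP : (1 - 2 / 100) * a ≤ localDensity (bohrSeminorm (m ^ 2 * K) Γ) h 0)
    (hinc : ∀ Γ' : Multiset (AddChar G ℂ), Γ'.card ≤ Γ.card + n →
      ∀ x, localDensity (bohrSeminorm (m ^ 5 * K) Γ') h x ≤ (1 + 1 / 100) * a) :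
    a ^ 3 / 8 * Real.exp (-(2 * H)) * (Fintype.card G : ℝ) ^ 2 ≤ apCount h := by
  have hθ := hpar.θ_pos
  have ha := hpar.a_pos.trans_le ha₀
  have hpow : ∀ {i j : ℕ}, i ≤ j → m ^ i * K ≤ m ^ j * K := fun hij =>
    Nat.mul_le_mul_right K (Nat.pow_le_pow_right (by lia) hij)
  have hsucc : ∀ i, m * (m ^ i * K) ≤ m ^ (i + 1) * K := fun i => by rw [pow_succ', mul_assoc]
  have hmass : ∀ i ≤ 5, ∀ Γ' : Multiset (AddChar G ℂ), Γ'.card = Γ.card →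
      Real.exp (-H) * Fintype.card G ≤ expMass (bohrSeminorm (m ^ i * K) Γ') :=
    fun i hi Γ' hΓ' => hbig _ _ (hpow hi) (by lia)
  have hhalf := card_halfFreq Γ
  have hmassN := hmass 1 (by lia) Γ rfl
  rw [pow_one] at hmassN
  have hmassP := hmass 2 (by lia) Γ rfl
  have hNP : IsFiner θ (bohrSeminorm (m * K) Γ) (bohrSeminorm (m ^ 2 * K) Γ) :=
    isFiner_bohrSeminorm hθ hmθ hmassP (by rw [sq, mul_assoc])
  set g := {y | bohrSeminorm (m * K) Γ y ≤ θ}.indicator h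
  have g0 : ∀ y, 0 ≤ g y := Set.indicator_nonneg fun y _ => h0 y
  have hgh : ∀ y, g y ≤ h y := Set.indicator_le_self' fun y _ => h0 y
  have hgN : ∀ y, g y ≠ 0 → bohrSeminorm (m * K) Γ y ≤ θ := fun _ =>
    Set.mem_of_indicator_ne_zero
  have hbg : a / 2 ≤ localDensity (bohrSeminorm (m ^ 2 * K) Γ) g 0 := by
    linarith [hNP.localDensity_le_indicator_add h1, hpar.θ_le]
  refine le_apCount_of_half_le (hodd := hodd) ha hmassN hmassP h0 g0 hgh (by linarith) hbg ?_
  refine half_le_sum_mul_weightedConv hpar ha₀ ha1 h0 h1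
    (bohrSeminorm_le_halfFreq hodd ?_ Γ) (bohrSeminorm_mono (hpow (by lia : 2 ≤ 4)) _)
    (isFiner_bohrSeminorm hθ hmθ (hmass 3 (by lia) _ hhalf) (hsucc 2))
    (isFiner_bohrSeminorm hθ hmθ (hmass 4 (by lia) _ hhalf) (hsucc 3)) hbN
    (doubledWeight_mem_stdSimplex g0 (by linarith)) (fun u => ?_)
    (fun u => le_two_mul_of_doubledWeight_ne_zero hgN)
    fun Λ hΛ => ?_
  · rw [sq, mul_assoc]
    exact Nat.mul_le_mul_right _ hm
  · rw [← inv_div]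
    exact doubledWeight_bohrSeminorm_le (fun y => (hgh y).trans (h1 y)) (half_pos ha) hbg u
  · have hcard : (halfFreq Γ + Λ.val).card ≤ Γ.card + n := by
      rw [Multiset.card_add, hhalf]
      exact Nat.add_le_add_left hΛ _
    refine ⟨_, isFiner_bohrSeminorm_add hθ hmθ (hbig _ _ le_rfl hcard) (hsucc 4) ?_,
      hinc _ hcard⟩
    calc m * 1 ≤ m ^ 5 * K := Nat.mul_le_mul (Nat.le_self_pow (by lia) m) hK

lemma exists_increment_of_apCount_lt (hodd : Odd (Nat.card G))
    (hpar : IncrementParams a₀ θ k l n) (ha₀ : a₀ ≤ a) (hK : 0 < K) (hm : 2 ≤ m)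
    (hbig : ∀ (K' : ℕ) (Γ' : Multiset (AddChar G ℂ)), K' ≤ m ^ 5 * K → Γ'.card ≤ Γ.card + n →
      Real.exp (-H) * Fintype.card G ≤ expMass (bohrSeminorm K' Γ'))
    (hmθ : H + Real.log (1 / θ) ≤ m * θ) (h0 : ∀ x, 0 ≤ h x) (h1 : ∀ x, h x ≤ 1)
    {x₀ : G} (hx₀ : a ≤ localDensity (bohrSeminorm K Γ) h x₀)
    (hap : apCount h < a ^ 3 / 8 * Real.exp (-(2 * H)) * (Fintype.card G : ℝ) ^ 2) :
    ∃ K' : ℕ, 0 < K' ∧ K' ≤ m ^ 5 * K ∧ ∃ Γ' : Multiset (AddChar G ℂ), Γ'.card ≤ Γ.card + n ∧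
      ∃ x, (1 + 1 / 100) * a ≤ localDensity (bohrSeminorm K' Γ') h x := by
  by_contra! hinc
  have ha := hpar.a_pos.trans_le ha₀
  have ha1 : a ≤ 1 := hx₀.trans (localDensity_le_one _ h1 _)
  have hθ := hpar.θ_pos
  have hθa := hpar.θ_le
  have hm1 : m * K ≤ m ^ 5 * K := Nat.mul_le_mul_right K (Nat.le_self_pow (by lia) m)
  have hm2 : m ^ 2 * K ≤ m ^ 5 * K :=
    Nat.mul_le_mul_right K (Nat.pow_le_pow_right (by lia) (by lia))
  have hfin : ∀ K' ≤ m ^ 5 * K, m * K ≤ K' → IsFiner θ (bohrSeminorm K Γ) (bohrSeminorm K' Γ) :=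
    fun K' hK' => isFiner_bohrSeminorm hθ hmθ (hbig K' Γ hK' (by lia))
  obtain ⟨s, hsN, hsP⟩ := exists_simultaneous_localDensity (c := 1 / 100)
    (hfin (m * K) hm1 le_rfl)
    (hfin (m ^ 2 * K) hm2 (Nat.mul_le_mul_right K (Nat.le_self_pow (by lia) m)))
    hθ.le (by linarith) (by linarith) ha.le h0 hx₀
    (fun y => (hinc _ (by positivity) hm1 Γ (by lia) y).le)
    (fun y => (hinc _ (by positivity) hm2 Γ (by lia) y).le)
  refine hap.not_ge ?_
  rw [← apCount_translate h s]
  refine le_apCount_of_localDensity_le hodd hpar ha₀ ha1 hK hm hbig hmθ (fun x => h0 _)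
    (fun x => h1 _) ?_ ?_ fun Γ' hΓ' x => ?_ <;> rw [localDensity_translate]
  · rw [add_zero]
    linarith
  · rw [add_zero]
    linarith
  · exact (hinc _ (by positivity) le_rfl Γ' hΓ' _).le

end Step

section Iteration

variable {G : Type*} [AddCommGroup G] [Fintype G] {a θ H : ℝ} {k l n J m : ℕ} {h : G → ℝ}

lemma exists_iterated_increment (hodd : Odd (Nat.card G)) (hpar : IncrementParams a θ k l n)
    (hm : 2 ≤ m) (hmθ : H + Real.log (1 / θ) ≤ m * θ)
    (hbig : ∀ (K : ℕ) (Γ : Multiset (AddChar G ℂ)), K ≤ m ^ (5 * J) → Γ.card ≤ J * n →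
      Real.exp (-H) * Fintype.card G ≤ expMass (bohrSeminorm K Γ))
    (h0 : ∀ x, 0 ≤ h x) (h1 : ∀ x, h x ≤ 1) (ha : a ≤ localDensity (bohrSeminorm 1 0) h 0)
    (hap : apCount h < a ^ 3 / 8 * Real.exp (-(2 * H)) * (Fintype.card G : ℝ) ^ 2) :
    ∀ j ≤ J, ∃ K : ℕ, 0 < K ∧ K ≤ m ^ (5 * j) ∧ ∃ Γ : Multiset (AddChar G ℂ), Γ.card ≤ j * n ∧
      ∃ x, (1 + 1 / 100) ^ j * a ≤ localDensity (bohrSeminorm K Γ) h x := by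
  intro j
  induction j with
  | zero => exact fun _ => ⟨1, one_pos, by simp, 0, by simp, 0, by simpa using ha⟩
  | succ j ih =>
    intro hj
    obtain ⟨K, hK0, hK, Γ, hΓ, x, hx⟩ := ih (by lia)
    have hKm : m ^ 5 * K ≤ m ^ (5 * (j + 1)) :=
      calc m ^ 5 * K ≤ m ^ 5 * m ^ (5 * j) := Nat.mul_le_mul_left _ hK
        _ = m ^ (5 * (j + 1)) := by ring
    have hΓn : Γ.card + n ≤ (j + 1) * n := by
      rw [add_one_mul]
      exact Nat.add_le_add_right hΓ n
    have ha0 := hpar.a_pos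
    have haj : a ≤ (1 + 1 / 100) ^ j * a :=
      le_mul_of_one_le_left ha0.le (one_le_pow₀ (by norm_num))
    obtain ⟨K', hK'0, hK', Γ', hΓ', y, hy⟩ := exists_increment_of_apCount_lt hodd hpar haj hK0 hm
      (fun K' Γ' hK' hΓ' => hbig K' Γ'
        ((hK'.trans hKm).trans (Nat.pow_le_pow_right (by lia) (by lia)))
        ((hΓ'.trans hΓn).trans (Nat.mul_le_mul_right n hj)))
      hmθ h0 h1 hx (hap.trans_le (by gcongr))
    refine ⟨K', hK'0, hK'.trans hKm, Γ', hΓ'.trans hΓn, y, ?_⟩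
    rwa [pow_succ', mul_assoc]

lemma le_apCount_of_params (hodd : Odd (Nat.card G)) (hpar : IncrementParams a θ k l n)
    (hm : 2 ≤ m) (hmθ : H + Real.log (1 / θ) ≤ m * θ) (hJ : 1 < (1 + 1 / 100) ^ J * a)
    (hH : 1 + 2 * (J * n : ℕ) * Real.log (4 * (m ^ (5 * J) : ℕ) * (J * n : ℕ) + 3) ≤ H)
    (h0 : ∀ x, 0 ≤ h x) (h1 : ∀ x, h x ≤ 1) (ha : a ≤ localDensity (bohrSeminorm 1 0) h 0) :
    a ^ 3 / 8 * Real.exp (-(2 * H)) * (Fintype.card G : ℝ) ^ 2 ≤ apCount h := by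
  by_contra! hap
  obtain ⟨K, -, -, Γ, -, x, hx⟩ := exists_iterated_increment hodd hpar hm hmθ
    (fun K Γ hK hΓ => exp_neg_mul_card_le_expMass_bohrSeminorm hΓ (le_trans (by gcongr) hH))
    h0 h1 ha hap J le_rfl
  exact (hJ.trans_le hx).not_ge (localDensity_le_one (bohrSeminorm K Γ) h1 x)

end Iteration

section IncrementParams

variable {a L : ℝ}

lemma two_le_of_exp_eq (ha0 : 0 < a) (ha1 : a ≤ 1) (hL : Real.exp L = 8 / a) : 2 ≤ L := by
  rw [← Real.exp_le_exp, hL]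
  calc Real.exp 2 = Real.exp 1 ^ 2 := by rw [← Real.exp_nat_mul, Nat.cast_ofNat, mul_one]
    _ ≤ 2.7182818286 ^ 2 := by
        gcongr
        exact Real.exp_one_lt_d9.le
    _ ≤ 8 := by norm_num
    _ ≤ 8 / a := le_div_self (by norm_num) ha0 ha1

lemma exp_nat_mul_eq (hL : Real.exp L = 8 / a) (j : ℕ) : Real.exp (j * L) = (8 / a) ^ j := by
  rw [Real.exp_nat_mul, hL]

lemma le_of_exp_eq (hL : Real.exp L = 8 / a) : L ≤ 8 / a := by
  linarith [Real.add_one_le_exp L]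

lemma two_mul_quarter_pow_le {l : ℕ} (ha0 : 0 < a) (ha1 : a ≤ 1) (hL : Real.exp L = 8 / a)
    (hl : 3 * L ≤ l) : 2 * (1 / 4) ^ l ≤ a / 100 := by
  have hpow : (8 / a) ^ 3 ≤ 4 ^ l :=
    calc (8 / a) ^ 3 = Real.exp ((3 : ℕ) * L) := (exp_nat_mul_eq hL 3).symm
      _ ≤ Real.exp (l * 1) := by
          apply Real.exp_le_exp.2
          push_cast
          linarith
      _ = Real.exp 1 ^ l := Real.exp_nat_mul 1 l
      _ ≤ 4 ^ l := by
          gcongr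
          exact Real.exp_one_lt_d9.le.trans (by norm_num)
  have hcube : 200 / a ≤ (8 / a) ^ 3 := by
    rw [div_pow, div_le_div_iff₀ ha0 (by positivity)]
    linarith [pow_le_of_le_one ha0.le ha1 (n := 3) (by norm_num)]
  rw [one_div, inv_pow, ← div_eq_mul_inv, div_le_iff₀ (by positivity)]
  calc (2 : ℝ) = a / 100 * (200 / a) := by
        field_simp
        norm_num
    _ ≤ a / 100 * 4 ^ l := by
        gcongr
        exact hcube.trans hpow

lemma mul_exp_neg_le_sq {k l : ℕ} (ha0 : 0 < a) (ha1 : a ≤ 1) (hL : Real.exp L = 8 / a)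
    (hl0 : 0 < l) (hl : l ≤ 6 * L) (hk : 360000 * l ^ 2 * (7 * L) / a ≤ k) :
    9600 * l * Real.exp (-(k * (1 / (300 * l)) ^ 2 * a / 4)) ≤ a ^ 2 := by
  have hexponent : (7 : ℕ) * L ≤ k * (1 / (300 * l)) ^ 2 * a / 4 :=
    calc (7 : ℕ) * L = 360000 * l ^ 2 * (7 * L) / a * (1 / (300 * l)) ^ 2 * a / 4 := by
          push_cast
          field_simp
          ring
      _ ≤ _ := by gcongr
  have hexp : Real.exp (-(k * (1 / (300 * l)) ^ 2 * a / 4)) ≤ (a / 8) ^ 7 :=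
    calc _ ≤ Real.exp (-((7 : ℕ) * L)) := Real.exp_le_exp.2 (neg_le_neg hexponent)
      _ = (a / 8) ^ 7 := by rw [Real.exp_neg, exp_nat_mul_eq hL, ← inv_pow, inv_div]
  calc _ ≤ 9600 * (6 * (8 / a)) * (a / 8) ^ 7 := by
        have := le_of_exp_eq hL
        gcongr
        exact hl.trans (by gcongr)
    _ = (9600 * 48 / 8 ^ 7) * a ^ 6 := by
        field_simp
        norm_num
    _ ≤ 1 * a ^ 6 := by
        gcongr
        norm_num
    _ ≤ a ^ 2 := by
        rw [one_mul]
        exact pow_le_pow_of_le_one ha0.le ha1 (by norm_num)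

lemma mul_two_div_pow_lt_exp {k : ℕ} {x : ℝ} (ha0 : 0 < a) (ha1 : a ≤ 1)
    (hL : Real.exp L = 8 / a) (hx : 32 * ((k + 2) * L) ≤ x) :
    32 * (2 / a) ^ k < Real.exp (x / 32) := by
  have hsq : (32 : ℝ) < Real.exp ((2 : ℕ) * L) := by
    rw [exp_nat_mul_eq hL, div_pow, lt_div_iff₀ (by positivity)]
    linarith [pow_le_one₀ ha0.le ha1 (n := 2)]
  have hpow : (2 / a) ^ k ≤ Real.exp (k * L) := by
    rw [exp_nat_mul_eq hL]
    gcongr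
    norm_num
  calc 32 * (2 / a) ^ k < Real.exp ((2 : ℕ) * L) * Real.exp (k * L) :=
        mul_lt_mul_of_pos_of_nonneg' hsq hpow (by positivity) (by positivity)
    _ = Real.exp ((k + 2) * L) := by
        rw [← Real.exp_add]
        push_cast
        ring_nf
    _ ≤ Real.exp (x / 32) := Real.exp_le_exp.2 (by linarith)

lemma incrementParams_of_le {k l n : ℕ} {D : ℝ} (ha0 : 0 < a) (ha1 : a ≤ 1)
    (hL : Real.exp L = 8 / a) (hl3 : 3 * L ≤ l) (hl6 : l ≤ 6 * L) (hk0 : 0 < k)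
    (hk : 360000 * l ^ 2 * (7 * L) / a ≤ k) (hn : 32 * ((k + 2) * L) ≤ n)
    (hD : 4 * n + 4 * k + 4000 * l / a ≤ D) : IncrementParams a (1 / D) k l n := by
  have hl0 : (0 : ℝ) < l := by linarith [two_le_of_exp_eq ha0 ha1 hL]
  have hla : 0 < 4000 * (l : ℝ) / a := by positivity
  have : (0 : ℝ) ≤ k := by positivity
  have : (0 : ℝ) ≤ n := by positivity
  have hD0 : 0 < D := by linarith
  have hlD : 4000 * l ≤ D * a := (div_le_iff₀ ha0).1 (by linarith)
  have hl1 : (1 : ℝ) ≤ l := by exact_mod_cast (Nat.cast_pos.1 hl0)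
  exact {
    a_pos := ha0
    θ_pos := by positivity
    l_pos := Nat.cast_pos.1 hl0
    k_pos := hk0
    smoothing_le := two_mul_quarter_pow_le ha0 ha1 hL hl3
    sampling_le := mul_exp_neg_le_sq ha0 ha1 hL (Nat.cast_pos.1 hl0) hl6 hk
    spectrum_lt := mul_two_div_pow_lt_exp ha0 ha1 hL hn
    θ_mul_l_le := by
      rw [mul_one_div, div_mul_eq_mul_div, div_le_iff₀ hD0]
      linarith
    θ_mul_k_le := by
      rw [mul_one_div, div_le_iff₀ hD0]
      linarith
    θ_mul_n_le := by
      rw [mul_one_div, div_le_iff₀ hD0]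
      linarith
    θ_le := by
      rw [mul_one_div, div_le_iff₀ hD0]
      linarith }

lemma exists_incrementParams (ha0 : 0 < a) (ha1 : a ≤ 1) (hL : Real.exp L = 8 / a) :
    ∃ θ : ℝ, ∃ k l n : ℕ, IncrementParams a θ k l n ∧ n ≤ 10 ^ 12 * (L ^ 4 / a) ∧
      1 / θ ≤ 10 ^ 12 * (L ^ 4 / a) := by
  have hL2 := two_le_of_exp_eq ha0 ha1 hL
  have hceil : ∀ {x : ℝ}, 1 ≤ x → ⌈x⌉₊ ≤ 2 * x := fun hx => Nat.ceil_le_two_mul (by linarith)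
  have hLa : ∀ j ≤ 4, L ^ j / a ≤ L ^ 4 / a := fun j hj => by
    gcongr
    linarith
  have hLa3 : 1 ≤ L ^ 3 / a :=
    (one_le_pow₀ (by linarith)).trans (le_div_self (by positivity) ha0 ha1)
  set l : ℕ := ⌈3 * L⌉₊
  have hl3 : 3 * L ≤ l := Nat.le_ceil _
  have hl6 : l ≤ 6 * L := (hceil (by linarith)).trans_eq (by ring)
  have hl1 : (1 : ℝ) ≤ l := by linarith
  have hk1 : 1 ≤ 360000 * (l : ℝ) ^ 2 * (7 * L) / a := by
    refine le_trans ?_ (le_div_self (by positivity) ha0 ha1)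
    nlinarith [one_le_pow₀ hl1 (n := 2)]
  set k : ℕ := ⌈360000 * (l : ℝ) ^ 2 * (7 * L) / a⌉₊
  have hk : 360000 * (l : ℝ) ^ 2 * (7 * L) / a ≤ k := Nat.le_ceil _
  have hkL : k ≤ 2 * 10 ^ 8 * (L ^ 3 / a) :=
    calc (k : ℝ) ≤ 2 * (360000 * (l : ℝ) ^ 2 * (7 * L) / a) := hceil hk1
      _ ≤ 2 * (360000 * (6 * L) ^ 2 * (7 * L) / a) := by gcongr
      _ = 181440000 * (L ^ 3 / a) := by ring
      _ ≤ _ := mul_le_mul_of_nonneg_right (by norm_num) (by positivity)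
  have hk1' : (1 : ℝ) ≤ k := hk1.trans hk
  set n : ℕ := ⌈32 * (((k : ℝ) + 2) * L)⌉₊
  have hnL : n ≤ 4 * 10 ^ 10 * (L ^ 4 / a) :=
    calc (n : ℝ) ≤ 2 * (32 * (((k : ℝ) + 2) * L)) := hceil (by nlinarith)
      _ ≤ 2 * (32 * (3 * (2 * 10 ^ 8 * (L ^ 3 / a)) * L)) := by
          gcongr
          linarith
      _ = 384 * 10 ^ 8 * (L ^ 4 / a) := by ring
      _ ≤ _ := mul_le_mul_of_nonneg_right (by norm_num) (by positivity)
  have hla : 4000 * (l : ℝ) / a ≤ 24000 * (L ^ 1 / a) :=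
    calc 4000 * (l : ℝ) / a ≤ 4000 * (6 * L) / a := by gcongr
      _ = _ := by ring
  refine ⟨_, k, l, n, incrementParams_of_le ha0 ha1 hL hl3 hl6 (by exact_mod_cast hk1') hk
    (Nat.le_ceil _) le_rfl, by linarith, ?_⟩
  rw [one_div_one_div]
  linarith [hLa 1 (by norm_num), hLa 3 (by norm_num)]

lemma exists_one_lt_pow_mul (ha0 : 0 < a) (ha1 : a ≤ 1) (hL : Real.exp L = 8 / a) :
    ∃ J : ℕ, 1 < (1 + 1 / 100) ^ J * a ∧ J ≤ 400 * L := by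
  have hL2 := two_le_of_exp_eq ha0 ha1 hL
  refine ⟨⌈200 * L⌉₊, ?_, (Nat.ceil_le_two_mul (by linarith)).trans_eq (by ring)⟩
  have hpow : 8 / a ≤ (1 + 1 / 100) ^ ⌈200 * L⌉₊ :=
    calc 8 / a = Real.exp L := hL.symm
      _ ≤ Real.exp (⌈200 * L⌉₊ * (1 / 200)) :=
          Real.exp_le_exp.2 (by linarith [Nat.le_ceil (200 * L)])
      _ = Real.exp (1 / 200) ^ ⌈200 * L⌉₊ := Real.exp_nat_mul _ _
      _ ≤ (1 + 1 / 100) ^ ⌈200 * L⌉₊ := by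
          gcongr
          exact (exp_le_one_add_two_mul_of_le le_rfl (by norm_num) (by norm_num)).trans_eq
            (by norm_num)
  rw [div_le_iff₀ ha0] at hpow
  linarith

end IncrementParams

section Scale

lemma exists_ge_affine_log (A B : ℝ) : ∃ x : ℝ, 1 ≤ x ∧ A + B * Real.log x ≤ x := by
  have hlog := (Real.isLittleO_log_id_atTop.const_mul_left B).def (one_half_pos (α := ℝ))
  obtain ⟨x, hx, hx1, hxA⟩ := (hlog.and ((Filter.eventually_ge_atTop 1).and
    (Filter.eventually_ge_atTop (2 * A)))).exists
  rw [Real.norm_eq_abs, id, Real.norm_eq_abs, abs_of_nonneg (zero_le_one.trans hx1)] at hx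
  exact ⟨x, hx1, by linarith [le_abs_self (B * Real.log x)]⟩

lemma exists_nat_scale {C C₀ E H θ : ℝ} (hC : 1 ≤ C) (hC₀ : 1 ≤ C₀) (hE : 1 ≤ E) (hH0 : 0 ≤ H)
    (hH : H ≤ C₀ * E ^ 8) (hθ : 0 < θ) (hθE : 1 / θ ≤ C * E ^ 5) :
    ∃ m : ℕ, 2 ≤ m ∧ H + Real.log (1 / θ) ≤ m * θ ∧ m ≤ 5 * C ^ 2 * C₀ * E ^ 13 := by
  refine ⟨⌈(H + C * E ^ 5) * (1 / θ)⌉₊ + 2, by lia, ?_, ?_⟩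
  · calc H + Real.log (1 / θ) ≤ H + C * E ^ 5 := by
          gcongr
          exact (Real.log_le_self (by positivity)).trans hθE
      _ = (H + C * E ^ 5) * (1 / θ) * θ := by field_simp
      _ ≤ _ := by
          gcongr
          push_cast
          linarith [Nat.le_ceil ((H + C * E ^ 5) * (1 / θ))]
  · have hone : 1 ≤ C ^ 2 * C₀ * E ^ 13 :=
      one_le_mul_of_one_le_of_one_le (one_le_mul_of_one_le_of_one_le (one_le_pow₀ hC) hC₀)
        (one_le_pow₀ hE)
    have hprod : (H + C * E ^ 5) * (1 / θ) ≤ 2 * (C ^ 2 * C₀ * E ^ 13) :=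
      calc (H + C * E ^ 5) * (1 / θ) ≤ (C₀ * E ^ 8 + C * E ^ 5) * (C * E ^ 5) := by gcongr
        _ = C ^ 1 * C₀ * E ^ 13 + C ^ 2 * 1 * E ^ 10 := by ring
        _ ≤ C ^ 2 * C₀ * E ^ 13 + C ^ 2 * C₀ * E ^ 13 := by
            gcongr
            · exact one_le_two
            · norm_num
        _ = _ := by ring
    push_cast
    linarith [Nat.ceil_lt_add_one (show 0 ≤ (H + C * E ^ 5) * (1 / θ) by positivity)]

lemma log_le_of_le_mul_exp_pow {B L x : ℝ} {j : ℕ} (hB : 1 ≤ B) (hL : 1 ≤ L) (hx0 : 0 < x)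
    (hx : x ≤ B * Real.exp L ^ j) : Real.log x ≤ (Real.log B + j) * L :=
  calc Real.log x ≤ Real.log (B * Real.exp L ^ j) := Real.log_le_log hx0 hx
    _ = Real.log B + j * L := by
        rw [Real.log_mul (by positivity) (by positivity), Real.log_pow, Real.log_exp]
    _ ≤ Real.log B * L + j * L := by
        gcongr
        exact le_mul_of_one_le_right (Real.log_nonneg hB) hL
    _ = _ := by ring

lemma log_four_mul_pow_mul_add_three_le {C q L : ℝ} {m J N : ℕ} (hC : 1 ≤ C) (hL : 1 ≤ L)
    (hm : 0 < m) (hmq : Real.log m ≤ q * L) (hJ : J ≤ 400 * L)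
    (hN : N ≤ 400 * C * Real.exp L ^ 6) :
    Real.log (4 * (m ^ (5 * J) : ℕ) * N + 3) ≤ (2000 * q + Real.log (1603 * C) + 6) * L ^ 2 := by
  have hE : 1 ≤ Real.exp L := Real.one_le_exp (by linarith)
  have : 0 ≤ Real.log m := Real.log_natCast_nonneg m
  have hpow : (1 : ℝ) ≤ (m : ℝ) ^ (5 * J) := one_le_pow₀ (by exact_mod_cast hm)
  have hN' : 4 * (N : ℝ) + 3 ≤ 1603 * C * Real.exp L ^ 6 := by
    linarith [one_le_mul_of_one_le_of_one_le hC (one_le_pow₀ hE (n := 6))]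
  have hlogN := log_le_of_le_mul_exp_pow (by linarith) hL (by positivity) hN'
  have hlogC : 0 ≤ Real.log (1603 * C) := Real.log_nonneg (by linarith)
  have hJm : J * Real.log m ≤ 400 * L * (q * L) := by gcongr
  calc Real.log (4 * (m ^ (5 * J) : ℕ) * N + 3)
      ≤ Real.log ((m : ℝ) ^ (5 * J) * (4 * N + 3)) := by
        refine Real.log_le_log (by positivity) ?_
        push_cast
        linarith
    _ = 5 * (J * Real.log m) + Real.log (4 * N + 3) := by
        rw [Real.log_mul (by positivity) (by positivity), Real.log_pow]
        push_cast
        ring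
    _ ≤ 5 * (400 * L * (q * L)) + (Real.log (1603 * C) + 6) * L := by
        gcongr
        exact_mod_cast hlogN
    _ ≤ 5 * (400 * L * (q * L)) + (Real.log (1603 * C) + 6) * L ^ 2 := by
        gcongr
        exact le_self_pow₀ hL two_ne_zero
    _ = _ := by ring

lemma pow_div_le_exp_pow {a L : ℝ} (ha0 : 0 < a) (hL0 : 0 ≤ L) (hL : Real.exp L = 8 / a) (j : ℕ) :
    L ^ j / a ≤ Real.exp L ^ (j + 1) :=
  calc L ^ j / a = L ^ j * (1 / a) := by ring
    _ ≤ Real.exp L ^ j * Real.exp L := by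
        gcongr
        · linarith [Real.add_one_le_exp L]
        · rw [hL]
          gcongr
          norm_num
    _ = Real.exp L ^ (j + 1) := (pow_succ _ _).symm

lemma exists_scale_and_size {C : ℝ} (hC : 1 ≤ C) : ∃ C₀ : ℝ, 1 ≤ C₀ ∧
    ∀ {a L θ : ℝ} {n J : ℕ}, 0 < a → a ≤ 1 → Real.exp L = 8 / a → 0 < θ →
      n ≤ C * (L ^ 4 / a) → 1 / θ ≤ C * (L ^ 4 / a) → J ≤ 400 * L →
      ∃ m : ℕ, 2 ≤ m ∧ C₀ * (L ^ 7 / a) + Real.log (1 / θ) ≤ m * θ ∧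
        1 + 2 * (J * n : ℕ) * Real.log (4 * (m ^ (5 * J) : ℕ) * (J * n : ℕ) + 3) ≤
          C₀ * (L ^ 7 / a) := by
  obtain ⟨C₀, hC₀, hle⟩ := exists_ge_affine_log
    (1 + 800 * C * (2000 * (Real.log (5 * C ^ 2) + 13) + Real.log (1603 * C) + 6))
    (800 * C * 2000)
  refine ⟨C₀, hC₀, fun {a L θ n J} ha0 ha1 hL hθ hn hθL hJ => ?_⟩
  have hL2 := two_le_of_exp_eq ha0 ha1 hL
  have hE : 1 ≤ Real.exp L := Real.one_le_exp (by linarith)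
  have hpoly := pow_div_le_exp_pow ha0 (by linarith) hL
  obtain ⟨m, hm2, hmθ, hm⟩ := exists_nat_scale (H := C₀ * (L ^ 7 / a)) hC hC₀ hE (by positivity)
    (by gcongr; exact hpoly 7) hθ (hθL.trans (by gcongr; exact hpoly 4))
  refine ⟨m, hm2, hmθ, ?_⟩
  have hC2 : 1 ≤ C ^ 2 := one_le_pow₀ hC
  have hlogm := log_le_of_le_mul_exp_pow (by nlinarith) (by linarith)
    (Nat.cast_pos.2 (by lia : 0 < m)) hm
  rw [Real.log_mul (by positivity) (by positivity)] at hlogm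
  have hJn : ((J * n : ℕ) : ℝ) ≤ 400 * C * (L ^ 5 / a) := by
    push_cast
    calc (J : ℝ) * n ≤ 400 * L * (C * (L ^ 4 / a)) := by gcongr
      _ = _ := by ring
  have hlog := log_four_mul_pow_mul_add_three_le hC (by linarith) (by lia) hlogm hJ
    (hJn.trans (by gcongr; exact hpoly 5))
  have hlog0 : 0 ≤ Real.log (4 * ((m ^ (5 * J) : ℕ) : ℝ) * (J * n : ℕ) + 3) :=
    Real.log_nonneg (le_add_of_nonneg_of_le (by positivity) (by norm_num))
  set r := 2000 * (Real.log (5 * C ^ 2) + Real.log C₀ + (13 : ℕ)) + Real.log (1603 * C) + 6 with hr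
  calc 1 + 2 * ((J * n : ℕ) : ℝ) * Real.log (4 * (m ^ (5 * J) : ℕ) * (J * n : ℕ) + 3)
      ≤ L ^ 7 / a + 2 * (400 * C * (L ^ 5 / a)) * (r * L ^ 2) := by
        gcongr
        exact (one_le_pow₀ (by linarith)).trans (le_div_self (by positivity) ha0 ha1)
    _ = (1 + 800 * C * r) * (L ^ 7 / a) := by ring
    _ ≤ C₀ * (L ^ 7 / a) := by
        gcongr
        rw [hr]
        push_cast
        linarith

/-- Here `J` is the number of iterations, `m` the ratio of consecutive scales and `C₀ * (L ^ 7 / a)`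
the exponent in the lower bound for the mass of every Bohr weight that occurs. -/
lemma exists_iteration_params : ∃ C₀ : ℝ, 1 ≤ C₀ ∧
    ∀ {a L : ℝ}, 0 < a → a ≤ 1 → Real.exp L = 8 / a → ∃ θ : ℝ, ∃ k l n J m : ℕ,
      IncrementParams a θ k l n ∧ 2 ≤ m ∧ C₀ * (L ^ 7 / a) + Real.log (1 / θ) ≤ m * θ ∧
        1 < (1 + 1 / 100) ^ J * a ∧
        1 + 2 * (J * n : ℕ) * Real.log (4 * (m ^ (5 * J) : ℕ) * (J * n : ℕ) + 3) ≤
          C₀ * (L ^ 7 / a) := by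
  obtain ⟨C₀, hC₀, hscale⟩ := exists_scale_and_size (C := 10 ^ 12) (by norm_num)
  refine ⟨C₀, hC₀, fun {a L} ha0 ha1 hL => ?_⟩
  obtain ⟨θ, k, l, n, hpar, hn, hθ⟩ := exists_incrementParams ha0 ha1 hL
  obtain ⟨J, hJ, hJL⟩ := exists_one_lt_pow_mul ha0 ha1 hL
  obtain ⟨m, hm, hmθ, hsize⟩ := hscale ha0 ha1 hL hpar.θ_pos hn hθ hJL
  exact ⟨θ, k, l, n, J, m, hpar, hm, hmθ, hJ, hsize⟩

end Scale

section DensityBasic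

variable {G : Type*} [Fintype G]

lemma density_le_one (A : Finset G) : density A ≤ 1 :=
  div_le_one_of_le₀ (by exact_mod_cast card_le_univ A) (Nat.cast_nonneg _)

lemma card_eq_density_mul [Nonempty G] (A : Finset G) :
    (A.card : ℝ) = density A * Fintype.card G :=
  (div_mul_cancel₀ _ (by positivity)).symm

end DensityBasic

section Counting

variable {G : Type*} [AddCommGroup G] {A : Finset G}

lemma threeAPCount_eq_card_filter [DecidableEq G] (A : Finset G) :
    threeAPCount A A A = #{p ∈ A ×ˢ A | 2 • p.1 - p.2 ∈ A} := by
  refine card_bij' (fun p _ => (p.2.1, p.1)) (fun p _ => (p.2, p.1, 2 • p.1 - p.2)) ?_ ?_ ?_ ?_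
  · rintro ⟨x, y, z⟩ hp
    simp only [mem_filter, mem_product] at hp ⊢
    obtain ⟨⟨hx, hy, hz⟩, hxz⟩ := hp
    exact ⟨⟨hy, hx⟩, by rwa [← hxz, add_sub_cancel_left]⟩
  · rintro ⟨y, x⟩ hp
    simp only [mem_filter, mem_product] at hp ⊢
    exact ⟨⟨hp.1.2, hp.1.1, hp.2⟩, add_sub_cancel _ _⟩
  · rintro ⟨x, y, z⟩ hp
    simp only [mem_filter, mem_product] at hp
    simp only [← hp.2, add_sub_cancel_left]
  · exact fun _ _ => rfl

lemma apCount_indicator [Fintype G] [DecidableEq G] (A : Finset G) :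
    apCount (fun x => if x ∈ A then (1 : ℝ) else 0) = threeAPCount A A A := by
  have hprod : apCount (fun x => if x ∈ A then (1 : ℝ) else 0) =
      ∑ y, ∑ x, if (y ∈ A ∧ x ∈ A) ∧ 2 • y - x ∈ A then (1 : ℝ) else 0 := by
    simp only [apCount, ite_zero_mul_ite_zero, mul_one, and_assoc]
  rw [hprod, ← Fintype.sum_prod_type' (f := fun y x =>
    if (y ∈ A ∧ x ∈ A) ∧ 2 • y - x ∈ A then (1 : ℝ) else 0), sum_boole,
    threeAPCount_eq_card_filter]
  congr 2
  ext p
  simp only [mem_filter, mem_univ, mem_product, true_and]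

lemma localDensity_bohrSeminorm_one_zero [Fintype G] (h : G → ℝ) :
    localDensity (bohrSeminorm 1 0) h 0 = (∑ x, h x) / Fintype.card G := by
  simp [localDensity, expWeight, expMass, bohrSeminorm_apply, mul_sum, div_eq_inv_mul]

lemma localDensity_indicator [Fintype G] [DecidableEq G] (A : Finset G) :
    localDensity (bohrSeminorm 1 0) (fun x => if x ∈ A then (1 : ℝ) else 0) 0 = density A := by
  simp [localDensity_bohrSeminorm_one_zero, density]

lemma threeAPCount_le_card_of_not_hasNontrivialThreeAP [DecidableEq G]
    (hA : ¬ HasNontrivialThreeAP A) : threeAPCount A A A ≤ A.card := by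
  have htriv : ∀ {x y z}, x ∈ A → y ∈ A → z ∈ A → x + z = 2 • y → x = y ∧ y = z := by
    intro x y z hx hy hz hxz
    by_contra hne
    exact hA ⟨x, hx, y, hy, z, hz, hxz, hne⟩
  calc threeAPCount A A A ≤ (A.image fun x => (x, x, x)).card := by
        refine card_le_card ?_
        rintro ⟨x, y, z⟩ hp
        simp only [mem_filter, mem_product] at hp
        obtain ⟨rfl, rfl⟩ := htriv hp.1.1 hp.1.2.1 hp.1.2.2 hp.2
        exact mem_image_of_mem _ hp.1.1
    _ ≤ A.card := card_image_le

lemma log_card_le_of_not_hasNontrivialThreeAP [DecidableEq G] {E : ℝ} (hA : A.Nonempty)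
    (hno : ¬ HasNontrivialThreeAP A)
    (hE : Real.exp (-E) * (A.card : ℝ) ^ 2 ≤ threeAPCount A A A) : Real.log A.card ≤ E := by
  have hA0 : (0 : ℝ) < A.card := by exact_mod_cast hA.card_pos
  have htriv : (threeAPCount A A A : ℝ) ≤ A.card := by
    exact_mod_cast threeAPCount_le_card_of_not_hasNontrivialThreeAP hno
  have hle : Real.exp (-E) * A.card ≤ 1 := by
    refine le_of_mul_le_mul_right ?_ hA0
    rw [mul_assoc, ← sq, one_mul]
    exact hE.trans htriv
  rw [Real.log_le_iff_le_exp hA0]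
  rwa [Real.exp_neg, ← div_eq_inv_mul, div_le_one (Real.exp_pos E)] at hle

end Counting

section Bounds

variable {a : ℝ}

lemma log_eight_div_le (ha0 : 0 < a) (ha1 : a ≤ 1) :
    Real.log (8 / a) ≤ 3 * Real.log (2 / a) :=
  calc Real.log (8 / a) ≤ Real.log ((2 / a) ^ 3) := by
        refine Real.log_le_log (by positivity) ?_
        rw [div_pow, div_le_div_iff₀ ha0 (by positivity)]
        linarith [pow_le_of_le_one ha0.le ha1 (n := 3) (by norm_num)]
    _ = 3 * Real.log (2 / a) := by rw [Real.log_pow, Nat.cast_ofNat]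

lemma exp_neg_mul_log_pow_le {C₀ : ℝ} (hC₀ : 0 ≤ C₀) (ha0 : 0 < a) (ha1 : a ≤ 1) :
    Real.exp (-(2187 * (2 * C₀ + 3) * a⁻¹ * Real.log (2 / a) ^ 7)) ≤
      a ^ 3 / 8 * Real.exp (-(2 * (C₀ * (Real.log (8 / a) ^ 7 / a)))) := by
  have hexp : Real.exp (Real.log (8 / a)) = 8 / a := Real.exp_log (by positivity)
  have hL2 := two_le_of_exp_eq ha0 ha1 hexp
  have hlog := log_eight_div_le ha0 ha1
  set L := Real.log (8 / a)
  have hcube : Real.exp (-((3 : ℕ) * L)) ≤ a ^ 3 / 8 := by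
    rw [Real.exp_neg, exp_nat_mul_eq hexp, ← inv_pow, inv_div, div_pow]
    gcongr
    norm_num
  have hL7 : L ≤ L ^ 7 / a :=
    (le_self_pow₀ (by linarith) (by norm_num)).trans (le_div_self (by positivity) ha0 ha1)
  have hexponent : (3 : ℕ) * L + 2 * (C₀ * (L ^ 7 / a)) ≤
      2187 * (2 * C₀ + 3) * a⁻¹ * Real.log (2 / a) ^ 7 :=
    calc _ ≤ (3 : ℕ) * (L ^ 7 / a) + 2 * (C₀ * (L ^ 7 / a)) := by gcongr
      _ = (2 * C₀ + 3) * a⁻¹ * L ^ 7 := by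
          push_cast
          ring
      _ ≤ (2 * C₀ + 3) * a⁻¹ * (3 * Real.log (2 / a)) ^ 7 := by gcongr
      _ = _ := by ring
  calc _ ≤ Real.exp (-((3 : ℕ) * L) + -(2 * (C₀ * (L ^ 7 / a)))) := by
        rw [← neg_add]
        exact Real.exp_le_exp.2 (neg_le_neg hexponent)
    _ ≤ _ := by
        rw [Real.exp_add]
        gcongr

theorem exists_exp_mul_sq_le_threeAPCount : ∃ C > (0 : ℝ),
    ∀ (G : Type*) [AddCommGroup G] [Fintype G] [DecidableEq G], Odd (Fintype.card G) →
      ∀ (A : Finset G) (α : ℝ), density A = α → 0 < α →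
        Real.exp (-(C * α⁻¹ * Real.log (2 / α) ^ 7)) * (A.card : ℝ) ^ 2 ≤
          (threeAPCount A A A : ℝ) := by
  obtain ⟨C₀, hC₀, hparams⟩ := exists_iteration_params
  refine ⟨2187 * (2 * C₀ + 3), by positivity, ?_⟩
  rintro G _ _ _ hodd A α rfl hα0
  have hα1 := density_le_one A
  obtain ⟨θ, k, l, n, J, m, hpar, hm, hmθ, hJ, hH⟩ := hparams hα0 hα1 (Real.exp_log (by positivity))
  rw [← Nat.card_eq_fintype_card] at hodd
  have hcount := le_apCount_of_params hodd hpar hm hmθ hJ hH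
    (h := fun x => if x ∈ A then (1 : ℝ) else 0) (fun _ => by positivity)
    (fun _ => by split_ifs <;> norm_num) (localDensity_indicator A).ge
  rw [apCount_indicator] at hcount
  refine le_trans ?_ hcount
  gcongr
  · exact exp_neg_mul_log_pow_le (by linarith) hα0 hα1
  · exact_mod_cast card_le_univ A

end Bounds

section Density

lemma le_log_log_of_seventeen_le {x : ℝ} (hx : 17 ≤ x) : 101 / 100 ≤ Real.log (Real.log x) := by
  have hlog17 : 275 / 100 ≤ Real.log 17 := by
    rw [Real.le_log_iff_exp_le (by norm_num), ← pow_le_pow_iff_left₀ (by positivity) (by norm_num)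
      (show (4 : ℕ) ≠ 0 by norm_num)]
    calc Real.exp (275 / 100) ^ 4 = Real.exp 1 ^ 11 := by
          rw [← Real.exp_nat_mul, ← Real.exp_nat_mul]
          norm_num
      _ ≤ 2.7182818286 ^ 11 := by
          gcongr
          exact Real.exp_one_lt_d9.le
      _ ≤ 17 ^ 4 := by norm_num
  have hexp : Real.exp (101 / 100) ≤ 275 / 100 := by
    rw [← pow_le_pow_iff_left₀ (by positivity) (by norm_num) (show (100 : ℕ) ≠ 0 by norm_num)]
    calc Real.exp (101 / 100) ^ 100 = Real.exp 1 ^ 101 := by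
          rw [← Real.exp_nat_mul, ← Real.exp_nat_mul]
          norm_num
      _ ≤ 2.7182818286 ^ 101 := by
          gcongr
          exact Real.exp_one_lt_d9.le
      _ ≤ (275 / 100) ^ 100 := by norm_num
  have hlog : Real.log 17 ≤ Real.log x := Real.log_le_log (by norm_num) hx
  rw [Real.le_log_iff_exp_le (by linarith)]
  exact hexp.trans (hlog17.trans hlog)

lemma two_mul_le_exp {y : ℝ} (hy : 1 ≤ y) : 2 * y ≤ Real.exp y :=
  calc 2 * y ≤ Real.exp 1 * Real.exp (y - 1) := by
        gcongr
        · linarith [Real.add_one_le_exp 1]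
        · linarith [Real.add_one_le_exp (y - 1)]
    _ = Real.exp y := by rw [← Real.exp_add, add_sub_cancel]

/-- With `a = y ^ (7 + t) / exp y` the left side is about `128 * C * exp y / y ^ t`. -/
lemma mul_log_pow_lt_of_div_exp_le {C a c y : ℝ} {t : ℕ} (hC : 0 ≤ C) (hc : 1 ≤ c)
    (ht : 256 * C < c ^ t) (hy : c ≤ y) (ha1 : a ≤ 1) (ha : y ^ (7 + t) / Real.exp y ≤ a) :
    C * a⁻¹ * Real.log (2 / a) ^ 7 < Real.exp y + Real.log a := by
  have hy1 : 1 ≤ y := hc.trans hy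
  have ha0 : 0 < a := lt_of_lt_of_le (by positivity) ha
  have hloga : -y ≤ Real.log a := by
    rw [Real.le_log_iff_exp_le ha0, Real.exp_neg, ← one_div]
    exact le_trans (by gcongr; exact one_le_pow₀ hy1) ha
  have hlog2 : Real.log (2 / a) ≤ 2 * y := by
    rw [Real.log_div two_ne_zero ha0.ne']
    linarith [Real.log_two_lt_d9]
  have hlog0 : 0 ≤ Real.log (2 / a) := Real.log_nonneg ((one_le_div ha0).2 (by linarith))
  have hainv : a⁻¹ ≤ Real.exp y / y ^ (7 + t) := by
    rwa [inv_le_comm₀ ha0 (by positivity), inv_div]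
  have hyt : 128 * C / y ^ t < 1 / 2 := by
    rw [div_lt_iff₀ (by positivity)]
    linarith [pow_le_pow_left₀ (by linarith) hy t]
  calc C * a⁻¹ * Real.log (2 / a) ^ 7 ≤ C * (Real.exp y / y ^ (7 + t)) * (2 * y) ^ 7 := by gcongr
    _ = Real.exp y * (128 * C / y ^ t) := by
        rw [pow_add]
        field_simp
        norm_num
    _ < Real.exp y * (1 / 2) := by gcongr
    _ ≤ Real.exp y + Real.log a := by linarith [two_mul_le_exp hy1]

theorem exists_hasNontrivialThreeAP_of_density : ∃ C₃ > (0 : ℝ),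
    ∀ (G : Type*) [AddCommGroup G] [Fintype G], Odd (Fintype.card G) →
      17 ≤ Fintype.card G → ∀ (A : Finset G) (α : ℝ), density A = α →
        Real.log (Real.log (Fintype.card G)) ^ C₃ / Real.log (Fintype.card G) ≤ α →
          HasNontrivialThreeAP A := by
  obtain ⟨C, hC, hcount⟩ := exists_exp_mul_sq_le_threeAPCount
  obtain ⟨t, ht⟩ := pow_unbounded_of_one_lt (256 * C) (show (1 : ℝ) < 101 / 100 by norm_num)
  refine ⟨(7 + t : ℕ), by positivity, ?_⟩
  rintro G _ _ hodd hcard A α rfl hα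
  classical
  by_contra hno
  have hloglog := le_log_log_of_seventeen_le (x := Fintype.card G) (by exact_mod_cast hcard)
  have hlog : 0 < Real.log (Fintype.card G) := Real.log_pos (by exact_mod_cast (by lia))
  have hα0 : 0 < density A := lt_of_lt_of_le (by positivity) hα
  have hA : A.Nonempty := nonempty_of_ne_empty fun hA => by simp [density, hA] at hα0
  rw [Real.rpow_natCast] at hα
  have hlt := mul_log_pow_lt_of_div_exp_le hC.le (by norm_num) ht hloglog (density_le_one A)
    (by rwa [Real.exp_log hlog])
  have hle := log_card_le_of_not_hasNontrivialThreeAP hA hno (hcount G hodd A _ rfl hα0)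
  rw [card_eq_density_mul, Real.log_mul hα0.ne' (by positivity)] at hle
  rw [Real.exp_log hlog] at hlt
  linarith

end Density

theorem theorem2 :
    (∃ C₁ > (0 : ℝ), ∃ C₂ > (0 : ℝ),
      ∀ (G : Type*) [AddCommGroup G] [Fintype G] [DecidableEq G], Odd (Fintype.card G) →
        ∀ (A : Finset G) (α : ℝ), density A = α → 0 < α →
          Real.exp (-(C₁ * α⁻¹ * Real.log (2 / α) ^ C₂)) * (A.card : ℝ) ^ 2
            ≤ (threeAPCount A A A : ℝ)) ∧
    (∃ C₃ > (0 : ℝ),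
      ∀ (G : Type*) [AddCommGroup G] [Fintype G], Odd (Fintype.card G) →
        17 ≤ Fintype.card G →
        ∀ (A : Finset G) (α : ℝ), density A = α →
          Real.log (Real.log (Fintype.card G)) ^ C₃ / Real.log (Fintype.card G) ≤ α →
            HasNontrivialThreeAP A) := by
  refine ⟨?_, exists_hasNontrivialThreeAP_of_density⟩
  obtain ⟨C, hC, hcount⟩ := exists_exp_mul_sq_le_threeAPCount
  refine ⟨C, hC, (7 : ℕ), by norm_num, fun G _ _ _ hodd A α hA hα => ?_⟩
  rw [Real.rpow_natCast]
  exact hcount G hodd A α hA hα
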